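/- Let $k$ be an algebraically closed field, let $n, d \ge 0$ be integers, and let $F_0,\dots,F_n \in k[X_0,\dots,X_n]$ be homogeneous polynomials of degree $d$ whose common zero locus in $\mathbb{P}^n_k$ is a finite set of points. Assume that the rational map $f=(F_0:\cdots:F_n):\mathbb{P}^n_k \dashrightarrow \mathbb{P}^n_k$, defined outside this finite set, is dominant. Let $\deg f = [k(\mathbb{P}^n): f^*k(\mathbb{P}^n)]$ be its degree, let $E_f \subset \mathbb{P}^n_k$ be the closed subscheme cut out by $F_0,\dots,F_n$, and let $\delta = \sum_{Q\in E_f} \operatorname{length} \mathcal{O}_{E_f,Q}$ be its total length. Then $$\deg f \le d^n - \delta .$$ Moreover, the following are equivalent: (a) $\deg f = d^n - \delta$; (b) $E_f$ is a local complete intersection, i.e. for every point $Q$ of $E_f$ the ideal of $E_f$ in $\mathcal{O}_{\mathbb{P}^n,Q}$ is generated by a regular sequence; (c) $E_f$ is Gorenstein, i.e. for every point $Q$ of $E_f$ the local ring $\mathcal{O}_{E_f,Q}$ is Gorenstein. In particular, equality $\deg f = d^n-\delta$ holds if $\operatorname{length}\mathcal{O}_{E_f,Q}\in\{1,2\}$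 for every point $Q$ of $E_f$. -/

import Mathlib

noncomputable section

namespace ProjRat

open MvPolynomial CategoryTheory

universe u

/-- The grading of `k[X₀, …, Xₙ]` by total degree. -/
abbrev grading (k : Type u) [Field k] (n : ℕ) : ℕ → Submodule k (MvPolynomial (Fin (n + 1)) k) :=
  homogeneousSubmodule (Fin (n + 1)) k

instance (k : Type u) [Field k] (n : ℕ) : GradedAlgebra (grading k n) :=
  MvPolynomial.gradedAlgebra

/-- Projective space `ℙⁿ` over `k`: the relevant homogeneous primes of `k[X₀, …, Xₙ]`, with the
Zariski topology. -/
abbrev PSpace (k : Type u) [Field k] (n : ℕ) : Type u := ProjectiveSpectrum (grading k n)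

/-- The local ring of `ℙⁿ` at `Q`: fractions `G / H` of forms of the same degree, `H ∉ Q`. -/
abbrev LocalRing {k : Type u} [Field k] {n : ℕ} (Q : PSpace k n) : Type u :=
  HomogeneousLocalization.AtPrime (grading k n) Q.asHomogeneousIdeal.toIdeal

section Forms

variable {k : Type u} [Field k] {n : ℕ}

/-- The set of points of the subscheme `E_f` cut out by the forms `F₀, …, Fₙ`. -/
def baseLocus (F : Fin (n + 1) → MvPolynomial (Fin (n + 1)) k) : Set (PSpace k n) :=
  ProjectiveSpectrum.zeroLocus (grading k n) (Set.range F)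

/-- The value at a point `p` outside the base locus of the rational map
`x ↦ (F₀(x) : ⋯ : Fₙ(x))`: the prime generated by the forms `G` with `G(F₀, …, Fₙ) ∈ p`. -/
def baseMap (F : Fin (n + 1) → MvPolynomial (Fin (n + 1)) k)
    (p : ((baseLocus F)ᶜ : Set (PSpace k n))) : PSpace k n where
  asHomogeneousIdeal :=
    (p.1.asHomogeneousIdeal.toIdeal.comap (aeval (R := k) F)).homogeneousCore (grading k n)
  isPrime := Ideal.IsPrime.homogeneousCore (p.1.isPrime.comap _)
  not_irrelevant_le := by
    intro h
    apply p.2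
    rintro _ ⟨i, rfl⟩
    have hX : (X i : MvPolynomial (Fin (n + 1)) k) ∈
        HomogeneousIdeal.irrelevant (grading k n) :=
      HomogeneousIdeal.mem_irrelevant_of_mem _ Nat.one_pos (isHomogeneous_X k i)
    have h2 := Ideal.toIdeal_homogeneousCore_le _ _ (h hX)
    simpa using h2

/-- The rational map given by `F₀, …, Fₙ` is dominant: it has dense image. -/
def Dominant (F : Fin (n + 1) → MvPolynomial (Fin (n + 1)) k) : Prop :=
  DenseRange (baseMap F)

/-- The subfield of `k(X₀, …, Xₙ)` formed by all fractions `G(F₀, …, Fₙ) / H(F₀, …, Fₙ)` with `G`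
and `H` forms of the same degree. If `F` defines a dominant rational map `f` from `ℙⁿ` to `ℙⁿ`, this
is the image `f^* k(ℙⁿ)` of the pull-back `f^*` of rational functions, `G / H ↦ G(F) / H(F)`. -/
def pullbackField (F : Fin (n + 1) → MvPolynomial (Fin (n + 1)) k) :
    Subfield (FractionRing (MvPolynomial (Fin (n + 1)) k)) where
  carrier := {z | ∃ (m : ℕ) (G H : MvPolynomial (Fin (n + 1)) k), G.IsHomogeneous m ∧
    H.IsHomogeneous m ∧ aeval F H ≠ 0 ∧
    z = algebraMap _ _ (aeval F G) / algebraMap _ _ (aeval F H)}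
  mul_mem' := by
    rintro _ _ ⟨m, G, H, hG, hH, h0, rfl⟩ ⟨m', G', H', hG', hH', h0', rfl⟩
    refine ⟨m + m', G * G', H * H', hG.mul hG', hH.mul hH', by rw [map_mul]; exact mul_ne_zero h0 h0', ?_⟩
    simp only [map_mul]
    rw [div_mul_div_comm]
  one_mem' := ⟨0, 1, 1, isHomogeneous_one _ _, isHomogeneous_one _ _, by simp, by simp⟩
  add_mem' := by
    rintro _ _ ⟨m, G, H, hG, hH, h0, rfl⟩ ⟨m', G', H', hG', hH', h0', rfl⟩
    refine ⟨m + m', G * H' + H * G', H * H', (hG.mul hH').add (hH.mul hG'), hH.mul hH',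
      by rw [map_mul]; exact mul_ne_zero h0 h0', ?_⟩
    simp only [map_mul, map_add]
    rw [div_add_div _ _ (by simpa using h0) (by simpa using h0')]
  zero_mem' := ⟨0, 0, 1, isHomogeneous_zero _ _ _, isHomogeneous_one _ _, by simp, by simp⟩
  neg_mem' := by
    rintro _ ⟨m, G, H, hG, hH, h0, rfl⟩
    refine ⟨m, -G, H, hG.neg, hH, h0, ?_⟩
    simp only [map_neg]
    rw [neg_div]
  inv_mem' := by
    rintro _ ⟨m, G, H, hG, hH, h0, rfl⟩
    by_cases hG0 : aeval F G = 0
    · exact ⟨m, G, H, hG, hH, h0, by rw [hG0, map_zero, zero_div, inv_zero]⟩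
    · exact ⟨m, H, G, hH, hG, hG0, by rw [inv_div]⟩

variable (k n) in
/-- The function field `k(ℙⁿ)`: all fractions `G / H` of forms of the same degree, `H ≠ 0`. -/
def functionField : Subfield (FractionRing (MvPolynomial (Fin (n + 1)) k)) :=
  pullbackField X

theorem mem_functionField (z : FractionRing (MvPolynomial (Fin (n + 1)) k)) :
    z ∈ functionField k n ↔ ∃ (m : ℕ) (G H : MvPolynomial (Fin (n + 1)) k),
      G.IsHomogeneous m ∧ H.IsHomogeneous m ∧ H ≠ 0 ∧ z = algebraMap _ _ G / algebraMap _ _ H := by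
  change (∃ (m : ℕ) (G H : MvPolynomial (Fin (n + 1)) k), G.IsHomogeneous m ∧
    H.IsHomogeneous m ∧ aeval X H ≠ 0 ∧
    z = algebraMap _ _ (aeval X G) / algebraMap _ _ (aeval X H)) ↔ _
  simp only [aeval_X_left, AlgHom.id_apply]

/-- The degree `[k(ℙⁿ) : f^* k(ℙⁿ)]` of the dominant rational map `f` given by `F₀, …, Fₙ`
(`⊤` if this extension is infinite). -/
def degree (F : Fin (n + 1) → MvPolynomial (Fin (n + 1)) k) : ℕ∞ :=
  Cardinal.toENat ((pullbackField F).relrank (functionField k n))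

/-- The ideal of `E_f` in the local ring of `ℙⁿ` at `Q`: the part of degree `0` of the extension of
the homogeneous ideal `(F₀, …, Fₙ)` to the localization of `k[X₀, …, Xₙ]` at the prime `Q`. -/
def localIdeal (F : Fin (n + 1) → MvPolynomial (Fin (n + 1)) k) (Q : PSpace k n) :
    Ideal (LocalRing Q) :=
  ((Ideal.span (Set.range F)).map (algebraMap (MvPolynomial (Fin (n + 1)) k)
    (Localization.AtPrime Q.asHomogeneousIdeal.toIdeal))).comap
    (algebraMap (LocalRing Q) (Localization.AtPrime Q.asHomogeneousIdeal.toIdeal))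

/-- The local ring of `E_f` at `Q`. -/
abbrev BaseLocalRing (F : Fin (n + 1) → MvPolynomial (Fin (n + 1)) k) (Q : PSpace k n) : Type u :=
  LocalRing Q ⧸ localIdeal F Q

/-- The length of `E_f` at the point `Q`. -/
def lengthAt (F : Fin (n + 1) → MvPolynomial (Fin (n + 1)) k) (Q : PSpace k n) : ℕ∞ :=
  Module.length (BaseLocalRing F Q) (BaseLocalRing F Q)

/-- The total length of `E_f`, when `E_f` has finitely many points. -/
def totalLength (F : Fin (n + 1) → MvPolynomial (Fin (n + 1)) k) (hF : (baseLocus F).Finite) : ℕ∞ :=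
  ∑ Q ∈ hF.toFinset, lengthAt F Q

/-- `E_f` is a local complete intersection: at each of its points, its ideal in the local ring
of `ℙⁿ` is generated by a regular sequence. -/
def IsLocalCompleteIntersection (F : Fin (n + 1) → MvPolynomial (Fin (n + 1)) k) : Prop :=
  ∀ Q ∈ baseLocus F, ∃ rs : List (LocalRing Q),
    RingTheory.Sequence.IsRegular (LocalRing Q) rs ∧ Ideal.ofList rs = localIdeal F Q

end Forms

/-- Gorenstein local rings: Noetherian local rings of finite injective dimension over themselves. -/
structure IsGorensteinLocalRing (R : Type u) [CommRing R] : Prop where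
  isLocalRing : IsLocalRing R
  isNoetherianRing : IsNoetherianRing R
  finite_injectiveDimension : ∃ m : ℕ, HasInjectiveDimensionLE (ModuleCat.of R R) m

/-- `E_f` is Gorenstein: all its local rings are Gorenstein. -/
def IsGorenstein {k : Type u} [Field k] {n : ℕ}
    (F : Fin (n + 1) → MvPolynomial (Fin (n + 1)) k) : Prop :=
  ∀ Q ∈ baseLocus F, IsGorensteinLocalRing (BaseLocalRing F Q)

end ProjRat

end

/-! The degree of the map is the length of a general fibre, and this length is read off from a
finite algebra. Choose an affine chart of `ℙⁿ` that contains the finite base scheme `E`, let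
`W` be its coordinate ring, and let `φᵢ` in `W` be the restriction of `Fᵢ` to it (`dehom`). The
fibre over the point `(1 : c)` lies in the scheme defined by the ideal `J` generated by the
`φᵢ - cᵢ φ₀` with `i > 0` (`pencilIdeal`). For general `c` there are three counts.

* `W ⧸ J` has dimension `d ^ n` (`bezout`). The `n` forms `Fᵢ - cᵢ F₀` have no common zero on the
  hyperplane at infinity (`Dominant.exists_generic_pencil`), so these forms and the equation of the
  hyperplane form a regular sequence (`forms_regular`), and this fixes the Hilbert series.
* Inverting `φ₀` in `W ⧸ J` gives an algebra of dimension `deg f` (`Dominant.exists_generic_fibre`),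
  because the coordinate ring of the open set `φ₀ ≠ 0` is generically free over the polynomial ring
  in the `φᵢ / φ₀` (`exists_generic_basis`, `finrank_fibre`).
* `W ⧸ (J + φ₀)` is the coordinate ring of `E`, of dimension `δ` (`totalLength_eq_finrank`).

For an element `g` of a finite algebra `N`, the dimensions of `N_g` and of `N ⧸ g` add up to at most
`dim N`, with equality if and only if `g` is divisible by `g ^ 2`
(`finrank_localization_add_finrank_quotient`). This is the inequality; and equality holds if and
only if, at every point of `E`, the general combinations `φᵢ - cᵢ φ₀` already generate the ideal
`I` of `E`.

The rest is local, in a regular local ring `R` of dimension `n` with maximal ideal `m`. If the `n`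
combinations generate `I`, they are a regular sequence (`regularFamily_of_pow_mem`), and `R ⧸ I` has
a simple socle (`simpleSocle_quotient`), hence is self-injective and Gorenstein. Conversely, by
Nakayama's lemma it suffices to find one linear relation between the `n + 1` generators of `I`
modulo `m I` (`mem_span_pencil_of_relation`): it does not involve `c`, so that finitely many points
impose only finitely many conditions on `c`. If `I` is generated by a regular sequence, this sequence
has at most `n` members, and the relation exists by linear algebra
(`exists_relation_of_isRegular`).

If `R ⧸ I` is Gorenstein, then it is self-injective (`IsGorensteinLocalRing.baer`) and its socle is
simple, and the relation comes from Kunz's theorem that almost complete intersections are not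
Gorenstein (`exists_syzygy_of_simpleSocle`). By duality modulo the regular sequence, the Koszul
homology of the generators of `I` in degree one is free of rank one over `R ⧸ I`, and adjoining one
divided power variable to the Koszul complex gives a free resolution (`tateComplex_exactMod`). It is
infinite and would be minimal if there were no relation, which is impossible over a regular ring
(`not_mem_maximalIdeal_smul`).

Facts on regular local rings are obtained from complexes of free modules by passing to the quotients
by the members of a regular system of parameters one at a time (`GradedComplex.ExactMod`); neither
depth nor resolutions of general modules are needed. -/

noncomputable section

/-! ### Complexes of free modules and regular sequences -/

namespace ProjRat

section Tower

variable {R : Type*} [CommRing R]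

/-- The ideal generated by the first `j` members of a finite family. -/
def prefixIdeal {n : ℕ} (x : Fin n → R) (j : ℕ) : Ideal R :=
  Ideal.span (x '' {i | (i : ℕ) < j})

/-- Each member of the family is a nonzerodivisor modulo the preceding ones. The quotient by the
whole family may be zero. -/
def RegularFamily {n : ℕ} (x : Fin n → R) : Prop :=
  ∀ (j : Fin n) (a : R), x j * a ∈ prefixIdeal x j → a ∈ prefixIdeal x j

theorem prefixIdeal_zero {n : ℕ} (x : Fin n → R) : prefixIdeal x 0 = ⊥ := by
  simp [prefixIdeal]

theorem prefixIdeal_succ {n : ℕ} (x : Fin n → R) (j : Fin n) :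
    prefixIdeal x (j + 1) = prefixIdeal x j ⊔ Ideal.span {x j} := by
  rw [prefixIdeal, prefixIdeal, ← Ideal.span_union, ← Set.image_singleton, ← Set.image_union]
  congr 2
  ext i
  simp only [Set.mem_ofPred_eq, Set.mem_union, Set.mem_singleton_iff, Fin.ext_iff]
  omega

theorem prefixIdeal_of_le {n : ℕ} (x : Fin n → R) {j : ℕ} (h : n ≤ j) :
    prefixIdeal x j = Ideal.span (Set.range x) := by
  rw [prefixIdeal, ← Set.image_univ]
  congr 2
  ext i
  simpa using lt_of_lt_of_le i.2 h

/-- A nonzerodivisor modulo `I` is a nonzerodivisor on `E ⧸ I E` for free `E`. -/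
theorem mem_smul_top_of_smul_mem {E : Type*} [AddCommGroup E] [Module R E] [Module.Free R E]
    {I : Ideal R} {x : R} (hx : ∀ a, x * a ∈ I → a ∈ I) {u : E}
    (h : x • u ∈ I • (⊤ : Submodule R E)) : u ∈ I • (⊤ : Submodule R E) := by
  classical
  let b := Module.Free.chooseBasis R E
  have key : ∀ w : E, w ∈ I • (⊤ : Submodule R E) → ∀ i, b.repr w i ∈ I := by
    intro w hw i
    refine Submodule.smul_induction_on hw (fun r hr m _ => ?_) (fun y z hy hz => ?_)
    · simpa using I.mul_mem_right _ hr
    · simpa using I.add_mem hy hz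
  rw [← b.linearCombination_repr u, Finsupp.linearCombination_apply]
  refine Submodule.sum_mem _ fun i _ => Submodule.smul_mem_smul ?_ trivial
  have := key _ h i
  simp only [map_smul, Finsupp.smul_apply, smul_eq_mul] at this
  exact hx _ this

variable (R) in
/-- A chain complex in degrees `0, 1, 2, …`, given as a family of submodules `C i` of one module
`E` with one differential `d` on `E`. Projections onto the `C i` are part of the data, so
that each `C i` is a direct summand of `E`. -/
structure GradedComplex (E : Type*) [AddCommGroup E] [Module R E] where
  /-- the differential -/
  d : E →ₗ[R] E
  /-- the chains of degree `i` -/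
  C : ℕ → Submodule R E
  /-- the projection onto the chains of degree `i` -/
  proj : ℕ → E →ₗ[R] E
  d_d : ∀ u, d (d u) = 0
  d_mem : ∀ {i u}, u ∈ C (i + 1) → d u ∈ C i
  proj_mem : ∀ i u, proj i u ∈ C i
  proj_of_mem : ∀ {i u}, u ∈ C i → proj i u = u

namespace GradedComplex

variable {E : Type*} [AddCommGroup E] [Module R E] (K : GradedComplex R E)

/-- The complex is exact in degree `i + 1` modulo the ideal `I`. -/
def ExactMod (I : Ideal R) (i : ℕ) : Prop :=
  ∀ u ∈ K.C (i + 1), K.d u ∈ I • (⊤ : Submodule R E) →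
    ∃ v ∈ K.C (i + 2), u - K.d v ∈ I • (⊤ : Submodule R E)

theorem map_mem_smul_top (f : E →ₗ[R] E) {I : Ideal R} {u : E}
    (hu : u ∈ I • (⊤ : Submodule R E)) : f u ∈ I • (⊤ : Submodule R E) := by
  have := Submodule.mem_map_of_mem (f := f) hu
  rw [Submodule.map_smul''] at this
  exact Submodule.smul_mono le_rfl le_top this

theorem smul_mem_smul_top {I : Ideal R} {x : R} (hx : x ∈ I) (u : E) :
    x • u ∈ I • (⊤ : Submodule R E) := Submodule.smul_mem_smul hx trivial

theorem exists_sub_smul_mem {I : Ideal R} {x : R} {i : ℕ} {u : E} (hu : u ∈ K.C i)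
    (h : u ∈ (I ⊔ Ideal.span {x}) • (⊤ : Submodule R E)) :
    ∃ b ∈ K.C i, u - x • b ∈ I • (⊤ : Submodule R E) := by
  rw [Submodule.sup_smul, Submodule.mem_sup] at h
  obtain ⟨y, hy, z, hz, rfl⟩ := h
  rw [Submodule.ideal_span_singleton_smul, Submodule.mem_smul_pointwise_iff_exists] at hz
  obtain ⟨b, -, rfl⟩ := hz
  refine ⟨K.proj i b, K.proj_mem i b, ?_⟩
  have h1 := K.proj_of_mem hu
  rw [map_add, map_smul] at h1
  have h2 : y + x • b - x • K.proj i b = K.proj i y := by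
    rw [← h1]; abel
  rw [h2]
  exact map_mem_smul_top _ hy

/-- If `x` is regular modulo `I`, exactness in degrees `i + 1` and `i + 2` modulo `I` gives
exactness in degree `i + 2` modulo `I + (x)`. -/
theorem ExactMod.sup [Module.Free R E] {I : Ideal R} {x : R} {i : ℕ}
    (hx : ∀ a, x * a ∈ I → a ∈ I) (h1 : K.ExactMod I i) (h2 : K.ExactMod I (i + 1)) :
    K.ExactMod (I ⊔ Ideal.span {x}) (i + 1) := by
  intro u hu hdu
  obtain ⟨b, hb, hb'⟩ := K.exists_sub_smul_mem (K.d_mem hu) hdu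
  have h3 : K.d b ∈ I • (⊤ : Submodule R E) := by
    apply mem_smul_top_of_smul_mem hx
    have := map_mem_smul_top K.d hb'
    rw [map_sub, K.d_d, map_smul, zero_sub] at this
    exact (Submodule.neg_mem_iff _).1 this
  obtain ⟨b', hb1, hb2⟩ := h1 b hb h3
  have h4 : K.d (u - x • b') ∈ I • (⊤ : Submodule R E) := by
    rw [map_sub, map_smul]
    have : K.d u - x • K.d b' = (K.d u - x • b) + x • (b - K.d b') := by
      rw [smul_sub]; abel
    rw [this]
    exact Submodule.add_mem _ hb' (Submodule.smul_mem _ _ hb2)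
  obtain ⟨v, hv, hv'⟩ := h2 (u - x • b') (Submodule.sub_mem _ hu (Submodule.smul_mem _ _ hb1)) h4
  refine ⟨v, hv, ?_⟩
  have : u - K.d v = (u - x • b' - K.d v) + x • b' := by abel
  rw [this]
  refine Submodule.add_mem _ (Submodule.smul_mono_left le_sup_left hv') ?_
  exact smul_mem_smul_top (Ideal.mem_sup_right (Ideal.mem_span_singleton_self x)) _

/-- If `x` is regular modulo `I` and a power of `x` annihilates the homology modulo `I`, then
exactness modulo `I + (x)` in degree `i + 2` gives exactness modulo `I` in degree `i + 1`. -/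
theorem ExactMod.of_sup [Module.Free R E] {I : Ideal R} {x : R} {i N : ℕ}
    (hx : ∀ a, x * a ∈ I → a ∈ I)
    (hN : ∀ u ∈ K.C (i + 1), K.d u ∈ I • (⊤ : Submodule R E) →
      ∃ v ∈ K.C (i + 2), x ^ N • u - K.d v ∈ I • (⊤ : Submodule R E))
    (h : K.ExactMod (I ⊔ Ideal.span {x}) (i + 1)) : K.ExactMod I i := by
  intro u hu hdu
  obtain ⟨v, hv, hv'⟩ := hN u hu hdu
  clear hN
  induction N generalizing v with
  | zero => exact ⟨v, hv, by simpa using hv'⟩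
  | succ N ih =>
    have h1 : K.d v ∈ (I ⊔ Ideal.span {x}) • (⊤ : Submodule R E) := by
      have h2 := Submodule.smul_mono_left (N := (⊤ : Submodule R E))
        (le_sup_left : I ≤ I ⊔ Ideal.span {x}) hv'
      have h3 : x ^ (N + 1) • u ∈ (I ⊔ Ideal.span {x}) • (⊤ : Submodule R E) := by
        rw [pow_succ', mul_smul]
        exact smul_mem_smul_top (Ideal.mem_sup_right (Ideal.mem_span_singleton_self x)) _
      simpa using Submodule.sub_mem _ h3 h2
    obtain ⟨y, hy, hy'⟩ := h v hv h1
    have hvy : v - K.d y ∈ K.C (i + 2) := Submodule.sub_mem _ hv (K.d_mem hy)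
    obtain ⟨w, hw, hw'⟩ := K.exists_sub_smul_mem hvy hy'
    refine ih w hw ?_
    apply mem_smul_top_of_smul_mem hx
    have h5 := map_mem_smul_top K.d hw'
    rw [map_sub, map_sub, K.d_d, sub_zero, map_smul] at h5
    have h6 : x • (x ^ N • u - K.d w) = (x ^ (N + 1) • u - K.d v) + (K.d v - x • K.d w) := by
      rw [smul_sub, smul_smul, ← pow_succ']; abel
    rw [h6]
    exact Submodule.add_mem _ hv' h5

/-- Exactness modulo a regular family `x₁, …, xₙ` in degrees above `s + n` descends to exactness
in degrees above `s`, if powers of the `xⱼ` annihilate the homology. -/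
theorem exactMod_bot_of_regularFamily [Module.Free R E] {n s : ℕ} {x : Fin n → R}
    (hx : RegularFamily x)
    (hN : ∀ (I : Ideal R) (j : Fin n), ∃ N : ℕ, ∀ i, ∀ u ∈ K.C (i + 1),
      K.d u ∈ I • (⊤ : Submodule R E) →
      ∃ v ∈ K.C (i + 2), x j ^ N • u - K.d v ∈ I • (⊤ : Submodule R E))
    (h : ∀ i, s + n ≤ i → K.ExactMod (Ideal.span (Set.range x)) i) :
    ∀ i, s ≤ i → K.ExactMod ⊥ i := by
  have key : ∀ t ≤ n, ∀ i, s + (n - t) ≤ i → K.ExactMod (prefixIdeal x (n - t)) i := by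
    intro t
    induction t with
    | zero =>
      intro _ i hi
      rw [prefixIdeal_of_le x (by simp)]
      exact h i hi
    | succ t ih =>
      intro ht i hi
      obtain ⟨N, hN⟩ := hN (prefixIdeal x (n - (t + 1))) ⟨n - (t + 1), by omega⟩
      refine ExactMod.of_sup K (hx ⟨n - (t + 1), by omega⟩) (hN i) ?_
      rw [← prefixIdeal_succ x ⟨n - (t + 1), by omega⟩]
      have : n - (t + 1) + 1 = n - t := by omega
      simp only [this]
      exact ih (by omega) (i + 1) (by omega)
  intro i hi
  have := key n le_rfl i (by simpa using hi)
  simpa [prefixIdeal_zero] using this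

/-- Exactness in degrees above `s` gives exactness in degrees above `s + n` modulo a regular
family of `n` elements. -/
theorem exactMod_regularFamily [Module.Free R E] {n s : ℕ} {x : Fin n → R}
    (hx : RegularFamily x) (h : ∀ i, s ≤ i → K.ExactMod ⊥ i) :
    ∀ i, s + n ≤ i → K.ExactMod (Ideal.span (Set.range x)) i := by
  have key : ∀ t ≤ n, ∀ i, s + t ≤ i → K.ExactMod (prefixIdeal x t) i := by
    intro t
    induction t with
    | zero =>
      intro _ i hi
      rw [prefixIdeal_zero]
      exact h i hi
    | succ t ih =>
      intro ht i hi
      rw [prefixIdeal_succ x ⟨t, by omega⟩]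
      obtain ⟨i, rfl⟩ : ∃ i', i = i' + 1 := ⟨i - 1, by omega⟩
      exact ExactMod.sup K (hx ⟨t, by omega⟩) (ih (by omega) i (by omega))
        (ih (by omega) (i + 1) (by omega))
  intro i hi
  have := key n le_rfl i hi
  rwa [prefixIdeal_of_le x le_rfl] at this

/-- Let `x₁, …, xₙ` be a regular family and let the complex be exact in positive degrees. If any
two chains of degree `n` satisfy a linear relation modulo `(x₁, …, xₙ)` with coefficients
not both in `P`, then so do, modulo boundaries, any two chains of degree `0` whose classes are
annihilated by all `xⱼ`. (The iterated connecting homomorphisms embed the latter homology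
classes into the homology in degree `n` modulo `(x₁, …, xₙ)`.) -/
theorem exists_relation_of_annihilated [Module.Free R E] {n : ℕ} {x : Fin n → R}
    (hx : RegularFamily x) (P : Ideal R) (h : ∀ i, K.ExactMod ⊥ i)
    (htop : ∀ u ∈ K.C n, ∀ v ∈ K.C n, ∃ r t : R, ¬ (r ∈ P ∧ t ∈ P) ∧
      r • u + t • v ∈ Ideal.span (Set.range x) • (⊤ : Submodule R E))
    {u v : E} (hu : u ∈ K.C 0) (hv : v ∈ K.C 0) (hdu : K.d u = 0) (hdv : K.d v = 0)
    (hxu : ∀ j, ∃ w ∈ K.C 1, x j • u = K.d w) (hxv : ∀ j, ∃ w ∈ K.C 1, x j • v = K.d w) :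
    ∃ r t : R, ¬ (r ∈ P ∧ t ∈ P) ∧ ∃ w ∈ K.C 1, r • u + t • v = K.d w := by
  have hex : ∀ t ≤ n, ∀ i, t ≤ i → K.ExactMod (prefixIdeal x t) i := by
    intro t
    induction t with
    | zero => intro _ i _; rw [prefixIdeal_zero]; exact h i
    | succ t ih =>
      intro ht i hi
      rw [prefixIdeal_succ x ⟨t, by omega⟩]
      obtain ⟨i, rfl⟩ : ∃ i', i = i' + 1 := ⟨i - 1, by omega⟩
      exact ExactMod.sup K (hx ⟨t, by omega⟩) (ih (by omega) i (by omega))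
        (ih (by omega) (i + 1) (by omega))
  -- the cycles modulo the first `j` members whose classes are annihilated by all members
  let Z : ℕ → E → Prop := fun j u => u ∈ K.C j ∧ K.d u ∈ prefixIdeal x j • (⊤ : Submodule R E) ∧
    ∀ l : Fin n, ∃ w ∈ K.C (j + 1), x l • u - K.d w ∈ prefixIdeal x j • (⊤ : Submodule R E)
  -- the connecting homomorphism for multiplication by `x j`
  have step : ∀ (j : Fin n) (u : E), Z j u → ∃ u', Z (j + 1) u' ∧
      x j • u - K.d u' ∈ prefixIdeal x j • (⊤ : Submodule R E) := by
    rintro j u ⟨hu, hdu, hxu⟩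
    obtain ⟨u', hu', hxu'⟩ := hxu j
    refine ⟨u', ⟨hu', ?_, fun l => ?_⟩, hxu'⟩
    · rw [prefixIdeal_succ]
      have h2 := Submodule.smul_mono_left (N := (⊤ : Submodule R E))
        (le_sup_left : _ ≤ prefixIdeal x j ⊔ Ideal.span {x j}) hxu'
      have h3 : x j • u ∈ (prefixIdeal x j ⊔ Ideal.span {x j}) • (⊤ : Submodule R E) :=
        smul_mem_smul_top (Ideal.mem_sup_right (Ideal.mem_span_singleton_self _)) _
      simpa using Submodule.sub_mem _ h3 h2
    · obtain ⟨w, hw, hxw⟩ := hxu l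
      have h1 : x l • u' - x j • w ∈ K.C (j + 1) :=
        Submodule.sub_mem _ (Submodule.smul_mem _ _ hu') (Submodule.smul_mem _ _ hw)
      have h2 : K.d (x l • u' - x j • w) ∈ prefixIdeal x j • (⊤ : Submodule R E) := by
        have : K.d (x l • u' - x j • w) =
            x j • (x l • u - K.d w) - x l • (x j • u - K.d u') := by
          rw [map_sub, map_smul, map_smul, smul_sub, smul_sub, smul_comm (x j) (x l) u]; abel
        rw [this]
        exact Submodule.sub_mem _ (Submodule.smul_mem _ _ hxw) (Submodule.smul_mem _ _ hxu')
      obtain ⟨y, hy, hy'⟩ := hex j j.2.le j le_rfl _ h1 h2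
      refine ⟨y, hy, ?_⟩
      rw [prefixIdeal_succ]
      have : x l • u' - K.d y = (x l • u' - x j • w - K.d y) + x j • w := by abel
      rw [this]
      exact Submodule.add_mem _ (Submodule.smul_mono_left le_sup_left hy')
        (smul_mem_smul_top (Ideal.mem_sup_right (Ideal.mem_span_singleton_self _)) _)
  -- a relation in degree `j + 1` descends to degree `j`, starting from `htop` in degree `n`
  have key : ∀ t ≤ n, ∀ u v, Z (n - t) u → Z (n - t) v → ∃ r s : R, ¬ (r ∈ P ∧ s ∈ P) ∧
      ∃ w ∈ K.C (n - t + 1), r • u + s • v - K.d w ∈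
        prefixIdeal x (n - t) • (⊤ : Submodule R E) := by
    intro t
    induction t with
    | zero =>
      intro _ u v hu hv
      obtain ⟨r, s, hrs, h⟩ := htop u hu.1 v hv.1
      refine ⟨r, s, hrs, 0, Submodule.zero_mem _, ?_⟩
      rw [prefixIdeal_of_le x (by simp)]
      simpa using h
    | succ t ih =>
      intro ht u v hu hv
      let j : Fin n := ⟨n - (t + 1), by omega⟩
      have hj : (j : ℕ) + 1 = n - t := by simp only [j]; omega
      obtain ⟨u', hu', hxu⟩ := step j u hu
      obtain ⟨v', hv', hxv⟩ := step j v hv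
      rw [hj] at hu' hv'
      obtain ⟨r, s, hrs, w, hw, hrel⟩ := ih (by omega) u' v' hu' hv'
      refine ⟨r, s, hrs, ?_⟩
      rw [← hj] at hw hrel
      have h1 : r • u' + s • v' - K.d w ∈ K.C (j + 1) :=
        Submodule.sub_mem _ (Submodule.add_mem _ (Submodule.smul_mem _ _ (hj ▸ hu'.1))
          (Submodule.smul_mem _ _ (hj ▸ hv'.1))) (K.d_mem hw)
      rw [prefixIdeal_succ] at hrel
      obtain ⟨b, hb, hb'⟩ := K.exists_sub_smul_mem h1 hrel
      refine ⟨b, hb, ?_⟩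
      apply mem_smul_top_of_smul_mem (hx j)
      have h2 := map_mem_smul_top K.d hb'
      rw [map_sub, map_sub, K.d_d, sub_zero, map_add, map_smul, map_smul, map_smul] at h2
      have h3 : x j • (r • u + s • v - K.d b) = r • (x j • u - K.d u') + s • (x j • v - K.d v') +
          (r • K.d u' + s • K.d v' - x j • K.d b) := by
        simp only [smul_sub, smul_add, smul_comm (x j) r, smul_comm (x j) s]; abel
      rw [h3]
      exact Submodule.add_mem _ (Submodule.add_mem _ (Submodule.smul_mem _ _ hxu)
        (Submodule.smul_mem _ _ hxv)) h2
  have hZ : ∀ u ∈ K.C 0, K.d u = 0 → (∀ j, ∃ w ∈ K.C 1, x j • u = K.d w) → Z (n - n) u := by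
    intro u hu hdu hxu
    rw [Nat.sub_self]
    refine ⟨hu, by rw [hdu]; exact Submodule.zero_mem _, fun l => ?_⟩
    obtain ⟨w, hw, h⟩ := hxu l
    exact ⟨w, hw, by rw [h, sub_self]; exact Submodule.zero_mem _⟩
  obtain ⟨r, s, hrs, w, hw, hrel⟩ := key n le_rfl u v (hZ u hu hdu hxu) (hZ v hv hdv hxv)
  rw [Nat.sub_self] at hw hrel
  rw [prefixIdeal_zero, Submodule.bot_smul, Submodule.mem_bot, sub_eq_zero] at hrel
  exact ⟨r, s, hrs, w, hw, hrel⟩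

end GradedComplex

end Tower

end ProjRat

/-! ### The Koszul complex -/

namespace ProjRat

open GradedComplex

section Koszul

variable {R : Type*} [CommRing R] {M : Type*} [AddCommGroup M] [Module R M]

/-- Contraction by a linear form lowers the degree on the exterior algebra by one. -/
theorem contractLeft_mem (φ : Module.Dual R M) {i : ℕ} {u : ExteriorAlgebra R M}
    (hu : u ∈ LinearMap.range (ExteriorAlgebra.ι R (M := M)) ^ (i + 1)) :
    CliffordAlgebra.contractLeft φ u ∈ LinearMap.range (ExteriorAlgebra.ι R (M := M)) ^ i := by
  induction i generalizing u with
  | zero =>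
    rw [zero_add, pow_one] at hu
    obtain ⟨m, rfl⟩ := hu
    rw [pow_zero]
    refine ⟨φ m, ?_⟩
    simp [ExteriorAlgebra.ι, CliffordAlgebra.contractLeft_ι, Algebra.algebraMap_eq_smul_one]
  | succ i ih =>
    rw [pow_succ'] at hu
    refine Submodule.mul_induction_on hu ?_ fun x y hx hy => ?_
    · rintro _ ⟨m, rfl⟩ w hw
      rw [ExteriorAlgebra.ι, CliffordAlgebra.contractLeft_ι_mul]
      refine Submodule.sub_mem _ (Submodule.smul_mem _ _ hw) ?_
      rw [pow_succ']
      exact Submodule.mul_mem_mul ⟨m, rfl⟩ (ih hw)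
    · rw [map_add]
      exact Submodule.add_mem _ hx hy

/-- The Koszul complex of a linear form `φ`: the exterior algebra, with contraction by `φ` as its
differential. -/
def koszul (φ : Module.Dual R M) : GradedComplex R (ExteriorAlgebra R M) where
  d := CliffordAlgebra.contractLeft φ
  C i := ⋀[R]^i M
  proj i := GradedAlgebra.proj (fun i : ℕ => ⋀[R]^i M) i
  d_d u := CliffordAlgebra.contractLeft_contractLeft φ u
  d_mem hu := contractLeft_mem φ hu
  proj_mem i u := by
    rw [GradedAlgebra.proj_apply]
    exact SetLike.coe_mem _
  proj_of_mem hu := by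
    rw [GradedAlgebra.proj_apply]
    exact DirectSum.decompose_of_mem_same _ hu

variable (φ : Module.Dual R M)

theorem koszul_d_ι_mul (m : M) (u : ExteriorAlgebra R M) :
    (koszul φ).d (ExteriorAlgebra.ι R m * u) =
      φ m • u - ExteriorAlgebra.ι R m * (koszul φ).d u :=
  CliffordAlgebra.contractLeft_ι_mul φ m u

theorem koszul_d_ι (m : M) :
    (koszul φ).d (ExteriorAlgebra.ι R m) = algebraMap R _ (φ m) :=
  CliffordAlgebra.contractLeft_ι _ φ m

theorem koszul_d_algebraMap (r : R) :
    (koszul φ).d (algebraMap R _ r) = 0 :=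
  CliffordAlgebra.contractLeft_algebraMap _ φ r

theorem mem_koszul_C_zero {u : ExteriorAlgebra R M} :
    u ∈ (koszul φ).C 0 ↔ ∃ r, algebraMap R _ r = u := by
  change u ∈ (LinearMap.range (ExteriorAlgebra.ι R (M := M))) ^ 0 ↔ _
  rw [pow_zero, Submodule.mem_one]

theorem mem_koszul_C_one {u : ExteriorAlgebra R M} :
    u ∈ (koszul φ).C 1 ↔ ∃ m, ExteriorAlgebra.ι R m = u := by
  change u ∈ (LinearMap.range (ExteriorAlgebra.ι R (M := M))) ^ 1 ↔ _
  rw [pow_one]; rfl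

theorem ι_mul_mem_koszul_C (m : M) {i : ℕ} {u : ExteriorAlgebra R M}
    (hu : u ∈ (koszul φ).C i) : ExteriorAlgebra.ι R m * u ∈ (koszul φ).C (i + 1) := by
  change _ ∈ (LinearMap.range (ExteriorAlgebra.ι R (M := M))) ^ (i + 1)
  rw [pow_succ']
  exact Submodule.mul_mem_mul ⟨m, rfl⟩ hu

/-- The syzygies of `φ` that hold by commutativity alone. -/
def trivialSyzygies : Submodule R M :=
  Submodule.span R {t | ∃ a b, t = φ a • b - φ b • a}

theorem exists_d_eq_of_mem_trivialSyzygies {m : M} (hm : m ∈ trivialSyzygies φ) :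
    ∃ v ∈ (koszul φ).C 2, ExteriorAlgebra.ι R m = (koszul φ).d v := by
  refine Submodule.span_induction ?_ ⟨0, Submodule.zero_mem _, by simp⟩ ?_ ?_ hm
  · rintro _ ⟨a, b, rfl⟩
    refine ⟨ExteriorAlgebra.ι R a * ExteriorAlgebra.ι R b,
      ι_mul_mem_koszul_C φ _ ((mem_koszul_C_one φ).2 ⟨b, rfl⟩), ?_⟩
    rw [koszul_d_ι_mul, koszul_d_ι, map_sub, map_smul, map_smul, ← Algebra.commutes,
      ← Algebra.smul_def]
  · rintro x y _ _ ⟨v, hv, hxv⟩ ⟨w, hw, hyw⟩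
    exact ⟨v + w, Submodule.add_mem _ hv hw, by rw [map_add, map_add, hxv, hyw]⟩
  · rintro r x _ ⟨v, hv, hxv⟩
    exact ⟨r • v, Submodule.smul_mem _ _ hv, by rw [map_smul, map_smul, hxv]⟩

theorem mem_trivialSyzygies_of_d_eq {m : M} {v : ExteriorAlgebra R M} (hv : v ∈ (koszul φ).C 2)
    (h : ExteriorAlgebra.ι R m = (koszul φ).d v) : m ∈ trivialSyzygies φ := by
  have key : ∃ t ∈ trivialSyzygies φ, ExteriorAlgebra.ι R t = (koszul φ).d v := by
    have hv' : v ∈ (LinearMap.range (ExteriorAlgebra.ι R (M := M))) ^ (1 + 1) := hv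
    rw [pow_succ', pow_one] at hv'
    refine Submodule.mul_induction_on hv' ?_ ?_
    · rintro _ ⟨a, rfl⟩ _ ⟨b, rfl⟩
      refine ⟨φ a • b - φ b • a, Submodule.subset_span ⟨a, b, rfl⟩, ?_⟩
      rw [koszul_d_ι_mul, koszul_d_ι, map_sub, map_smul, map_smul, ← Algebra.commutes,
        ← Algebra.smul_def]
    · rintro x y ⟨s, hs, hxs⟩ ⟨t, ht, hyt⟩
      exact ⟨s + t, Submodule.add_mem _ hs ht, by rw [map_add, map_add, hxs, hyt]⟩
  obtain ⟨t, ht, h'⟩ := key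
  rw [← h'] at h
  rwa [(ExteriorAlgebra.ι_leftInverse (R := R) (M := M)).injective h]

/-- The homology of the Koszul complex, modulo any ideal, is annihilated by the values of `φ`. -/
theorem koszul_smul_exact (m : M) (I : Ideal R) {i : ℕ} {u : ExteriorAlgebra R M}
    (hu : u ∈ (koszul φ).C (i + 1))
    (hdu : (koszul φ).d u ∈ I • (⊤ : Submodule R (ExteriorAlgebra R M))) :
    ∃ v ∈ (koszul φ).C (i + 2),
      φ m • u - (koszul φ).d v ∈ I • (⊤ : Submodule R (ExteriorAlgebra R M)) := by
  refine ⟨ExteriorAlgebra.ι R m * u, ι_mul_mem_koszul_C φ m hu, ?_⟩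
  rw [koszul_d_ι_mul, sub_sub_cancel]
  exact map_mem_smul_top (LinearMap.mulLeft R (ExteriorAlgebra.ι R m)) hdu

theorem free_exteriorAlgebra {r : ℕ} (b : Module.Basis (Fin r) R M) :
    Module.Free R (ExteriorAlgebra R M) :=
  Module.Free.of_basis b.ExteriorAlgebra

/-- The Koszul complex of a free module of rank `r` vanishes above degree `r`. -/
theorem koszul_C_eq_bot {r : ℕ} (b : Module.Basis (Fin r) R M) {i : ℕ} (hi : r < i) :
    (koszul φ).C i = ⊥ := by
  have : IsEmpty (Set.powersetCard (Fin r) i) := by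
    refine ⟨fun s => ?_⟩
    have h1 : (s : Finset (Fin r)).card = i := s.2
    have h2 := Finset.card_le_univ (s : Finset (Fin r))
    rw [Fintype.card_fin] at h2
    omega
  have : Subsingleton (⋀[R]^i M) := (b.exteriorPower (n := i)).repr.toEquiv.subsingleton
  change (⋀[R]^i M) = ⊥
  exact (Submodule.subsingleton_iff_eq_bot).1 this

/-- The depth sensitivity of the Koszul complex: if the ideal of values of `φ` contains powers
of the members of a regular family of length `n`, the Koszul complex on `r ≤ s + n` elements is
exact in degrees above `s`. -/
theorem koszul_exactMod_bot {r n s : ℕ} (b : Module.Basis (Fin r) R M) {x : Fin n → R}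
    (hx : RegularFamily x) (hφ : ∀ j, ∃ N, x j ^ N ∈ LinearMap.range φ) (hr : r ≤ s + n) :
    ∀ i, s ≤ i → (koszul φ).ExactMod ⊥ i := by
  have := free_exteriorAlgebra b
  refine exactMod_bot_of_regularFamily _ hx (fun I j => ?_) (fun i hi u hu _ => ?_)
  · obtain ⟨N, m, hm⟩ := hφ j
    refine ⟨N, fun i u hu hdu => ?_⟩
    rw [← hm]
    exact koszul_smul_exact φ m I hu hdu
  · rw [koszul_C_eq_bot φ b (by omega)] at hu
    rw [(Submodule.mem_bot R).1 hu]
    exact ⟨0, Submodule.zero_mem _, by simp⟩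

theorem ker_le_trivialSyzygies_of_exactMod (h : (koszul φ).ExactMod ⊥ 0) :
    LinearMap.ker φ ≤ trivialSyzygies φ := by
  intro m hm
  rw [LinearMap.mem_ker] at hm
  obtain ⟨v, hv, h'⟩ := h (ExteriorAlgebra.ι R m) ((mem_koszul_C_one φ).2 ⟨m, rfl⟩)
    (by rw [koszul_d_ι, hm, map_zero]; exact Submodule.zero_mem _)
  rw [Submodule.bot_smul, Submodule.mem_bot, sub_eq_zero] at h'
  exact mem_trivialSyzygies_of_d_eq φ hv h'

/-- The linear form on `Rʳ` with coefficients `f`. -/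
def formOf {r : ℕ} (f : Fin r → R) : Module.Dual R (Fin r → R) := Fintype.linearCombination R f

theorem formOf_apply {r : ℕ} (f : Fin r → R) (a : Fin r → R) :
    formOf f a = ∑ i, a i * f i := by
  simp [formOf, Fintype.linearCombination_apply]

theorem range_formOf {r : ℕ} (f : Fin r → R) :
    LinearMap.range (formOf f) = Ideal.span (Set.range f) :=
  Fintype.range_linearCombination R f

/-- If all syzygies of a finite family in the maximal ideal of a Noetherian local ring are trivial,
the family is regular. -/
theorem regularFamily_of_ker_le [IsLocalRing R] [IsNoetherianRing R] {r : ℕ} {f : Fin r → R}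
    (hf : ∀ i, f i ∈ IsLocalRing.maximalIdeal R)
    (h : LinearMap.ker (formOf f) ≤ trivialSyzygies (formOf f)) : RegularFamily f := by
  induction r with
  | zero => exact fun j => j.elim0
  | succ r ih =>
    let f' : Fin r → R := fun i => f i.castSucc
    let ρ : (Fin (r + 1) → R) →ₗ[R] (Fin r → R) := LinearMap.funLeft R R Fin.castSucc
    have hφ : ∀ a : Fin (r + 1) → R,
        formOf f a = formOf f' (ρ a) + a (Fin.last r) * f (Fin.last r) := by
      intro a
      rw [formOf_apply, formOf_apply, Fin.sum_univ_castSucc]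
      rfl
    -- a trivial syzygy, split into the first `r` coefficients and the last one
    have htriv : ∀ t ∈ trivialSyzygies (formOf f), ∃ w : Fin r → R,
        ρ t - f (Fin.last r) • w ∈ trivialSyzygies (formOf f') ∧
          t (Fin.last r) = - formOf f' w := by
      intro t ht
      refine Submodule.span_induction ?_ ⟨0, by simp, by simp⟩ ?_ ?_ ht
      · rintro _ ⟨a, b, rfl⟩
        refine ⟨a (Fin.last r) • ρ b - b (Fin.last r) • ρ a, ?_, ?_⟩
        · have : ρ (formOf f a • b - formOf f b • a) -
              f (Fin.last r) • (a (Fin.last r) • ρ b - b (Fin.last r) • ρ a) =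
              formOf f' (ρ a) • ρ b - formOf f' (ρ b) • ρ a := by
            rw [map_sub, map_smul, map_smul, hφ, hφ]; module
          rw [this]
          exact Submodule.subset_span ⟨_, _, rfl⟩
        · simp only [Pi.sub_apply, Pi.smul_apply, smul_eq_mul, map_sub, map_smul, hφ]
          ring
      · rintro t s _ _ ⟨w, hw, hw'⟩ ⟨v, hv, hv'⟩
        refine ⟨w + v, ?_, ?_⟩
        · have : ρ (t + s) - f (Fin.last r) • (w + v) =
              (ρ t - f (Fin.last r) • w) + (ρ s - f (Fin.last r) • v) := by
            rw [map_add]; module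
          rw [this]
          exact Submodule.add_mem _ hw hv
        · rw [Pi.add_apply, hw', hv', map_add]; ring
      · rintro c t _ ⟨w, hw, hw'⟩
        refine ⟨c • w, ?_, ?_⟩
        · have : ρ (c • t) - f (Fin.last r) • (c • w) = c • (ρ t - f (Fin.last r) • w) := by
            rw [map_smul]; module
          rw [this]
          exact Submodule.smul_mem _ _ hw
        · rw [Pi.smul_apply, hw', map_smul]; simp
    have hpre : ∀ j ≤ r, prefixIdeal f j = prefixIdeal f' j := by
      intro j hj
      rw [prefixIdeal, prefixIdeal]
      congr 1
      ext y
      constructor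
      · rintro ⟨i, hi, rfl⟩
        have hi' : (i : ℕ) < j := hi
        exact ⟨⟨i, by omega⟩, hi, rfl⟩
      · rintro ⟨i, hi, rfl⟩
        exact ⟨i.castSucc, hi, rfl⟩
    -- the syzygies of the first `r` members are trivial up to multiples of the last member of the
    -- family, so Nakayama's lemma applies
    have hker : LinearMap.ker (formOf f') ≤ trivialSyzygies (formOf f') := by
      refine Submodule.le_of_le_smul_of_le_jacobson_bot (I := IsLocalRing.maximalIdeal R)
        (IsNoetherian.noetherian _) (by rw [IsLocalRing.jacobson_eq_maximalIdeal _ bot_ne_top]) ?_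
      intro c hc
      have hc' : formOf f' c = 0 := hc
      let c' : Fin (r + 1) → R := Fin.snoc c 0
      have h1 : ρ c' = c := by
        ext i
        simp [ρ, c', LinearMap.funLeft_apply]
      have h2 : c' (Fin.last r) = 0 := by simp [c']
      have h3 : c' ∈ LinearMap.ker (formOf f) := by
        rw [LinearMap.mem_ker, hφ, h1, h2, hc']; simp
      obtain ⟨w, hw, hw'⟩ := htriv c' (h h3)
      rw [h1] at hw
      rw [h2, eq_comm, neg_eq_zero] at hw'
      have : c = (c - f (Fin.last r) • w) + f (Fin.last r) • w := by abel
      rw [this]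
      exact Submodule.add_mem _ (Submodule.mem_sup_left hw)
        (Submodule.mem_sup_right (Submodule.smul_mem_smul (hf _) hw'))
    intro j a hja
    rcases Fin.eq_castSucc_or_eq_last j with ⟨i, rfl⟩ | rfl
    · have hi : ((i.castSucc : Fin (r + 1)) : ℕ) = i := rfl
      rw [hi, hpre _ i.2.le] at hja ⊢
      exact ih (fun i => hf _) hker i a hja
    · have hl : ((Fin.last r : Fin (r + 1)) : ℕ) = r := rfl
      rw [hl, hpre r le_rfl, prefixIdeal_of_le _ le_rfl, ← range_formOf] at hja ⊢
      obtain ⟨c, hc⟩ := hja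
      let c' : Fin (r + 1) → R := Fin.snoc (-c) a
      have h1 : ρ c' = -c := by
        ext i
        simp [ρ, c', LinearMap.funLeft_apply]
      have h2 : c' (Fin.last r) = a := by simp [c']
      have h3 : c' ∈ LinearMap.ker (formOf f) := by
        rw [LinearMap.mem_ker, hφ, h1, h2, map_neg, hc]; ring
      obtain ⟨w, -, hw'⟩ := htriv c' (h h3)
      rw [h2] at hw'
      exact ⟨-w, by rw [map_neg, hw']⟩

/-- In a Noetherian local ring, let the ideal generated by `n` non-units contain powers of all
members of a regular family of length `n`. Then these `n` elements form a regular family. -/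
theorem regularFamily_of_pow_mem [IsLocalRing R] [IsNoetherianRing R] {n : ℕ} {x f : Fin n → R}
    (hx : RegularFamily x) (hf : ∀ i, f i ∈ IsLocalRing.maximalIdeal R)
    (h : ∀ j, ∃ N, x j ^ N ∈ Ideal.span (Set.range f)) : RegularFamily f := by
  refine regularFamily_of_ker_le hf (ker_le_trivialSyzygies_of_exactMod _ ?_)
  refine koszul_exactMod_bot (s := 0) _ (Pi.basisFun R (Fin n)) hx ?_ (by omega) 0 le_rfl
  rw [range_formOf]
  exact h

end Koszul

end ProjRat

/-! ### Artinian Gorenstein local rings -/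

namespace ProjRat

open CategoryTheory IsLocalRing

section SelfInjective

/-- Any two elements of the socle of a local ring are proportional. -/
def SimpleSocle (B : Type*) [CommRing B] [IsLocalRing B] : Prop :=
  ∀ a b : B, (∀ y ∈ maximalIdeal B, y * a = 0) → (∀ y ∈ maximalIdeal B, y * b = 0) →
    a ≠ 0 → ∃ r, b = r * a

/-- If the maximal ideal is nilpotent, every nonzero ideal meets the socle. -/
theorem exists_mul_mem_socle {B : Type*} [CommRing B] [IsLocalRing B]
    (hnil : IsNilpotent (maximalIdeal B)) {a : B} (ha : a ≠ 0) :
    ∃ c, a * c ≠ 0 ∧ ∀ y ∈ maximalIdeal B, y * (a * c) = 0 := by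
  classical
  obtain ⟨N, hN⟩ := hnil
  have hex : ∃ N, ∀ y ∈ maximalIdeal B ^ N, y * a = 0 :=
    ⟨N, fun y hy => by rw [hN] at hy; rw [(Submodule.mem_bot _).1 hy, zero_mul]⟩
  have h1 := Nat.find_spec hex
  obtain ⟨s, hs⟩ : ∃ s, Nat.find hex = s + 1 := by
    refine Nat.exists_eq_succ_of_ne_zero fun h0 => ha ?_
    rw [h0] at h1
    simpa using h1 1 (by simp)
  have h2 := Nat.find_min hex (m := s) (by omega)
  push Not at h2
  obtain ⟨y, hy, hya⟩ := h2
  refine ⟨y, by rwa [mul_comm], fun z hz => ?_⟩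
  rw [mul_comm a, ← mul_assoc]
  refine h1 _ ?_
  rw [hs, pow_succ']
  exact Ideal.mul_mem_mul hz hy

variable {k : Type*} [Field k] {B : Type*} [CommRing B] [Algebra k B]

/-- A linear form that does not vanish on a simple socle vanishes on no nonzero ideal. -/
theorem SimpleSocle.exists_functional [IsLocalRing B] (h : SimpleSocle B)
    (hnil : IsNilpotent (maximalIdeal B))
    (hres : ∀ b : B, ∃ c : k, b - algebraMap k B c ∈ maximalIdeal B) :
    ∃ l : B →ₗ[k] k, ∀ a, a ≠ 0 → ∃ c, l (a * c) ≠ 0 := by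
  obtain ⟨s, hs, hsoc⟩ := exists_mul_mem_socle hnil (one_ne_zero (α := B))
  obtain ⟨l, hl⟩ : ∃ l : Module.Dual k B, l (1 * s) ≠ 0 := by
    by_contra hl
    push Not at hl
    exact hs ((Module.forall_dual_apply_eq_zero_iff k _).1 hl)
  refine ⟨l, fun a ha => ?_⟩
  obtain ⟨c, hc, hac⟩ := exists_mul_mem_socle hnil ha
  obtain ⟨r, hr⟩ := h _ _ hsoc hac hs
  obtain ⟨e, he⟩ := hres r
  have h1 : a * c = e • (1 * s) := by
    have := hsoc _ he
    rw [sub_mul, sub_eq_zero] at this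
    rw [hr, this, Algebra.smul_def]
  refine ⟨c, ?_⟩
  rw [h1, map_smul, smul_eq_mul]
  refine mul_ne_zero ?_ hl
  rintro rfl
  exact hc (by rw [h1, zero_smul])

/-- A linear form that vanishes on no nonzero ideal identifies the algebra with its dual. -/
theorem exists_functional_eq_mul [Module.Finite k B] {l : B →ₗ[k] k}
    (hl : ∀ a, a ≠ 0 → ∃ c, l (a * c) ≠ 0) (m : B →ₗ[k] k) : ∃ a, ∀ c, m c = l (a * c) := by
  let f : B →ₗ[k] Module.Dual k B := (LinearMap.mul k B).compr₂ l
  have hf : Function.Injective f := by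
    rw [injective_iff_map_eq_zero]
    intro a ha
    by_contra h0
    obtain ⟨c, hc⟩ := hl a h0
    exact hc (by simpa [f] using LinearMap.congr_fun ha c)
  have hsurj := (LinearMap.injective_iff_surjective_of_finrank_eq_finrank
    (Subspace.dual_finrank_eq (K := k) (V := B)).symm).1 hf
  obtain ⟨a, ha⟩ := hsurj m
  exact ⟨a, fun c => by rw [← ha]; rfl⟩

/-- A finite algebra that is isomorphic to its dual by a linear form is self-injective. -/
theorem baer_of_functional [Module.Finite k B] {l : B →ₗ[k] k}
    (hl : ∀ a, a ≠ 0 → ∃ c, l (a * c) ≠ 0) : Module.Baer B B := by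
  intro I g
  obtain ⟨m, hm⟩ := LinearMap.exists_extend (p := I.restrictScalars k)
    (l ∘ₗ (g.restrictScalars k))
  obtain ⟨a, ha⟩ := exists_functional_eq_mul hl m
  refine ⟨LinearMap.mulLeft B a, fun x hx => ?_⟩
  by_contra hne
  obtain ⟨c, hc⟩ := hl _ (sub_ne_zero.2 hne)
  apply hc
  have h1 : g ⟨x, hx⟩ * c = g ⟨x * c, I.mul_mem_right c hx⟩ := by
    have : (⟨x * c, I.mul_mem_right c hx⟩ : I) = c • ⟨x, hx⟩ := by
      ext; simp [mul_comm]
    rw [this, map_smul, smul_eq_mul, mul_comm]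
  have h2 := LinearMap.congr_fun hm ⟨x * c, I.mul_mem_right c hx⟩
  simp only [LinearMap.comp_apply, Submodule.subtype_apply] at h2
  rw [sub_mul, map_sub, LinearMap.mulLeft_apply, mul_assoc, ← ha, h1, sub_eq_zero]
  exact h2

/-- A finite local algebra with simple socle and residue field `k` is self-injective. -/
theorem SimpleSocle.baer [IsLocalRing B] [Module.Finite k B] (h : SimpleSocle B)
    (hres : ∀ b : B, ∃ c : k, b - algebraMap k B c ∈ maximalIdeal B) : Module.Baer B B := by
  have : IsArtinianRing B := IsArtinianRing.of_finite k B
  obtain ⟨l, hl⟩ := h.exists_functional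
    (by rw [← jacobson_eq_maximalIdeal ⊥ bot_ne_top]; exact IsArtinianRing.isNilpotent_jacobson_bot)
    hres
  exact baer_of_functional hl

end SelfInjective

section Annihilator

variable {B : Type*} [CommRing B]

/-- Over a self-injective ring, `(b) ⊆ (a)` as soon as the annihilator of `a` annihilates `b`. -/
theorem exists_eq_mul_of_baer (h : Module.Baer B B) {a b : B}
    (hker : ∀ c, c * a = 0 → c * b = 0) : ∃ r, b = r * a := by
  let f := Submodule.liftQ (LinearMap.ker (LinearMap.toSpanSingleton B B a))
    (LinearMap.toSpanSingleton B B a) le_rfl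
  have hf : Function.Injective f := by
    rw [← LinearMap.ker_eq_bot]
    exact Submodule.ker_liftQ_eq_bot _ _ _ le_rfl
  let g := Submodule.liftQ (LinearMap.ker (LinearMap.toSpanSingleton B B a))
    (LinearMap.toSpanSingleton B B b) (by
      intro c hc
      rw [LinearMap.mem_ker, LinearMap.toSpanSingleton_apply, smul_eq_mul] at hc ⊢
      exact hker c hc)
  obtain ⟨G, hG⟩ := h.extension_property f hf g
  refine ⟨G 1, ?_⟩
  have h1 := LinearMap.congr_fun hG (Submodule.Quotient.mk 1)
  simp only [LinearMap.comp_apply, f, g, Submodule.liftQ_apply, LinearMap.toSpanSingleton_apply,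
    one_smul] at h1
  rw [← h1, mul_comm, ← smul_eq_mul, ← map_smul, smul_eq_mul, mul_one]

theorem simpleSocle_of_baer [IsLocalRing B] (h : Module.Baer B B) : SimpleSocle B := by
  intro a b ha hb ha0
  refine exists_eq_mul_of_baer h fun c hc => hb c ((mem_maximalIdeal c).2 fun hu => ha0 ?_)
  exact (hu.mul_right_eq_zero).1 hc

end Annihilator

section InjectiveDimension

universe v

variable {B : Type v} [CommRing B]

theorem isGorensteinLocalRing_of_baer [IsLocalRing B] [IsNoetherianRing B]
    (h : Module.Baer B B) : IsGorensteinLocalRing B where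
  isLocalRing := inferInstance
  isNoetherianRing := inferInstance
  finite_injectiveDimension := by
    have := h.injective
    have : Injective (ModuleCat.of B B) := Module.injective_object_of_injective_module _ _
    exact ⟨0, injective_iff_hasInjectiveDimensionLT_one.1 this⟩

open Abelian in
/-- Let `B` be local with nilpotent maximal ideal. If all `Ext`-groups into `B` vanish in degree
`i + 2`, then they vanish in degree `i + 1`: first for vector spaces over the residue field, which
embed into free modules because the residue field embeds into `B`, and then for all modules. -/
theorem hasInjectiveDimensionLT_of_succ [IsLocalRing B] (hnil : IsNilpotent (maximalIdeal B))
    {i : ℕ} [HasInjectiveDimensionLT (ModuleCat.of B B) (i + 2)] :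
    HasInjectiveDimensionLT (ModuleCat.of B B) (i + 1) := by
  have hvec : ∀ (Y : ModuleCat.{v} B), (∀ a ∈ maximalIdeal B, ∀ y : Y, a • y = 0) →
      ∀ e : Ext Y (ModuleCat.of B B) (i + 1), e = 0 := by
    intro Y hY e
    obtain ⟨s, hs, hsoc⟩ := exists_mul_mem_socle hnil (one_ne_zero (α := B))
    rw [one_mul] at hs hsoc
    have htors : Module.IsTorsionBySet B Y (maximalIdeal B : Set B) :=
      fun y a => hY a a.2 y
    let : Module (B ⧸ maximalIdeal B) Y := htors.module
    have : IsScalarTower B (B ⧸ maximalIdeal B) Y := htors.isScalarTower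
    let : Field (B ⧸ maximalIdeal B) := Ideal.Quotient.field _
    let b := Module.Basis.ofVectorSpace (B ⧸ maximalIdeal B) Y
    -- the residue field embeds into `B` because the socle contains a nonzero element `s`
    let emb : (B ⧸ maximalIdeal B) →ₗ[B] B :=
      Submodule.liftQ _ (LinearMap.toSpanSingleton B B s) (by
        intro c hc
        rw [LinearMap.mem_ker, LinearMap.toSpanSingleton_apply, smul_eq_mul]
        exact hsoc c hc)
    have hemb : Function.Injective emb := by
      rw [← LinearMap.ker_eq_bot, Submodule.ker_liftQ_eq_bot]
      intro c hc
      rw [LinearMap.mem_ker, LinearMap.toSpanSingleton_apply, smul_eq_mul] at hc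
      exact (mem_maximalIdeal c).2 fun hu => hs ((hu.mul_right_eq_zero).1 hc)
    let f : Y →ₗ[B] (Module.Basis.ofVectorSpaceIndex (B ⧸ maximalIdeal B) Y →₀ B) :=
      Finsupp.mapRange.linearMap emb ∘ₗ b.repr.toLinearMap.restrictScalars B
    have hf : Function.Injective f :=
      (Finsupp.mapRange_injective _ (map_zero emb) hemb).comp b.repr.injective
    let S : ShortComplex (ModuleCat.{v} B) :=
      ShortComplex.mk (ModuleCat.ofHom f) (ModuleCat.ofHom (LinearMap.range f).mkQ) (by
        ext x
        simp)
    have hS : S.ShortExact := {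
      exact := by
        rw [ShortComplex.moduleCat_exact_iff_ker_sub_range]
        intro x hx
        simpa [S] using hx
      mono_f := (ModuleCat.mono_iff_injective _).2 hf
      epi_g := (ModuleCat.epi_iff_surjective _).2 (Submodule.mkQ_surjective _) }
    -- the class lifts to `Ext` of the free module, as the next `Ext` of the cokernel vanishes
    obtain ⟨x₂, hx₂⟩ := Ext.contravariant_sequence_exact₁ hS (ModuleCat.of B B) e
      (by omega : 1 + (i + 1) = i + 2)
      (Ext.eq_zero_of_hasInjectiveDimensionLT _ (i + 2) le_rfl)
    have : Projective S.X₂ := by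
      refine (IsProjective.iff_projective (R := B) (P := _)).1 ?_
      infer_instance
    rw [← hx₂, Ext.eq_zero_of_projective x₂, Ext.comp_zero]
  obtain ⟨N, hN⟩ := hnil
  -- modules killed by a power of the maximal ideal, by the filtration by its powers
  have hall : ∀ (s : ℕ) (Y : ModuleCat.{v} B), (∀ a ∈ maximalIdeal B ^ s, ∀ y : Y, a • y = 0) →
      ∀ e : Ext Y (ModuleCat.of B B) (i + 1), e = 0 := by
    intro s
    induction s with
    | zero =>
      intro Y hY e
      refine hvec Y (fun a _ y => ?_) e
      have := hY 1 (by simp) y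
      rw [one_smul] at this
      rw [this, smul_zero]
    | succ s ih =>
      intro Y hY e
      let P : Submodule B Y := maximalIdeal B • ⊤
      let S : ShortComplex (ModuleCat.{v} B) :=
        ShortComplex.mk (ModuleCat.ofHom P.subtype) (ModuleCat.ofHom P.mkQ) (by
          ext x
          simp)
      have hS : S.ShortExact := {
        exact := by
          rw [ShortComplex.moduleCat_exact_iff_ker_sub_range]
          intro x hx
          simpa [S] using hx
        mono_f := (ModuleCat.mono_iff_injective _).2 P.subtype_injective
        epi_g := (ModuleCat.epi_iff_surjective _).2 P.mkQ_surjective }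
      obtain ⟨x₃, hx₃⟩ := Ext.contravariant_sequence_exact₂ hS (ModuleCat.of B B) e
        (ih _ (fun a ha y => by
          obtain ⟨y, hy⟩ := y
          ext
          change a • y = 0
          refine Submodule.smul_induction_on hy (fun r hr z _ => ?_) fun z w hz hw => ?_
          · rw [smul_smul]
            refine hY _ ?_ z
            rw [pow_succ]
            exact Ideal.mul_mem_mul ha hr
          · rw [smul_add, hz, hw, add_zero]) _)
      rw [← hx₃, hvec _ (fun a ha y => by
          obtain ⟨y, rfl⟩ := P.mkQ_surjective y
          rw [← map_smul]
          exact (Submodule.Quotient.mk_eq_zero _).2 (Submodule.smul_mem_smul ha trivial)) x₃,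
        Ext.comp_zero]
  rw [hasInjectiveDimensionLT_iff]
  intro j hj Y e
  rcases hj.lt_or_eq with hj | rfl
  · exact Ext.eq_zero_of_hasInjectiveDimensionLT e (i + 2) hj
  · exact hall N Y (fun a ha y => by
      rw [hN] at ha
      rw [(Submodule.mem_bot _).1 ha, zero_smul]) e

/-- A Gorenstein local ring with nilpotent maximal ideal is self-injective. -/
theorem IsGorensteinLocalRing.baer [IsLocalRing B] (hnil : IsNilpotent (maximalIdeal B))
    (h : IsGorensteinLocalRing B) : Module.Baer B B := by
  obtain ⟨m, hm⟩ := h.finite_injectiveDimension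
  change HasInjectiveDimensionLT _ (m + 1) at hm
  induction m with
  | zero =>
    have : Injective (ModuleCat.of B B) := injective_iff_hasInjectiveDimensionLT_one.2 hm
    exact Module.Baer.of_injective (Module.injective_module_of_injective_object _ _)
  | succ m ih => exact ih (hasInjectiveDimensionLT_of_succ hnil)

end InjectiveDimension

end ProjRat

/-! ### Almost complete intersections are not Gorenstein -/

namespace ProjRat

open IsLocalRing GradedComplex

section Socle

variable {R : Type*} [CommRing R] [IsLocalRing R]

/-- Any two elements of top degree in the exterior algebra of a free module of rank `n` are
proportional modulo the maximal ideal, with coefficients that are not both in it. -/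
theorem exists_relation_top_degree {M : Type*} [AddCommGroup M] [Module R M] {n : ℕ}
    (b : Module.Basis (Fin n) R M) (φ : Module.Dual R M) {u v : ExteriorAlgebra R M}
    (hu : u ∈ (koszul φ).C n) (hv : v ∈ (koszul φ).C n) :
    ∃ r t : R, ¬ (r ∈ maximalIdeal R ∧ t ∈ maximalIdeal R) ∧
      r • u + t • v ∈ maximalIdeal R • (⊤ : Submodule R (ExteriorAlgebra R M)) := by
  have huniq : ∀ s t : Set.powersetCard (Fin n) n, s = t := by
    have h : ∀ s : Set.powersetCard (Fin n) n, (s : Finset (Fin n)) = Finset.univ := fun s =>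
      (Finset.card_eq_iff_eq_univ _).1 (by
        have h1 : (s : Finset (Fin n)).card = n := s.2
        rw [h1, Fintype.card_fin])
    exact fun s t => Subtype.ext ((h s).trans (h t).symm)
  let s₀ : Set.powersetCard (Fin n) n := ⟨Finset.univ, by simp⟩
  have : Unique (Set.powersetCard (Fin n) n) := ⟨⟨s₀⟩, fun s => huniq _ _⟩
  let e := b.exteriorPower (n := n)
  have key : ∀ w ∈ (koszul φ).C n, ∃ a : R, w = a • (e default : ExteriorAlgebra R M) := by
    intro w hw
    refine ⟨e.repr ⟨w, hw⟩ default, ?_⟩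
    have := e.sum_repr ⟨w, hw⟩
    rw [Fintype.sum_unique] at this
    have h2 := congrArg Subtype.val this
    exact h2.symm
  obtain ⟨α, rfl⟩ := key u hu
  obtain ⟨β, rfl⟩ := key v hv
  by_cases hα : α ∈ maximalIdeal R
  · refine ⟨1, 0, fun h => ?_, ?_⟩
    · exact (mem_maximalIdeal _).1 h.1 isUnit_one
    · rw [zero_smul, add_zero, one_smul]
      exact smul_mem_smul_top hα _
  · refine ⟨β, -α, fun h => hα (by simpa using h.2), ?_⟩
    rw [smul_smul, smul_smul, ← add_smul, mul_comm, neg_mul, add_neg_cancel, zero_smul]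
    exact Submodule.zero_mem _

variable {n : ℕ} {x f : Fin n → R}

/-- An Artinian complete intersection has a simple socle. -/
theorem simpleSocle_quotient (hx : RegularFamily x)
    (hxm : Ideal.span (Set.range x) = maximalIdeal R)
    (h : ∀ j, ∃ N, x j ^ N ∈ Ideal.span (Set.range f))
    [IsLocalRing (R ⧸ Ideal.span (Set.range f))] :
    SimpleSocle (R ⧸ Ideal.span (Set.range f)) := by
  have hex : ∀ i, (koszul (formOf f)).ExactMod ⊥ i := by
    intro i
    exact koszul_exactMod_bot (s := 0) _ (Pi.basisFun R (Fin n)) hx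
      (by rw [range_formOf]; exact h) (by omega) i (Nat.zero_le _)
  have := free_exteriorAlgebra (Pi.basisFun R (Fin n))
  intro a b ha hb ha0
  obtain ⟨a, rfl⟩ := Ideal.Quotient.mk_surjective a
  obtain ⟨b, rfl⟩ := Ideal.Quotient.mk_surjective b
  have hm : ∀ y ∈ maximalIdeal R,
      Ideal.Quotient.mk (Ideal.span (Set.range f)) y ∈
        maximalIdeal (R ⧸ Ideal.span (Set.range f)) := by
    intro y hy
    rw [mem_maximalIdeal, mem_nonunits_iff] at hy ⊢
    have : IsLocalHom (Ideal.Quotient.mk (Ideal.span (Set.range f))) :=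
      IsLocalHom.of_surjective _ Ideal.Quotient.mk_surjective
    exact fun hu => hy (isUnit_of_map_unit _ _ hu)
  have hd : ∀ c : R, c ∈ Ideal.span (Set.range f) →
      ∃ w ∈ (koszul (formOf f)).C 1, algebraMap R _ c = (koszul (formOf f)).d w := by
    intro c hc
    rw [← range_formOf] at hc
    obtain ⟨m, rfl⟩ := hc
    exact ⟨_, (mem_koszul_C_one _).2 ⟨m, rfl⟩, (koszul_d_ι _ m).symm⟩
  have hann : ∀ c : R, (∀ y ∈ maximalIdeal (R ⧸ Ideal.span (Set.range f)),
      y * Ideal.Quotient.mk (Ideal.span (Set.range f)) c = 0) → ∀ j, ∃ w ∈ (koszul (formOf f)).C 1,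
      x j • algebraMap R (ExteriorAlgebra R (Fin n → R)) c = (koszul (formOf f)).d w := by
    intro c hc j
    rw [Algebra.smul_def, ← map_mul]
    refine hd _ ?_
    rw [← Ideal.Quotient.eq_zero_iff_mem, map_mul]
    refine hc _ (hm _ ?_)
    rw [← hxm]
    exact Ideal.subset_span ⟨j, rfl⟩
  obtain ⟨r, t, hrt, w, hw, hrel⟩ := exists_relation_of_annihilated (koszul (formOf f)) hx
    (maximalIdeal R) hex (by
      rw [hxm]
      exact fun u hu v hv => exists_relation_top_degree (Pi.basisFun R (Fin n)) _ hu hv)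
    ((mem_koszul_C_zero _).2 ⟨a, rfl⟩) ((mem_koszul_C_zero _).2 ⟨b, rfl⟩)
    (koszul_d_algebraMap _ a) (koszul_d_algebraMap _ b) (hann a ha) (hann b hb)
  obtain ⟨m, rfl⟩ := (mem_koszul_C_one _).1 hw
  rw [koszul_d_ι, Algebra.smul_def, Algebra.smul_def, ← map_mul, ← map_mul, ← map_add] at hrel
  have hmem : r * a + t * b ∈ Ideal.span (Set.range f) := by
    rw [ExteriorAlgebra.algebraMap_leftInverse _ |>.injective hrel, ← range_formOf]
    exact ⟨m, rfl⟩
  have h0 := Ideal.Quotient.eq_zero_iff_mem.2 hmem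
  rw [map_add, map_mul, map_mul] at h0
  -- if `t` were in the maximal ideal, `t * b` would vanish modulo `f`, and hence also `a`
  have ht : IsUnit t := by
    by_contra ht
    have ht' : t ∈ maximalIdeal R := (mem_maximalIdeal t).2 ht
    have hr : IsUnit r := by
      by_contra hr
      exact hrt ⟨(mem_maximalIdeal r).2 hr, ht'⟩
    rw [hb _ (hm t ht'), add_zero] at h0
    exact ha0 (((hr.map (Ideal.Quotient.mk _)).mul_right_eq_zero).1 h0)
  obtain ⟨t, rfl⟩ := ht
  refine ⟨Ideal.Quotient.mk _ (-(t⁻¹ : Rˣ) * r), ?_⟩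
  have h1 : Ideal.Quotient.mk (Ideal.span (Set.range f)) ((t⁻¹ : Rˣ) : R) *
      Ideal.Quotient.mk (Ideal.span (Set.range f)) t = 1 := by
    rw [← map_mul, Units.inv_mul, map_one]
  rw [map_mul, map_neg]
  linear_combination (-Ideal.Quotient.mk (Ideal.span (Set.range f)) b) * h1 +
    (Ideal.Quotient.mk (Ideal.span (Set.range f)) ((t⁻¹ : Rˣ) : R)) * h0

end Socle

section DividedPowers

variable {R : Type*} [CommRing R] {M : Type*} [AddCommGroup M] [Module R M]
  (φ : Module.Dual R M) (z : M) (hz : φ z = 0)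

/-- Sequences of elements of the exterior algebra, as coefficients of the divided powers of a
variable of degree `2`. The differential is the Koszul differential on coefficients, and the
derivative of the variable is the syzygy `z`. -/
def tateDifferential :
    (ℕ →₀ ExteriorAlgebra R M) →ₗ[R] (ℕ →₀ ExteriorAlgebra R M) :=
  Finsupp.mapRange.linearMap (koszul φ).d +
    Finsupp.mapRange.linearMap (LinearMap.mulLeft R (ExteriorAlgebra.ι R z)) ∘ₗ
      Finsupp.lcomapDomain Nat.succ Nat.succ_injective

theorem tateDifferential_apply (c : ℕ →₀ ExteriorAlgebra R M) (p : ℕ) :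
    tateDifferential φ z c p =
      (koszul φ).d (c p) + ExteriorAlgebra.ι R z * c (p + 1) := rfl

/-- The chains of degree `m`: the coefficient of the `p`-th divided power has degree `m - 2p`. -/
def tateChains (m : ℕ) : Submodule R (ℕ →₀ ExteriorAlgebra R M) where
  carrier := {c | ∀ p, (2 * p ≤ m → c p ∈ (koszul φ).C (m - 2 * p)) ∧ (m < 2 * p → c p = 0)}
  zero_mem' p := ⟨fun _ => Submodule.zero_mem _, fun _ => rfl⟩
  add_mem' {a b} ha hb p := ⟨fun h => Submodule.add_mem _ ((ha p).1 h) ((hb p).1 h),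
    fun h => by rw [Finsupp.add_apply, (ha p).2 h, (hb p).2 h, add_zero]⟩
  smul_mem' r a ha p := ⟨fun h => Submodule.smul_mem _ r ((ha p).1 h),
    fun h => by rw [Finsupp.smul_apply, (ha p).2 h, smul_zero]⟩

theorem single_mem_tateChains {m p : ℕ} (h : 2 * p ≤ m) {u : ExteriorAlgebra R M}
    (hu : u ∈ (koszul φ).C (m - 2 * p)) : Finsupp.single p u ∈ tateChains φ m := by
  intro q
  rcases eq_or_ne p q with rfl | hne
  · rw [Finsupp.single_eq_same]
    exact ⟨fun _ => hu, fun h' => by omega⟩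
  · rw [Finsupp.single_eq_of_ne hne.symm]
    exact ⟨fun _ => Submodule.zero_mem _, fun _ => rfl⟩

/-- The Koszul complex with a divided power variable adjoined to kill the class of the
syzygy `z`. -/
def tateComplex : GradedComplex R (ℕ →₀ ExteriorAlgebra R M) where
  d := tateDifferential φ z
  C := tateChains φ
  proj m := ∑ p ∈ Finset.range (m / 2 + 1),
    Finsupp.lsingle p ∘ₗ (koszul φ).proj (m - 2 * p) ∘ₗ Finsupp.lapply p
  d_d c := by
    ext1 p
    rw [tateDifferential_apply, tateDifferential_apply, tateDifferential_apply, map_add,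
      (koszul φ).d_d, koszul_d_ι_mul, hz, zero_smul, mul_add, ← mul_assoc,
      ExteriorAlgebra.ι_sq_zero]
    simp
  d_mem {m c} hc := by
    intro p
    rw [tateDifferential_apply]
    refine ⟨fun hp => Submodule.add_mem _ ?_ ?_, fun hp => ?_⟩
    · have := (hc p).1 (by omega)
      rw [show m + 1 - 2 * p = m - 2 * p + 1 by omega] at this
      exact (koszul φ).d_mem this
    · rcases le_or_gt (2 * (p + 1)) (m + 1) with h | h
      · have := (hc (p + 1)).1 h
        rw [show m - 2 * p = m + 1 - 2 * (p + 1) + 1 by omega]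
        exact ι_mul_mem_koszul_C φ z this
      · rw [(hc (p + 1)).2 h, mul_zero]
        exact Submodule.zero_mem _
    · rw [(hc (p + 1)).2 (by omega), mul_zero, add_zero]
      rcases eq_or_lt_of_le (show m + 1 ≤ 2 * p by omega) with h | h
      · have := (hc p).1 h.ge
        rw [h, Nat.sub_self, mem_koszul_C_zero] at this
        obtain ⟨r, hr⟩ := this
        rw [← hr, koszul_d_algebraMap]
      · rw [(hc p).2 h, map_zero]
  proj_mem m c := by
    rw [LinearMap.sum_apply]
    refine Submodule.sum_mem _ fun p hp => ?_
    rw [Finset.mem_range] at hp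
    exact single_mem_tateChains φ (by omega) ((koszul φ).proj_mem _ _)
  proj_of_mem {m c} hc := by
    ext1 q
    rw [LinearMap.sum_apply, Finsupp.finsetSum_apply]
    rcases le_or_gt (2 * q) m with h | h
    · rw [Finset.sum_eq_single q]
      · simp only [LinearMap.comp_apply, Finsupp.lsingle_apply, Finsupp.lapply_apply,
          Finsupp.single_eq_same]
        exact (koszul φ).proj_of_mem ((hc q).1 h)
      · intro p _ hpq
        simp [Finsupp.single_eq_of_ne hpq.symm]
      · intro hq
        exact absurd (Finset.mem_range.2 (by omega)) hq
    · rw [(hc q).2 h]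
      refine Finset.sum_eq_zero fun p hp => ?_
      rw [Finset.mem_range] at hp
      simp [Finsupp.single_eq_of_ne (show q ≠ p by omega)]

variable {φ z}

/-- If the Koszul homology vanishes above degree `1` and its part in degree `1` is free of
rank one over the homology in degree `0`, generated by the class of `z`, then adjoining a divided
power variable that kills this class gives an exact complex. -/
theorem tateComplex_exactMod (h2 : ∀ i, 1 ≤ i → (koszul φ).ExactMod ⊥ i)
    (h1 : ∀ c, φ c = 0 → ∃ e : R, c - e • z ∈ trivialSyzygies φ)
    (h0 : ∀ e : R, e • z ∈ trivialSyzygies φ → e ∈ LinearMap.range φ) :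
    ∀ i, (tateComplex φ z hz).ExactMod ⊥ i := by
  have hex : ∀ j, 2 ≤ j → ∀ u ∈ (koszul φ).C j, (koszul φ).d u = 0 →
      ∃ v ∈ (koszul φ).C (j + 1), u = (koszul φ).d v := by
    intro j hj u hu hdu
    obtain ⟨j, rfl⟩ : ∃ i, j = i + 1 := ⟨j - 1, by omega⟩
    obtain ⟨v, hv, h⟩ := h2 j (by omega) u hu (by rw [hdu]; exact Submodule.zero_mem _)
    rw [Submodule.bot_smul, Submodule.mem_bot, sub_eq_zero] at h
    exact ⟨v, hv, h⟩
  let K := tateComplex φ z hz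
  have happ : ∀ c p, K.d c p = (koszul φ).d (c p) + ExteriorAlgebra.ι R z * c (p + 1) :=
    tateDifferential_apply φ z
  -- cycles in whose leading coefficient the Koszul degree is at least two
  have hlow : ∀ (s m : ℕ), 2 * s + 2 ≤ m → ∀ c ∈ K.C m, K.d c = 0 → (∀ p, s < p → c p = 0) →
      ∃ v ∈ K.C (m + 1), c = K.d v := by
    intro s
    induction s with
    | zero =>
      intro m hm c hc hdc hs
      have hd0 : (koszul φ).d (c 0) = 0 := by
        have := happ c 0
        rw [hdc, hs 1 one_pos, mul_zero, add_zero] at this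
        exact this.symm
      obtain ⟨v, hv, hcv⟩ := hex m (by omega) (c 0) ((hc 0).1 (by omega)) hd0
      refine ⟨Finsupp.single 0 v, single_mem_tateChains φ (by omega) hv, ?_⟩
      ext1 p
      rw [happ, Finsupp.single_eq_of_ne (show p + 1 ≠ 0 by omega), mul_zero, add_zero]
      rcases Nat.eq_zero_or_pos p with rfl | hp
      · rw [Finsupp.single_eq_same, hcv]
      · rw [hs p hp, Finsupp.single_eq_of_ne hp.ne', map_zero]
    | succ s ih =>
      intro m hm c hc hdc hs
      have hd0 : (koszul φ).d (c (s + 1)) = 0 := by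
        have := happ c (s + 1)
        rw [hdc, hs (s + 1 + 1) (by omega), mul_zero, add_zero] at this
        exact this.symm
      obtain ⟨v, hv, hcv⟩ := hex _ (by omega) (c (s + 1)) ((hc (s + 1)).1 (by omega)) hd0
      have hv' : Finsupp.single (s + 1) v ∈ K.C (m + 1) :=
        single_mem_tateChains φ (by omega)
          (by rwa [show m + 1 - 2 * (s + 1) = m - 2 * (s + 1) + 1 by omega])
      obtain ⟨w, hw, hcw⟩ := ih m (by omega) (c - K.d (Finsupp.single (s + 1) v))
        (Submodule.sub_mem _ hc (K.d_mem hv')) (by rw [map_sub, hdc, K.d_d, sub_zero]) (by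
          intro p hp
          rw [Finsupp.sub_apply, happ, Finsupp.single_eq_of_ne (show p + 1 ≠ s + 1 by omega),
            mul_zero, add_zero]
          rcases eq_or_ne p (s + 1) with rfl | hne
          · rw [Finsupp.single_eq_same, hcv, sub_self]
          · rw [Finsupp.single_eq_of_ne hne, map_zero, sub_zero, hs p (by omega)])
      exact ⟨w + Finsupp.single (s + 1) v, Submodule.add_mem _ hw hv', by
        rw [map_add, ← hcw, sub_add_cancel]⟩
  intro i c hc hdc
  rw [Submodule.bot_smul, Submodule.mem_bot] at hdc
  suffices h : ∃ v ∈ K.C (i + 2), c = K.d v by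
    obtain ⟨v, hv, rfl⟩ := h
    exact ⟨v, hv, by rw [sub_self]; exact Submodule.zero_mem _⟩
  -- it is enough to remove the leading coefficient
  have hred : ∀ (s : ℕ), i + 1 < 2 * s + 2 → 2 * s ≤ i + 1 →
      (∃ v ∈ K.C (i + 2), ∀ p, s ≤ p → (c - K.d v) p = 0) → ∃ v ∈ K.C (i + 2), c = K.d v := by
    rintro s hs hs' ⟨v, hv, hcv⟩
    rcases Nat.eq_zero_or_pos s with rfl | hpos
    · refine ⟨v, hv, sub_eq_zero.1 ?_⟩
      ext1 p
      exact hcv p (Nat.zero_le _)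
    · obtain ⟨w, hw, hcw⟩ := hlow (s - 1) (i + 1) (by omega) (c - K.d v)
        (Submodule.sub_mem _ hc (K.d_mem hv)) (by rw [map_sub, hdc, K.d_d, sub_zero])
        (fun p hp => hcv p (by omega))
      exact ⟨w + v, Submodule.add_mem _ hw hv, by rw [map_add, ← hcw, sub_add_cancel]⟩
  rcases Nat.even_or_odd' (i + 1) with ⟨s, hs | hs⟩
  · -- the leading coefficient is a scalar; it lies in the ideal
    refine hred s (by omega) (by omega) ?_
    obtain ⟨e, he⟩ := (mem_koszul_C_zero φ).1 (by
      have := (hc s).1 hs.ge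
      rwa [hs, Nat.sub_self] at this)
    have h3 : e • z ∈ trivialSyzygies φ := by
      have h4 := happ c (s - 1)
      rw [hdc, show s - 1 + 1 = s by omega, ← he, ← Algebra.commutes, ← Algebra.smul_def,
        ← map_smul] at h4
      have h5 := (hc (s - 1)).1 (by omega)
      rw [show i + 1 - 2 * (s - 1) = 2 by omega] at h5
      refine mem_trivialSyzygies_of_d_eq φ (v := -c (s - 1)) (Submodule.neg_mem _ h5) ?_
      rw [map_neg]
      exact eq_neg_of_add_eq_zero_right h4.symm
    obtain ⟨m, hm⟩ := h0 e h3
    refine ⟨Finsupp.single s (ExteriorAlgebra.ι R m), single_mem_tateChains φ (by omega) ?_, ?_⟩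
    · rw [show i + 2 - 2 * s = 1 by omega]
      exact (mem_koszul_C_one φ).2 ⟨m, rfl⟩
    · intro p hp
      rw [Finsupp.sub_apply, happ, Finsupp.single_eq_of_ne (show p + 1 ≠ s by omega), mul_zero,
        add_zero]
      rcases eq_or_ne p s with rfl | hne
      · rw [Finsupp.single_eq_same, koszul_d_ι, hm, he, sub_self]
      · rw [Finsupp.single_eq_of_ne hne, map_zero, sub_zero]
        exact (hc p).2 (by omega)
  · -- the leading coefficient is a syzygy; it is a multiple of `z` up to a boundary
    refine hred s (by omega) (by omega) ?_
    obtain ⟨m, hm⟩ := (mem_koszul_C_one φ).1 (by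
      have := (hc s).1 (by omega)
      rwa [show i + 1 - 2 * s = 1 by omega] at this)
    have hφm : φ m = 0 := by
      have h4 := happ c s
      rw [hdc, (hc (s + 1)).2 (by omega), mul_zero, add_zero, ← hm, koszul_d_ι] at h4
      exact (ExteriorAlgebra.algebraMap_leftInverse M).injective (by rw [← h4, map_zero]; rfl)
    obtain ⟨e, he⟩ := h1 m hφm
    obtain ⟨v, hv, hev⟩ := exists_d_eq_of_mem_trivialSyzygies φ he
    refine ⟨Finsupp.single s v + Finsupp.single (s + 1) (algebraMap R _ e),
      Submodule.add_mem _ (single_mem_tateChains φ (by omega) ?_)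
        (single_mem_tateChains φ (by omega) ?_), ?_⟩
    · rwa [show i + 2 - 2 * s = 2 by omega]
    · rw [show i + 2 - 2 * (s + 1) = 0 by omega]
      exact (mem_koszul_C_zero φ).2 ⟨e, rfl⟩
    · intro p hp
      rw [Finsupp.sub_apply, happ, Finsupp.add_apply, Finsupp.add_apply,
        Finsupp.single_eq_of_ne (show p + 1 ≠ s by omega), zero_add, map_add]
      rcases eq_or_ne p s with rfl | hne
      · rw [Finsupp.single_eq_same, Finsupp.single_eq_same,
          Finsupp.single_eq_of_ne (show p ≠ p + 1 by omega), map_zero, add_zero, ← hev, ← hm,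
          ← Algebra.commutes, ← Algebra.smul_def, map_sub, map_smul]
        abel
      · rw [Finsupp.single_eq_of_ne hne, map_zero, zero_add,
          Finsupp.single_eq_of_ne (show p + 1 ≠ s + 1 by omega), mul_zero, add_zero,
          (hc p).2 (by omega), zero_sub, neg_eq_zero]
        rcases eq_or_ne p (s + 1) with rfl | hne'
        · rw [Finsupp.single_eq_same, koszul_d_algebraMap]
        · rw [Finsupp.single_eq_of_ne hne', map_zero]

/-- Over a local ring whose maximal ideal is generated by a regular family, the syzygy `z` cannot
have all its coefficients in the maximal ideal when the complex is exact: the complex would be an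
infinite minimal resolution. -/
theorem not_mem_maximalIdeal_smul [IsLocalRing R] {r n : ℕ} (b : Module.Basis (Fin r) R M)
    {x : Fin n → R} (hx : RegularFamily x) (hxm : Ideal.span (Set.range x) = maximalIdeal R)
    (hK : ∀ i, (tateComplex φ z hz).ExactMod ⊥ i) (hφ : ∀ m, φ m ∈ maximalIdeal R) :
    z ∉ maximalIdeal R • (⊤ : Submodule R M) := by
  intro hzm
  have := free_exteriorAlgebra b
  let K := tateComplex φ z hz
  have happ : ∀ c p, K.d c p = (koszul φ).d (c p) + ExteriorAlgebra.ι R z * c (p + 1) :=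
    tateDifferential_apply φ z
  have hcoord : ∀ c : ℕ →₀ ExteriorAlgebra R M,
      c ∈ maximalIdeal R • (⊤ : Submodule R (ℕ →₀ ExteriorAlgebra R M)) → ∀ p,
      c p ∈ maximalIdeal R • (⊤ : Submodule R (ExteriorAlgebra R M)) := by
    intro c hc p
    refine Submodule.smul_induction_on hc (fun a ha m _ => ?_) fun c c' h h' => ?_
    · exact smul_mem_smul_top ha _
    · exact Submodule.add_mem _ h h'
  have hιz : ∀ u : ExteriorAlgebra R M, ExteriorAlgebra.ι R z * u ∈
      maximalIdeal R • (⊤ : Submodule R (ExteriorAlgebra R M)) := by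
    intro u
    have h1 := Submodule.mem_map_of_mem
      (f := (LinearMap.mulRight R u).comp (ExteriorAlgebra.ι R (M := M))) hzm
    rw [Submodule.map_smul''] at h1
    exact Submodule.smul_mono le_rfl le_top h1
  have hkd : ∀ u : ExteriorAlgebra R M, (koszul φ).d u ∈
      maximalIdeal R • (⊤ : Submodule R (ExteriorAlgebra R M)) := by
    intro u
    induction u using CliffordAlgebra.left_induction with
    | algebraMap r => rw [koszul_d_algebraMap]; exact Submodule.zero_mem _
    | add u v hu hv => rw [map_add]; exact Submodule.add_mem _ hu hv
    | ι_mul u m hu =>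
      have := koszul_d_ι_mul φ m u
      rw [ExteriorAlgebra.ι] at this
      rw [this]
      exact Submodule.sub_mem _ (smul_mem_smul_top (hφ m) _)
        (map_mem_smul_top (LinearMap.mulLeft R _) hu)
  -- the divided power of order `n + 1` lives in degree `2 n + 2 > n`; its boundary vanishes modulo
  -- the maximal ideal, so exactness there makes it a boundary, but boundaries vanish as well
  have hd1 : K.d (Finsupp.single (n + 1) 1) =
      (Finsupp.single n (ExteriorAlgebra.ι R z)) := by
    ext1 p
    rw [happ]
    rcases eq_or_ne p n with rfl | hne
    · rw [Finsupp.single_eq_same, Finsupp.single_eq_same,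
        Finsupp.single_eq_of_ne (show p ≠ p + 1 by omega), map_zero, zero_add, mul_one]
    · rw [Finsupp.single_eq_of_ne (show p + 1 ≠ n + 1 by omega), mul_zero, add_zero,
        Finsupp.single_eq_of_ne hne]
      rcases eq_or_ne p (n + 1) with rfl | hne'
      · rw [Finsupp.single_eq_same, ← map_one (algebraMap R _), koszul_d_algebraMap]
      · rw [Finsupp.single_eq_of_ne hne', map_zero]
  have hex := exactMod_regularFamily K hx (s := 0) (fun i _ => hK i) (2 * n + 1) (by omega)
  rw [hxm] at hex
  obtain ⟨v, -, hv⟩ := hex (Finsupp.single (n + 1) 1)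
    (single_mem_tateChains φ (by omega) (by
      rw [show 2 * n + 1 + 1 - 2 * (n + 1) = 0 by omega]
      exact (mem_koszul_C_zero φ).2 ⟨1, map_one _⟩)) (by
    rw [hd1]
    have h1 := Submodule.mem_map_of_mem (f := (Finsupp.lsingle n).comp
      (ExteriorAlgebra.ι R (M := M))) hzm
    rw [Submodule.map_smul''] at h1
    exact Submodule.smul_mono le_rfl le_top h1)
  have h1 := hcoord _ hv (n + 1)
  rw [Finsupp.sub_apply, Finsupp.single_eq_same, happ] at h1
  have h2 := Submodule.add_mem _ h1 (Submodule.add_mem _ (hkd (v (n + 1)))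
    (hιz (v (n + 1 + 1))))
  rw [sub_add_cancel] at h2
  have h3 := Submodule.mem_map_of_mem (f := (ExteriorAlgebra.algebraMapInv (R := R)
    (M := M)).toLinearMap) h2
  rw [Submodule.map_smul''] at h3
  have h4 : (1 : R) ∈ maximalIdeal R • (⊤ : Submodule R R) := by
    simpa using Submodule.smul_mono (le_refl (maximalIdeal R)) le_top h3
  rw [Ideal.smul_eq_mul, Ideal.mul_top] at h4
  exact (mem_maximalIdeal _).1 h4 isUnit_one

end DividedPowers

end ProjRat

/-! ### Relations between generators -/

namespace ProjRat

open IsLocalRing GradedComplex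

section AlmostCompleteIntersection

variable {k : Type*} [Field k] {R : Type*} [CommRing R] [IsLocalRing R] [Algebra k R]

theorem exists_sub_algebraMap_mem_quotient
    (hres : ∀ b : R, ∃ c : k, b - algebraMap k R c ∈ maximalIdeal R) (I : Ideal R)
    [IsLocalRing (R ⧸ I)] (b : R ⧸ I) :
    ∃ c : k, b - algebraMap k (R ⧸ I) c ∈ maximalIdeal (R ⧸ I) := by
  obtain ⟨b, rfl⟩ := Ideal.Quotient.mk_surjective b
  obtain ⟨c, hc⟩ := hres b
  refine ⟨c, ?_⟩
  have : IsLocalHom (Ideal.Quotient.mk I) :=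
    IsLocalHom.of_surjective _ Ideal.Quotient.mk_surjective
  have h1 : Ideal.Quotient.mk I (b - algebraMap k R c) ∈ maximalIdeal (R ⧸ I) := by
    rw [mem_maximalIdeal, mem_nonunits_iff] at hc ⊢
    exact fun hu => hc (isUnit_of_map_unit _ _ hu)
  rwa [map_sub] at h1

variable {n : ℕ} {x f : Fin n → R} {g : R}

/-- Let `f` be a regular family of `n` elements and `g` a further element such that the quotient
by all of them has a simple socle. Then some syzygy of these `n + 1` elements has a unit among its
coefficients. Modulo `f`, duality yields an element `h` such that `(g)` and `(h)` are the
annihilators of one another; the syzygy is the one expressing that `g h` vanishes modulo `f`. -/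
theorem exists_syzygy_of_simpleSocle
    (hres : ∀ b : R, ∃ c : k, b - algebraMap k R c ∈ maximalIdeal R)
    (hx : RegularFamily x) (hxm : Ideal.span (Set.range x) = maximalIdeal R)
    (h : ∀ j, ∃ N, x j ^ N ∈ Ideal.span (Set.range f))
    (hf : ∀ i, f i ∈ maximalIdeal R) (hg : g ∈ maximalIdeal R)
    [Module.Finite k (R ⧸ Ideal.span (Set.range f))]
    [IsLocalRing (R ⧸ (Ideal.span (Set.range f) ⊔ Ideal.span {g}))]
    (hsoc : SimpleSocle (R ⧸ (Ideal.span (Set.range f) ⊔ Ideal.span {g}))) :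
    ∃ (a : Fin n → R) (b : R), ∑ i, a i * f i + b * g = 0 ∧
      (b ∉ maximalIdeal R ∨ ∃ i, a i ∉ maximalIdeal R) := by
  set J := Ideal.span (Set.range f) with hJ
  have hJm : J ≤ maximalIdeal R := by
    rw [hJ, Ideal.span_le]
    rintro _ ⟨i, rfl⟩
    exact hf i
  have : Nontrivial (R ⧸ J) := Ideal.Quotient.nontrivial_iff.2 fun h1 =>
    (maximalIdeal.isMaximal R).ne_top (top_le_iff.1 (h1 ▸ hJm))
  have : IsLocalRing (R ⧸ J) := IsLocalRing.of_surjective' (Ideal.Quotient.mk J)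
    Ideal.Quotient.mk_surjective
  have : IsArtinianRing (R ⧸ J) := IsArtinianRing.of_finite k _
  let π : (R ⧸ J) →ₐ[k] (R ⧸ (J ⊔ Ideal.span {g})) := Ideal.Quotient.factorₐ k le_sup_left
  have hπ : Function.Surjective π := Ideal.Quotient.factor_surjective le_sup_left
  have : Module.Finite k (R ⧸ (J ⊔ Ideal.span {g})) := Module.Finite.of_surjective π.toLinearMap hπ
  have : IsArtinianRing (R ⧸ (J ⊔ Ideal.span {g})) := IsArtinianRing.of_finite k _
  have hnil : ∀ (B : Type _) [CommRing B] [IsLocalRing B] [IsArtinianRing B],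
      IsNilpotent (maximalIdeal B) := fun B _ _ _ => by
    rw [← jacobson_eq_maximalIdeal ⊥ bot_ne_top]; exact IsArtinianRing.isNilpotent_jacobson_bot
  have hsocA : SimpleSocle (R ⧸ J) := simpleSocle_quotient hx hxm h
  have hbaer : Module.Baer (R ⧸ J) (R ⧸ J) :=
    hsocA.baer (k := k) (exists_sub_algebraMap_mem_quotient hres J)
  obtain ⟨l, hl⟩ := hsocA.exists_functional (k := k) (hnil _)
    (exists_sub_algebraMap_mem_quotient hres J)
  obtain ⟨m, hm⟩ := hsoc.exists_functional (k := k) (hnil _)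
    (exists_sub_algebraMap_mem_quotient hres _)
  -- the functional of the smaller quotient is a multiple of that of `R ⧸ J`; the multiplier `h₀`
  -- has annihilator `J ⊔ (g)`
  obtain ⟨h', hh'⟩ := exists_functional_eq_mul hl (m ∘ₗ π.toLinearMap)
  obtain ⟨h₀, rfl⟩ := Ideal.Quotient.mk_surjective h'
  have hann : ∀ c : R, h₀ * c ∈ J ↔ c ∈ J ⊔ Ideal.span {g} := by
    intro c
    rw [← Ideal.Quotient.eq_zero_iff_mem, ← Ideal.Quotient.eq_zero_iff_mem, map_mul]
    have hπc : Ideal.Quotient.mk (J ⊔ Ideal.span {g}) c = π (Ideal.Quotient.mk J c) := rfl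
    rw [hπc]
    constructor
    · intro h0
      by_contra hne
      obtain ⟨e, he⟩ := hm _ hne
      obtain ⟨e, rfl⟩ := hπ e
      apply he
      have := hh' (Ideal.Quotient.mk J c * e)
      rw [LinearMap.comp_apply, AlgHom.toLinearMap_apply, map_mul, ← mul_assoc, h0, zero_mul,
        map_zero] at this
      exact this
    · intro h0
      by_contra hne
      obtain ⟨e, he⟩ := hl _ hne
      apply he
      rw [mul_assoc, ← hh', LinearMap.comp_apply, AlgHom.toLinearMap_apply, map_mul, h0, zero_mul,
        map_zero]
  have hann' : ∀ c : R, g * c ∈ J → c ∈ J ⊔ Ideal.span {h₀} := by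
    intro c hc
    obtain ⟨r, hr⟩ := exists_eq_mul_of_baer hbaer (a := Ideal.Quotient.mk J h₀)
      (b := Ideal.Quotient.mk J c) (by
      intro d hd
      obtain ⟨d, rfl⟩ := Ideal.Quotient.mk_surjective d
      rw [← map_mul, Ideal.Quotient.eq_zero_iff_mem, mul_comm, hann, Submodule.mem_sup] at hd
      obtain ⟨y, hy, w, hw, rfl⟩ := hd
      obtain ⟨w, rfl⟩ := Ideal.mem_span_singleton'.1 hw
      rw [← map_mul, Ideal.Quotient.eq_zero_iff_mem, add_mul, mul_assoc]
      exact J.add_mem (J.mul_mem_right _ hy) (J.mul_mem_left _ hc))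
    obtain ⟨r, rfl⟩ := Ideal.Quotient.mk_surjective r
    rw [← map_mul, Ideal.Quotient.eq] at hr
    rw [← sub_add_cancel c (r * h₀)]
    exact Ideal.add_mem _ (Ideal.mem_sup_left hr)
      (Ideal.mem_sup_right (Ideal.mul_mem_left _ _ (Ideal.mem_span_singleton_self _)))
  have hgh : h₀ * g ∈ J := (hann g).2 (Ideal.mem_sup_right (Ideal.mem_span_singleton_self g))
  rw [hJ, ← range_formOf] at hgh
  obtain ⟨a, ha⟩ := hgh
  by_contra hcon
  push Not at hcon
  obtain ⟨hbm, ham⟩ := hcon (-a) h₀ (by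
    rw [← ha, formOf_apply]
    simp [neg_mul, Finset.sum_neg_distrib])
  -- the syzygy `z` that expresses `h₀ * g ∈ J`; it generates the first Koszul homology
  let φ : Module.Dual R ((Fin n → R) × R) :=
    (formOf f).coprod (LinearMap.toSpanSingleton R R g)
  have hφ : ∀ c : (Fin n → R) × R, φ c = formOf f c.1 + c.2 * g := fun c => rfl
  let z : (Fin n → R) × R := (-a, h₀)
  have hz : φ z = 0 := by
    rw [hφ]
    simp only [z, map_neg, ha]
    ring
  let b : Module.Basis (Fin (n + 1)) R ((Fin n → R) × R) :=
    ((Pi.basisFun R (Fin n)).prod (Module.Basis.singleton (Fin 1) R)).reindex finSumFinEquiv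
  have hrange : ∀ c ∈ J, c ∈ LinearMap.range φ := by
    intro c hc
    rw [hJ, ← range_formOf] at hc
    obtain ⟨m, rfl⟩ := hc
    exact ⟨(m, 0), by rw [hφ]; simp⟩
  have htriv : ∀ t ∈ trivialSyzygies φ, t.2 ∈ J := by
    intro t ht
    refine Submodule.span_induction ?_ J.zero_mem ?_ ?_ ht
    · rintro _ ⟨c, d, rfl⟩
      have : (φ c • d - φ d • c).2 = formOf f c.1 * d.2 - formOf f d.1 * c.2 := by
        simp only [hφ, Prod.snd_sub, Prod.smul_snd, smul_eq_mul]; ring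
      rw [this]
      have hmem : ∀ e, formOf f e ∈ J := fun e => by
        rw [hJ, ← range_formOf]; exact ⟨e, rfl⟩
      exact J.sub_mem (J.mul_mem_right _ (hmem _)) (J.mul_mem_right _ (hmem _))
    · intro c d _ _ hc hd
      exact J.add_mem hc hd
    · intro r c _ hc
      exact J.mul_mem_left r hc
  have hker : LinearMap.ker (formOf f) ≤ trivialSyzygies (formOf f) :=
    ker_le_trivialSyzygies_of_exactMod _ (koszul_exactMod_bot (s := 0) _ (Pi.basisFun R (Fin n)) hx
      (by rw [range_formOf]; exact h) (by omega) 0 le_rfl)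
  have hincl : ∀ t ∈ trivialSyzygies (formOf f), ((t, 0) : (Fin n → R) × R) ∈
      trivialSyzygies φ := by
    intro t ht
    refine Submodule.span_induction ?_ (Submodule.zero_mem _) ?_ ?_ ht
    · rintro _ ⟨c, d, rfl⟩
      refine Submodule.subset_span ⟨(c, 0), (d, 0), ?_⟩
      rw [hφ, hφ]
      ext <;> simp
    · intro c d _ _ hc hd
      simpa using Submodule.add_mem _ hc hd
    · intro r c _ hc
      simpa using Submodule.smul_mem _ r hc
  refine not_mem_maximalIdeal_smul (φ := φ) (z := z) hz b hx hxm
    (tateComplex_exactMod hz ?_ ?_ ?_) ?_ ?_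
  · exact koszul_exactMod_bot (s := 1) φ b hx (fun j => (h j).imp fun N hN => hrange _ hN)
      (by omega)
  · rintro ⟨c, γ⟩ hc
    rw [hφ] at hc
    simp only at hc
    have h1 : g * γ ∈ J := by
      have : g * γ = formOf f (-c) := by rw [map_neg]; linear_combination hc
      rw [this, hJ, ← range_formOf]
      exact ⟨-c, rfl⟩
    obtain ⟨y, hy, w, hw, hyw⟩ := Submodule.mem_sup.1 (hann' γ h1)
    obtain ⟨e, rfl⟩ := Ideal.mem_span_singleton'.1 hw
    rw [hJ, ← range_formOf] at hy
    obtain ⟨β, rfl⟩ := hy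
    refine ⟨e, ?_⟩
    have h2 : c + e • a + g • β ∈ trivialSyzygies (formOf f) := by
      refine hker ?_
      rw [LinearMap.mem_ker, map_add, map_add, map_smul, map_smul, ha, smul_eq_mul, smul_eq_mul]
      rw [← hyw] at hc
      linear_combination hc
    have h3 : φ (β, 0) • ((0, 1) : (Fin n → R) × R) - φ (0, 1) • ((β, 0) : (Fin n → R) × R) ∈
        trivialSyzygies φ := Submodule.subset_span ⟨_, _, rfl⟩
    have h4 := Submodule.add_mem _ (hincl _ h2) h3
    convert h4 using 1
    rw [hφ, hφ]
    ext i
    · simp [z]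
    · simp [z, ← hyw]
  · intro e he
    have h1 := htriv _ he
    simp only [z, Prod.smul_snd, smul_eq_mul] at h1
    rw [mul_comm, hann] at h1
    obtain ⟨y, hy, w, hw, rfl⟩ := Submodule.mem_sup.1 h1
    obtain ⟨w, rfl⟩ := Ideal.mem_span_singleton'.1 hw
    exact Submodule.add_mem _ (hrange _ hy) ⟨(0, w), by rw [hφ]; simp⟩
  · intro c
    rw [hφ]
    refine Ideal.add_mem _ (hJm ?_) (Ideal.mul_mem_left _ _ hg)
    rw [hJ, ← range_formOf]
    exact ⟨_, rfl⟩
  · have : z = ∑ i, (-a) i • ((Pi.single i 1, 0) : (Fin n → R) × R) + h₀ • (0, 1) := by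
      ext i
      · simp [z, Prod.fst_sum, Finset.sum_apply, Pi.single_apply]
      · simp [z, Prod.snd_sum]
    rw [this]
    exact Submodule.add_mem _ (Submodule.sum_mem _ fun i _ => smul_mem_smul_top (ham i) _)
      (smul_mem_smul_top hbm _)

/-- A regular family in the maximal ideal is a regular sequence in the sense of Mathlib. -/
theorem isRegular_ofFn (hreg : RegularFamily f) (hf : ∀ i, f i ∈ maximalIdeal R) :
    RingTheory.Sequence.IsRegular R (List.ofFn f) := by
  refine RingTheory.Sequence.IsRegular.of_isWeaklyRegular_of_mem_maximalIdeal
    (L := R) (R := R) ?_ ?_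
  rotate_left
  · rw [RingTheory.Sequence.isWeaklyRegular_iff_Fin]
    intro i
    have hi : (i : ℕ) < n := by simpa using i.2
    have h1 : Ideal.ofList ((List.ofFn f).take i) • (⊤ : Submodule R R) = prefixIdeal f i := by
      rw [Ideal.smul_eq_mul, Ideal.mul_top, prefixIdeal, Ideal.ofList]
      congr 1
      ext y
      simp only [Set.mem_ofPred_eq, List.mem_take_iff_getElem, Set.mem_image]
      constructor
      · rintro ⟨j, hj, rfl⟩
        simp only [List.length_ofFn, lt_min_iff] at hj
        exact ⟨⟨j, hj.2⟩, hj.1, by simp⟩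
      · rintro ⟨j, hj, rfl⟩
        exact ⟨j, by simp [hj], by simp⟩
    rw [h1, isSMulRegular_quotient_iff_mem_of_smul_mem]
    intro a ha
    have := hreg ⟨i, hi⟩ a
    simp only [smul_eq_mul, Fin.getElem_fin, List.getElem_ofFn] at ha
    exact this ha
  · intro y hy
    obtain ⟨i, rfl⟩ := List.mem_ofFn.1 hy
    exact hf i

theorem ofList_ofFn {R : Type*} [CommRing R] {n : ℕ} {f : Fin n → R} :
    Ideal.ofList (List.ofFn f) = Ideal.span (Set.range f) := by
  rw [Ideal.ofList]
  congr 1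
  ext y
  simp [List.mem_ofFn]

variable {F : Fin (n + 1) → R}

/-- If the ideal of `F₀, …, Fₙ` is generated by a regular sequence, then the `Fᵢ` are linearly
dependent modulo the product of the ideal and the maximal ideal. -/
theorem exists_relation_of_isRegular [IsNoetherianRing R]
    (hres : ∀ b : R, ∃ c : k, b - algebraMap k R c ∈ maximalIdeal R)
    (hxm : Ideal.span (Set.range x) = maximalIdeal R) {rs : List R}
    (hreg : RingTheory.Sequence.IsRegular R rs)
    (hrs : Ideal.ofList rs = Ideal.span (Set.range F)) :
    ∃ c : Fin (n + 1) → k, c ≠ 0 ∧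
      ∑ i, c i • F i ∈ maximalIdeal R * Ideal.span (Set.range F) := by
  -- a regular sequence is not longer than the number of generators of the maximal ideal
  have hdim : ringKrullDim R ≤ n := by
    refine (ringKrullDim_le_spanFinrank_maximalIdeal R).trans ?_
    have h1 := Submodule.spanFinrank_span_le_ncard_of_finite (R := R) (Set.finite_range x)
    change (Ideal.span (Set.range x)).spanFinrank ≤ _ at h1
    rw [hxm, ← Set.image_univ] at h1
    have h2 := h1.trans (Set.ncard_image_le Set.finite_univ)
    rw [Set.ncard_univ, Nat.card_eq_fintype_card, Fintype.card_fin] at h2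
    exact_mod_cast h2
  have hlen : rs.length ≤ n := by
    have h1 := ringKrullDim_add_length_eq_ringKrullDim_of_isRegular rs hreg
    have : Nontrivial (R ⧸ Ideal.ofList rs) := by
      refine Ideal.Quotient.nontrivial_iff.2 fun h => hreg.top_ne_smul ?_
      rw [h, Ideal.smul_eq_mul, Ideal.mul_top]
    have h2 : (0 : WithBot ℕ∞) ≤ ringKrullDim (R ⧸ Ideal.ofList rs) :=
      ringKrullDim_nonneg_of_nontrivial
    have h3 : ((rs.length : ℕ) : WithBot ℕ∞) ≤ (n : ℕ) := by
      calc ((rs.length : ℕ) : WithBot ℕ∞) = 0 + rs.length := (zero_add _).symm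
        _ ≤ ringKrullDim (R ⧸ Ideal.ofList rs) + rs.length := by gcongr
        _ ≤ n := h1.trans_le hdim
    exact_mod_cast h3
  have hF : ∀ i, ∃ r : Fin rs.length → R, ∑ j, r j * rs.get j = F i := by
    intro i
    have h1 : F i ∈ Ideal.ofList rs := hrs ▸ Ideal.subset_span ⟨i, rfl⟩
    have h2 : Ideal.ofList rs = Ideal.span (Set.range rs.get) := by
      rw [Ideal.ofList, Set.range_list_get]
    rw [h2] at h1
    simpa using (Ideal.mem_span_range_iff_exists_fun).1 h1
  choose r hr using hF
  choose ρ hρ using hres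
  -- `n + 1` vectors of coefficients, reduced modulo the maximal ideal, in a space of dimension at
  -- most `n`
  obtain ⟨c, hc, i, hi⟩ : ∃ c : Fin (n + 1) → k,
      ∑ i, c i • (fun j => ρ (r i j)) = 0 ∧ ∃ i, c i ≠ 0 := by
    have : ¬ LinearIndependent k (fun i : Fin (n + 1) => (fun j => ρ (r i j))) := by
      intro h
      have := h.fintype_card_le_finrank
      simp only [Fintype.card_fin, Module.finrank_fin_fun] at this
      omega
    simpa [Fintype.not_linearIndependent_iff] using this
  refine ⟨c, fun h => hi (by rw [h]; rfl), ?_⟩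
  have h1 : ∑ i, c i • F i = ∑ j, (∑ i, c i • (r i j - algebraMap k R (ρ (r i j)))) * rs.get j := by
    have h2 : ∀ j, ∑ i, c i • algebraMap k R (ρ (r i j)) = 0 := by
      intro j
      have := congrFun hc j
      simp only [Finset.sum_apply, Pi.smul_apply, smul_eq_mul, Pi.zero_apply] at this
      rw [← map_zero (algebraMap k R), ← this, map_sum]
      exact Finset.sum_congr rfl fun i _ => by rw [map_mul, Algebra.smul_def]
    simp only [smul_sub, Finset.sum_sub_distrib, h2, sub_zero, Finset.sum_mul]
    rw [Finset.sum_comm]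
    refine Finset.sum_congr rfl fun i _ => ?_
    rw [← hr, Finset.smul_sum]
    exact Finset.sum_congr rfl fun j _ => (smul_mul_assoc _ _ _).symm
  rw [h1, ← hrs]
  refine Ideal.sum_mem _ fun j _ => Ideal.mul_mem_mul (Ideal.sum_mem _ fun i _ => ?_)
    (Ideal.subset_span (List.get_mem rs j))
  rw [Algebra.smul_def]
  exact Ideal.mul_mem_left _ _ (hρ _)

variable (c : Fin n → k)

theorem span_pencil_sup {k R : Type*} [Field k] [CommRing R] [Algebra k R] {n : ℕ} (c : Fin n → k)
    (F : Fin (n + 1) → R) :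
    Ideal.span (Set.range fun i : Fin n => F i.succ - c i • F 0) ⊔ Ideal.span {F 0} =
      Ideal.span (Set.range F) := by
  apply le_antisymm
  · refine sup_le ?_ ?_
    · rw [Ideal.span_le]
      rintro _ ⟨i, rfl⟩
      refine Ideal.sub_mem _ (Ideal.subset_span ⟨_, rfl⟩) ?_
      rw [Algebra.smul_def]
      exact Ideal.mul_mem_left _ _ (Ideal.subset_span ⟨_, rfl⟩)
    · rw [Ideal.span_singleton_le_iff_mem]
      exact Ideal.subset_span ⟨_, rfl⟩
  · rw [Ideal.span_le]
    rintro _ ⟨i, rfl⟩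
    have h0 : F 0 ∈ Ideal.span (Set.range fun i : Fin n => F i.succ - c i • F 0) ⊔
        Ideal.span {F 0} := Ideal.mem_sup_right (Ideal.mem_span_singleton_self _)
    rcases Fin.eq_zero_or_eq_succ i with rfl | ⟨j, rfl⟩
    · exact h0
    · have : F j.succ = (F j.succ - c j • F 0) + c j • F 0 := by abel
      rw [SetLike.mem_coe, this]
      refine Ideal.add_mem _ (Ideal.mem_sup_left (Ideal.subset_span ⟨j, rfl⟩)) ?_
      rw [Algebra.smul_def]
      exact Ideal.mul_mem_left _ _ h0

/-- A linear relation between the `Fᵢ` modulo the product of their ideal and the maximal ideal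
shows, for general `c`, that the differences `Fᵢ - cᵢ F₀` generate the ideal (Nakayama). -/
theorem mem_span_pencil_of_relation [IsNoetherianRing R] {e : Fin (n + 1) → k}
    (hrel : ∑ i, e i • F i ∈ maximalIdeal R * Ideal.span (Set.range F))
    (hc : e 0 + ∑ i : Fin n, e i.succ * c i ≠ 0) :
    F 0 ∈ Ideal.span (Set.range fun i : Fin n => F i.succ - c i • F 0) := by
  set J := Ideal.span (Set.range fun i : Fin n => F i.succ - c i • F 0) with hJ
  have hI := span_pencil_sup c F
  rw [← hJ] at hI
  have hsum : ∑ i, e i • F i - ∑ i : Fin n, e i.succ • (F i.succ - c i • F 0) =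
      (e 0 + ∑ i : Fin n, e i.succ * c i) • F 0 := by
    rw [Fin.sum_univ_succ, add_smul, Finset.sum_smul]
    simp only [smul_sub, Finset.sum_sub_distrib, smul_smul]
    abel
  have hF0 : F 0 ∈ J ⊔ maximalIdeal R * Ideal.span (Set.range F) := by
    have h1 : (e 0 + ∑ i : Fin n, e i.succ * c i) • F 0 ∈
        J ⊔ maximalIdeal R * Ideal.span (Set.range F) := by
      rw [← hsum]
      refine Ideal.sub_mem _ (Ideal.mem_sup_right hrel) (Ideal.mem_sup_left ?_)
      refine Ideal.sum_mem _ fun i _ => ?_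
      rw [Algebra.smul_def]
      exact Ideal.mul_mem_left _ _ (Ideal.subset_span ⟨i, rfl⟩)
    have h2 := Ideal.mul_mem_left _
      (algebraMap k R (e 0 + ∑ i : Fin n, e i.succ * c i)⁻¹) h1
    rwa [← Algebra.smul_def, smul_smul, inv_mul_cancel₀ hc, one_smul] at h2
  have hle : Ideal.span (Set.range F) ≤ J := by
    refine Submodule.le_of_le_smul_of_le_jacobson_bot (I := maximalIdeal R)
      (IsNoetherian.noetherian _) (by rw [IsLocalRing.jacobson_eq_maximalIdeal _ bot_ne_top]) ?_
    nth_rewrite 1 [← hI]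
    refine sup_le le_sup_left ?_
    rw [Ideal.span_singleton_le_iff_mem]
    exact hF0
  exact hle (Ideal.subset_span ⟨0, rfl⟩)

/-- If the quotient by `F₀, …, Fₙ` has a simple socle, and the quotient by the `n` elements
`Fᵢ - cᵢ F₀` is finite-dimensional, then the `Fᵢ` are linearly dependent modulo the product of
their ideal and the maximal ideal. -/
theorem exists_relation_of_simpleSocle
    (hres : ∀ b : R, ∃ c : k, b - algebraMap k R c ∈ maximalIdeal R)
    (hx : RegularFamily x) (hxm : Ideal.span (Set.range x) = maximalIdeal R)
    (h : ∀ j, ∃ N, x j ^ N ∈ Ideal.span (Set.range fun i : Fin n => F i.succ - c i • F 0))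
    (hF : ∀ i, F i ∈ maximalIdeal R)
    [Module.Finite k (R ⧸ Ideal.span (Set.range fun i : Fin n => F i.succ - c i • F 0))]
    [IsLocalRing (R ⧸ Ideal.span (Set.range F))]
    (hsoc : SimpleSocle (R ⧸ Ideal.span (Set.range F))) :
    ∃ e : Fin (n + 1) → k, e ≠ 0 ∧
      ∑ i, e i • F i ∈ maximalIdeal R * Ideal.span (Set.range F) := by
  have hI := span_pencil_sup c F
  have hg : ∀ i : Fin n, F i.succ - c i • F 0 ∈ maximalIdeal R := by
    intro i
    rw [Algebra.smul_def]
    exact Ideal.sub_mem _ (hF _) (Ideal.mul_mem_left _ _ (hF _))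
  obtain ⟨a, b, hab, hunit⟩ : ∃ (a : Fin n → R) (b : R),
      ∑ i, a i * (F i.succ - c i • F 0) + b * F 0 = 0 ∧
      (b ∉ maximalIdeal R ∨ ∃ i, a i ∉ maximalIdeal R) := by
    revert hsoc
    revert ‹IsLocalRing (R ⧸ Ideal.span (Set.range F))›
    rw [← hI]
    intro _ hsoc
    exact exists_syzygy_of_simpleSocle hres hx hxm h hg (hF 0) hsoc
  choose ρ hρ using hres
  refine ⟨Fin.cons (ρ b - ∑ i, ρ (a i) * c i) (fun i => ρ (a i)), ?_, ?_⟩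
  · intro h0
    have h1 : ∀ i, ρ (a i) = 0 := fun i => by
      have := congrFun h0 i.succ
      simpa using this
    have h2 : ρ b = 0 := by
      have := congrFun h0 0
      simpa [h1] using this
    rcases hunit with hb | ⟨i, hi⟩
    · exact hb (by simpa [h2] using hρ b)
    · exact hi (by simpa [h1] using hρ (a i))
  · have hmem : ∀ i, F i ∈ Ideal.span (Set.range F) := fun i => Ideal.subset_span ⟨i, rfl⟩
    have hgm : ∀ i : Fin n, F i.succ - c i • F 0 ∈ Ideal.span (Set.range F) := by
      intro i
      rw [Algebra.smul_def]
      exact Ideal.sub_mem _ (hmem _) (Ideal.mul_mem_left _ _ (hmem _))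
    have h1 : ∑ i,
        (Fin.cons (ρ b - ∑ i, ρ (a i) * c i) (fun i => ρ (a i)) : Fin (n + 1) → k) i • F i
        = ∑ i, (algebraMap k R (ρ (a i)) - a i) * (F i.succ - c i • F 0) +
          (algebraMap k R (ρ b) - b) * F 0 := by
      have h2 : ∑ i, (algebraMap k R (ρ (a i)) - a i) * (F i.succ - c i • F 0) +
          (algebraMap k R (ρ b) - b) * F 0 =
          ∑ i, algebraMap k R (ρ (a i)) * (F i.succ - c i • F 0) + algebraMap k R (ρ b) * F 0 := by
        simp only [sub_mul, Finset.sum_sub_distrib]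
        linear_combination -hab
      rw [h2, Fin.sum_univ_succ]
      simp only [Fin.cons_zero, Fin.cons_succ, Algebra.smul_def, map_sub, map_sum, map_mul, mul_sub,
        sub_mul, Finset.sum_sub_distrib, Finset.sum_mul, mul_assoc]
      ring
    rw [h1]
    have hρ' : ∀ r, algebraMap k R (ρ r) - r ∈ maximalIdeal R := fun r => by
      rw [← neg_sub]
      exact Ideal.neg_mem_iff _ |>.2 (hρ r)
    exact Ideal.add_mem _ (Ideal.sum_mem _ fun i _ => Ideal.mul_mem_mul (hρ' _) (hgm i))
      (Ideal.mul_mem_mul (hρ' _) (hmem 0))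

end AlmostCompleteIntersection

end ProjRat

/-! ### Hilbert series of homogeneous ideals -/

namespace ProjRat

open MvPolynomial

section RegularFamilies

variable {R : Type*} [CommRing R]

theorem prefixIdeal_map {A : Type*} [CommRing A] (g : R →+* A) {n : ℕ} (x : Fin n → R) (j : ℕ) :
    prefixIdeal (fun i => g (x i)) j = (prefixIdeal x j).map g := by
  rw [prefixIdeal, prefixIdeal, Ideal.map_span, Set.image_image]

theorem RegularFamily.of_isLocalization (M : Submonoid R) {A : Type*} [CommRing A] [Algebra R A]
    [IsLocalization M A] {n : ℕ} {x : Fin n → R} (hx : RegularFamily x) :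
    RegularFamily fun i => algebraMap R A (x i) := by
  intro j a ha
  obtain ⟨r, s, rfl⟩ := IsLocalization.exists_mk'_eq M a
  rw [prefixIdeal_map] at ha ⊢
  have h1 : algebraMap R A (x j) * IsLocalization.mk' A r s = IsLocalization.mk' A (x j * r) s := by
    rw [IsLocalization.mul_mk'_eq_mk'_of_mul]
  simp only [h1] at ha
  rw [IsLocalization.mk'_mem_map_algebraMap_iff] at ha ⊢
  obtain ⟨t, ht, h⟩ := ha
  exact ⟨t, ht, hx j _ (by rwa [mul_left_comm])⟩

/-- The linear polynomials vanishing at a point form a regular sequence. -/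
theorem regularFamily_X_sub_C {k : Type*} [Field k] {n : ℕ} (q : Fin n → k) :
    RegularFamily fun i => (X i - C (q i) : MvPolynomial (Fin n) k) := by
  intro j
  -- the prefix ideal is the kernel of the evaluation at `q` of the first `j` variables
  let ev : MvPolynomial (Fin n) k →ₐ[k] MvPolynomial (Fin n) k :=
    aeval fun i => if (i : ℕ) < j then C (q i) else X i
  have hker : ∀ p, p ∈ prefixIdeal (fun i => (X i - C (q i) : MvPolynomial (Fin n) k)) j ↔
      ev p = 0 := by
    intro p
    constructor
    · intro hp
      have : prefixIdeal (fun i => (X i - C (q i) : MvPolynomial (Fin n) k)) j ≤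
          RingHom.ker ev := by
        rw [prefixIdeal, Ideal.span_le]
        rintro _ ⟨i, hi, rfl⟩
        simp only [SetLike.mem_coe, RingHom.mem_ker, map_sub, ev, aeval_X, aeval_C]
        rw [if_pos (by exact hi)]
        exact sub_self _
      exact this hp
    · intro hp
      let P := prefixIdeal (fun i => (X i - C (q i) : MvPolynomial (Fin n) k)) j
      have hcomp : (Ideal.Quotient.mkₐ k P).comp ev = Ideal.Quotient.mkₐ k P := by
        ext i
        simp only [AlgHom.comp_apply, ev, aeval_X]
        split_ifs with h
        · refine ((Ideal.Quotient.mk_eq_mk_iff_sub_mem _ _).2 ?_).symm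
          exact Ideal.subset_span ⟨i, h, rfl⟩
        · rfl
      have := DFunLike.congr_fun hcomp p
      rw [AlgHom.comp_apply, hp, map_zero] at this
      exact Ideal.Quotient.eq_zero_iff_mem.1 this.symm
  intro a ha
  rw [hker, map_mul] at ha
  rw [hker]
  refine (mul_eq_zero.1 ha).resolve_left ?_
  simp only [ev, map_sub, aeval_X, aeval_C, lt_irrefl, if_false, algebraMap_eq]
  intro h
  have := congrArg (coeff (Finsupp.single j 1)) h
  have h0 : (0 : Fin n →₀ ℕ) ≠ Finsupp.single j 1 := by simp [eq_comm]
  simp [coeff_X, coeff_C, h0] at this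

end RegularFamilies

section Hilbert

variable {k : Type*} [Field k] {n : ℕ}

local notation "S" => MvPolynomial (Fin (n + 1)) k

theorem isHomogeneous_span {ι : Type*} {G : ι → S} {e : ι → ℕ} (hG : ∀ i, (G i).IsHomogeneous (e i))
    (s : Set ι) : (Ideal.span (G '' s)).IsHomogeneous (grading k n) := by
  refine Ideal.homogeneous_span _ _ ?_
  rintro _ ⟨i, -, rfl⟩
  exact ⟨e i, hG i⟩

theorem coe_decompose (p : S) (m : ℕ) :
    (DirectSum.decompose (grading k n) p m : S) = homogeneousComponent m p :=
  decomposition.decompose'_apply p m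

theorem homogeneousComponent_mul_left {G : S} {e : ℕ} (hG : G.IsHomogeneous e) (s : S) (m : ℕ) :
    homogeneousComponent m (G * s) =
      if e ≤ m then G * homogeneousComponent (m - e) s else 0 := by
  have := DirectSum.coe_decompose_mul_of_left_mem (𝒜 := grading k n) (b := s) m
    (show G ∈ grading k n e from hG)
  rwa [coe_decompose, coe_decompose] at this

/-- The forms of degree `m` in an ideal. -/
def formsIn (J : Ideal S) (m : ℕ) : Submodule k S :=
  J.restrictScalars k ⊓ homogeneousSubmodule (Fin (n + 1)) k m

instance (m : ℕ) : Module.Finite k (homogeneousSubmodule (Fin (n + 1)) k m) :=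
  Module.Finite.iff_fg.2 (homogeneousSubmodule_fg _ _ m)

instance (J : Ideal S) (m : ℕ) : Module.Finite k (formsIn J m) :=
  Submodule.finiteDimensional_inf_right _ _

/-- The generating series of the codimensions of the ideal `J` in the single degrees. -/
def hilbertSeries (J : Ideal S) : PowerSeries ℤ :=
  PowerSeries.mk fun m => (Module.finrank k (homogeneousSubmodule (Fin (n + 1)) k m) : ℤ) -
    Module.finrank k (formsIn J m)

/-- Adding a form of degree `e` that is a nonzerodivisor modulo `J` multiplies the Hilbert series
by `1 - X ^ e`. -/
theorem hilbertSeries_sup {J : Ideal S} (hJ : J.IsHomogeneous (grading k n)) {G : S} {e : ℕ}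
    (hG : G.IsHomogeneous e) (hG0 : G ≠ 0)
    (hreg : ∀ (m : ℕ) (H : S), H.IsHomogeneous m → G * H ∈ J → H ∈ J) :
    hilbertSeries (J ⊔ Ideal.span {G}) = (1 - PowerSeries.X ^ e) * hilbertSeries J := by
  ext m
  rw [sub_mul, one_mul, map_sub, PowerSeries.coeff_X_pow_mul']
  simp only [hilbertSeries, PowerSeries.coeff_mk]
  -- forms in the sum
  have hsup : ∀ H : S, H ∈ formsIn (J ⊔ Ideal.span {G}) m →
      ∃ j ∈ formsIn J m, ∃ s, H = j + homogeneousComponent m (G * s) := by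
    rintro H ⟨h1, h2⟩
    obtain ⟨j, hj, g, hg, h3⟩ := Submodule.mem_sup.1 h1
    obtain ⟨s, rfl⟩ := Ideal.mem_span_singleton'.1 hg
    refine ⟨homogeneousComponent m j, ⟨?_, homogeneousComponent_mem m j⟩, s, ?_⟩
    · exact homogeneousComponent_mem_of_mem hJ hj m
    · rw [← map_add, mul_comm G, h3, homogeneousComponent_eq_self h2]
  split_ifs with hem
  · have key : formsIn (J ⊔ Ideal.span {G}) m = formsIn J m ⊔
        (homogeneousSubmodule (Fin (n + 1)) k (m - e)).map (LinearMap.mulLeft k G) := by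
      apply le_antisymm
      · intro H hH
        obtain ⟨j, hj, s, rfl⟩ := hsup H hH
        refine Submodule.add_mem_sup hj ?_
        rw [homogeneousComponent_mul_left hG, if_pos hem]
        exact ⟨_, homogeneousComponent_mem _ _, rfl⟩
      · refine sup_le ?_ ?_
        · rintro H ⟨h1, h2⟩
          exact ⟨Ideal.mem_sup_left h1, h2⟩
        · rintro _ ⟨H, hH, rfl⟩
          refine ⟨Ideal.mem_sup_right ?_, ?_⟩
          · exact Ideal.mul_mem_right _ _ (Ideal.mem_span_singleton_self G)
          · have := hG.mul hH
            rwa [Nat.add_sub_cancel' hem] at this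
    have kinf : formsIn J m ⊓
        (homogeneousSubmodule (Fin (n + 1)) k (m - e)).map (LinearMap.mulLeft k G) =
        (formsIn J (m - e)).map (LinearMap.mulLeft k G) := by
      ext H
      constructor
      · rintro ⟨h1, H, h2, rfl⟩
        exact ⟨H, ⟨hreg _ H h2 h1.1, h2⟩, rfl⟩
      · rintro ⟨H, ⟨h1, h2⟩, rfl⟩
        refine ⟨⟨Ideal.mul_mem_left _ _ h1, ?_⟩, H, h2, rfl⟩
        have := hG.mul h2
        rwa [Nat.add_sub_cancel' hem] at this
    have hinj : Function.Injective (LinearMap.mulLeft k G) := fun a b h =>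
      mul_left_cancel₀ hG0 h
    have hdim := Submodule.finrank_sup_add_finrank_inf_eq (formsIn J m)
      ((homogeneousSubmodule (Fin (n + 1)) k (m - e)).map (LinearMap.mulLeft k G))
    rw [kinf, ← key, ← (Submodule.equivMapOfInjective _ hinj _).finrank_eq,
      ← (Submodule.equivMapOfInjective _ hinj _).finrank_eq] at hdim
    omega
  · have key : formsIn (J ⊔ Ideal.span {G}) m = formsIn J m := by
      apply le_antisymm
      · intro H hH
        obtain ⟨j, hj, s, rfl⟩ := hsup H hH
        rw [homogeneousComponent_mul_left hG, if_neg hem, add_zero]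
        exact hj
      · rintro H ⟨h1, h2⟩
        exact ⟨Ideal.mem_sup_left h1, h2⟩
    rw [key, sub_zero]

end Hilbert

end ProjRat

/-! ### Hilbert series of complete intersections -/

namespace ProjRat

open MvPolynomial

section Hilbert

variable {k : Type*} [Field k] {n : ℕ}

local notation "S" => MvPolynomial (Fin (n + 1)) k

/-- A regular sequence of `j` forms of degree `d` multiplies the Hilbert series by
`(1 - X ^ d) ^ j`. -/
theorem hilbertSeries_prefixIdeal {N d : ℕ} {g : Fin N → S}
    (hreg : ∀ (j : Fin N) (m : ℕ) (H : S), H.IsHomogeneous m → g j * H ∈ prefixIdeal g j →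
      H ∈ prefixIdeal g j)
    (h0 : ∀ j, g j ≠ 0) (j : ℕ) (hj : j ≤ N)
    (hg : ∀ i : Fin N, (i : ℕ) < j → (g i).IsHomogeneous d) :
    hilbertSeries (prefixIdeal g j) =
      (1 - PowerSeries.X ^ d) ^ j * hilbertSeries (⊥ : Ideal S) := by
  induction j with
  | zero => rw [prefixIdeal_zero, pow_zero, one_mul]
  | succ j ih =>
    have hj' : j < N := hj
    have hhom : (prefixIdeal g j).IsHomogeneous (grading k n) := by
      refine Ideal.homogeneous_span _ _ ?_
      rintro _ ⟨i, hi, rfl⟩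
      exact ⟨d, hg i (Nat.lt_succ_of_lt hi)⟩
    have := prefixIdeal_succ g ⟨j, hj'⟩
    simp only at this
    rw [this, hilbertSeries_sup hhom (hg ⟨j, hj'⟩ (Nat.lt_succ_self j)) (h0 _)
      (hreg ⟨j, hj'⟩), ih hj'.le (fun i hi => hg i (Nat.lt_succ_of_lt hi)), pow_succ']
    ring

theorem mem_span_X_iff (p : S) :
    p ∈ Ideal.span (Set.range (X : Fin (n + 1) → S)) ↔ constantCoeff p = 0 := by
  constructor
  · intro hp
    have : Ideal.span (Set.range (X : Fin (n + 1) → S)) ≤ RingHom.ker (constantCoeff (R := k)) := by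
      rw [Ideal.span_le]
      rintro _ ⟨i, rfl⟩
      simp [RingHom.mem_ker]
    exact this hp
  · intro hp
    rw [← Set.image_univ, mem_ideal_span_X_image]
    intro m hm
    by_contra! h
    have : m = 0 := by ext i; simpa using h i (Set.mem_univ i)
    subst this
    exact (mem_support_iff.1 hm) hp

theorem hilbertSeries_span_X :
    hilbertSeries (Ideal.span (Set.range (X : Fin (n + 1) → S))) = 1 := by
  ext m
  rw [hilbertSeries, PowerSeries.coeff_mk, PowerSeries.coeff_one]
  split_ifs with hm
  · subst hm
    have h1 : formsIn (Ideal.span (Set.range (X : Fin (n + 1) → S))) 0 = ⊥ := by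
      rw [eq_bot_iff]
      rintro p ⟨h1, h2⟩
      have h3 := (mem_span_X_iff p).1 h1
      have h4 := homogeneousComponent_eq_self h2
      rw [homogeneousComponent_zero] at h4
      rw [Submodule.mem_bot, ← h4]
      simpa [constantCoeff_eq] using h3
    rw [h1, finrank_bot, homogeneousSubmodule_zero, Submodule.one_eq_span,
      finrank_span_singleton one_ne_zero]
    simp
  · have h1 : formsIn (Ideal.span (Set.range (X : Fin (n + 1) → S))) m =
        homogeneousSubmodule _ k m := by
      refine inf_eq_right.2 fun p hp => ?_
      refine (mem_span_X_iff p).2 ?_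
      exact (IsHomogeneous.coeff_eq_zero hp (by simpa using Ne.symm hm))
    rw [h1, sub_self]

/-- The Hilbert series of the polynomial ring in `n + 1` variables is `1 / (1 - X) ^ (n + 1)`: the
variables form a regular sequence with quotient `k`. -/
theorem hilbertSeries_bot : (1 - PowerSeries.X) ^ (n + 1) * hilbertSeries (⊥ : Ideal S) = 1 := by
  have h1 := hilbertSeries_prefixIdeal (k := k) (n := n) (d := 1) (g := X) (fun j m H _ h => ?_)
    (fun j => X_ne_zero j) _ le_rfl fun i _ => isHomogeneous_X k i
  · rwa [prefixIdeal_of_le _ le_rfl, hilbertSeries_span_X, pow_one, eq_comm] at h1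
  · have := regularFamily_X_sub_C (k := k) (n := n + 1) (fun _ => 0) j H
    simp only [map_zero, sub_zero] at this
    exact this h

/-- An ideal with the Hilbert series of a complete intersection of `n` forms of degree `d` has
codimension `d ^ n` in all large degrees. The series is `(1 + X + ⋯ + X ^ (d - 1)) ^ n / (1 - X)`,
and the numerator takes the value `d ^ n` at `1`. -/
theorem exists_finrank_formsIn {d : ℕ} {J : Ideal S}
    (hJ : hilbertSeries J = (1 - PowerSeries.X ^ d) ^ n * hilbertSeries (⊥ : Ideal S)) :
    ∃ m₀, ∀ m, m₀ ≤ m → Module.finrank k (homogeneousSubmodule (Fin (n + 1)) k m) =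
      d ^ n + Module.finrank k (formsIn J m) := by
  let p : Polynomial ℤ := (∑ i ∈ Finset.range d, Polynomial.X ^ i) ^ n
  have h1 : hilbertSeries J = (p : PowerSeries ℤ) * PowerSeries.mk 1 := by
    have hp : (p : PowerSeries ℤ) * (1 - PowerSeries.X) ^ n = (1 - PowerSeries.X ^ d) ^ n := by
      rw [Polynomial.coe_pow, ← mul_pow, ← geom_sum_mul_neg (PowerSeries.X : PowerSeries ℤ) d]
      congr 2
      rw [← Polynomial.coeToPowerSeries.ringHom_apply, map_sum]
      simp
    rw [hJ, ← hp]
    calc _ = (p : PowerSeries ℤ) * ((1 - PowerSeries.X) ^ n * hilbertSeries (⊥ : Ideal S)) *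
          (PowerSeries.mk 1 * (1 - PowerSeries.X)) := by
          rw [PowerSeries.mk_one_mul_one_sub_eq_one ℤ]; ring
      _ = (p : PowerSeries ℤ) * PowerSeries.mk 1 *
          ((1 - PowerSeries.X) ^ (n + 1) * hilbertSeries (⊥ : Ideal S)) := by
          ring
      _ = _ := by rw [hilbertSeries_bot, mul_one]
  refine ⟨p.natDegree, fun m hm => ?_⟩
  have h2 := congrArg (PowerSeries.coeff m) h1
  rw [hilbertSeries, PowerSeries.coeff_mk, PowerSeries.coeff_mul,
    Finset.Nat.sum_antidiagonal_eq_sum_range_succ_mk] at h2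
  simp only [Polynomial.coeff_coe, PowerSeries.coeff_mk, Pi.one_apply, mul_one] at h2
  have h3 := Polynomial.eval_eq_sum_range' (p := p) (n := m + 1) (by omega) 1
  simp only [one_pow, mul_one] at h3
  have h4 : p.eval 1 = (d : ℤ) ^ n := by simp [p, Polynomial.eval_finsetSum]
  rw [Nat.succ_eq_add_one, ← h3, h4] at h2
  have : ((d ^ n : ℕ) : ℤ) = (d : ℤ) ^ n := by push_cast; rfl
  omega

/-- Homogeneous form of the Cohen–Macaulay property of a polynomial ring: `n + 1` forms of positive
degree without common zero, in the sense that they generate an ideal containing powers of all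
variables, form a regular sequence. -/
theorem forms_regular {g : Fin (n + 1) → S} {e : Fin (n + 1) → ℕ}
    (hg : ∀ i, (g i).IsHomogeneous (e i)) (he : ∀ i, e i ≠ 0)
    (hX : ∀ i, ∃ N, (X i : S) ^ N ∈ Ideal.span (Set.range g)) (j : Fin (n + 1)) (m : ℕ) (H : S)
    (hH : H.IsHomogeneous m) (h : g j * H ∈ prefixIdeal g j) : H ∈ prefixIdeal g j := by
  let P : Ideal S := RingHom.ker (constantCoeff (R := k) (σ := Fin (n + 1)))
  have hP : P.IsPrime := RingHom.ker_isPrime _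
  let R := Localization.AtPrime P
  have hx : RegularFamily fun i : Fin (n + 1) => algebraMap S R (X i) := by
    have := regularFamily_X_sub_C (k := k) (n := n + 1) (fun _ => 0)
    simp only [map_zero, sub_zero] at this
    exact this.of_isLocalization P.primeCompl
  have hreg : RegularFamily fun i => algebraMap S R (g i) := by
    refine regularFamily_of_pow_mem hx (fun i => ?_) fun i => ?_
    · have := (IsLocalization.AtPrime.to_map_mem_maximal_iff R P (g i)).2 ?_
      · exact this
      · exact (hg i).coeff_eq_zero (by simpa using (he i).symm)
    · obtain ⟨N, hN⟩ := hX i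
      refine ⟨N, ?_⟩
      rw [Set.range_comp' (algebraMap S R) g, ← Ideal.map_span, ← map_pow]
      exact Ideal.mem_map_of_mem _ hN
  have h1 := hreg j (algebraMap S R H) (by
    rw [prefixIdeal_map, ← map_mul]
    exact Ideal.mem_map_of_mem _ h)
  rw [prefixIdeal_map, IsLocalization.algebraMap_mem_map_algebraMap_iff P.primeCompl] at h1
  obtain ⟨s, hs, hsH⟩ := h1
  have hhom : (prefixIdeal g j).IsHomogeneous (grading k n) := isHomogeneous_span hg _
  -- the component of degree `m` of `s * H` is `s 0 • H`
  have h2 := homogeneousComponent_mem_of_mem hhom hsH m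
  rw [mul_comm, homogeneousComponent_mul_left hH, if_pos le_rfl, Nat.sub_self,
    homogeneousComponent_zero] at h2
  have hs0 : coeff 0 s ≠ 0 := hs
  have h3 := Ideal.mul_mem_right (C (coeff 0 s)⁻¹) _ h2
  rwa [mul_assoc, ← C_mul, mul_inv_cancel₀ hs0, C_1, mul_one] at h3

end Hilbert

end ProjRat

/-! ### Dehomogenization and Bézout's theorem -/

namespace ProjRat

open MvPolynomial

section Dehomogenization

variable {k : Type*} [Field k] {n : ℕ}

local notation "S" => MvPolynomial (Fin (n + 1)) k
local notation "W" => MvPolynomial (Fin n) k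

/-- The linear form `X₀ + a₁ X₁ + ⋯ + aₙ Xₙ`. -/
def linForm (a : Fin n → k) : S := X 0 + ∑ i, C (a i) * X i.succ

/-- Restriction to the affine chart on which the linear form of `a` takes the value `1`, with the
coordinates `X₁, …, Xₙ`. -/
def dehom (a : Fin n → k) : S →ₐ[k] W := aeval (Fin.cons (1 - ∑ i, C (a i) * X i) X)

variable (a : Fin n → k)

theorem dehom_X_zero : dehom a (X 0) = 1 - ∑ i, C (a i) * X i := by simp [dehom]

theorem dehom_X_succ (i : Fin n) : dehom a (X i.succ) = X i := by simp [dehom]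

theorem linForm_isHomogeneous : (linForm a).IsHomogeneous 1 :=
  (isHomogeneous_X k 0).add (IsHomogeneous.sum _ _ _ fun _ _ => isHomogeneous_C_mul_X _ _)

theorem linForm_ne_zero : linForm a ≠ 0 := by
  intro h
  have h1 := congrArg (eval (Fin.cons 1 0 : Fin (n + 1) → k)) h
  simp [linForm] at h1

theorem dehom_linForm : dehom a (linForm a) = 1 := by
  simp only [linForm, map_add, map_sum, map_mul, dehom_X_zero, dehom_X_succ]
  simp [dehom]

theorem dehom_surjective : Function.Surjective (dehom a) := by
  intro w
  refine ⟨rename Fin.succ w, ?_⟩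
  have : (dehom a).comp (rename Fin.succ) = AlgHom.id k W := by
    ext i
    simp [dehom_X_succ]
  exact DFunLike.congr_fun this w

theorem aeval_smul_of_isHomogeneous {σ L : Type*} [CommRing L] [Algebra k L] {F : MvPolynomial σ k}
    {m : ℕ} (hF : F.IsHomogeneous m) (u : L) (x : σ → L) :
    aeval (fun i => u * x i) F = u ^ m * aeval x F := by
  rw [aeval_def, aeval_def, eval₂_eq, eval₂_eq, Finset.mul_sum]
  refine Finset.sum_congr rfl fun s hs => ?_
  have h1 : ∑ i ∈ s.support, s i = m := by
    have := hF (mem_support_iff.1 hs)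
    rwa [show Finsupp.weight 1 s = s.degree from
      (DFunLike.congr_fun (Finsupp.degree_eq_weight_one (R := ℕ)) s).symm] at this
  simp_rw [mul_pow]
  rw [Finset.prod_mul_distrib, Finset.prod_pow_eq_pow_sum, h1]
  ring

/-- Compatibility of dehomogenization with any homomorphisms that identify the coordinates of the
chart with the homogeneous coordinates divided by the linear form. -/
theorem map_dehom {L : Type*} [CommRing L] [Algebra k L] {ψ : W →ₐ[k] L} {ρ : S →ₐ[k] L} {u : L}
    (hψ : ∀ i, ψ (X i) = u * ρ (X i.succ)) (hu : u * ρ (linForm a) = 1) {F : S} {m : ℕ}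
    (hF : F.IsHomogeneous m) : ψ (dehom a F) = u ^ m * ρ F := by
  have h1 : ψ.comp (dehom a) = aeval fun i => u * ρ (X i) := by
    ext i
    rw [AlgHom.comp_apply, aeval_X]
    refine Fin.cases ?_ (fun i => ?_) i
    · rw [dehom_X_zero, map_sub, map_one, map_sum, ← hu, linForm, map_add, map_sum, mul_add,
        Finset.mul_sum, add_sub_assoc, ← Finset.sum_sub_distrib, Finset.sum_eq_zero, add_zero]
      intro i _
      simp only [map_mul, hψ, ← algebraMap_eq, AlgHom.commutes]
      ring
    · rw [dehom_X_succ, hψ]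
  have h2 : ρ = aeval fun i => ρ (X i) := by ext i; simp
  rw [← AlgHom.comp_apply, h1, aeval_smul_of_isHomogeneous hF, ← h2]

theorem dehom_injective_of_isHomogeneous {F : S} {m : ℕ} (hF : F.IsHomogeneous m)
    (h : dehom a F = 0) : F = 0 := by
  let L := FractionRing S
  let ρ : S →ₐ[k] L := Algebra.algHom k S L
  have hinj : Function.Injective ρ := IsFractionRing.injective S L
  have hl : ρ (linForm a) ≠ 0 := fun h0 => linForm_ne_zero a (hinj (by rw [h0, map_zero]))
  let ψ : W →ₐ[k] L := aeval fun i => (ρ (linForm a))⁻¹ * ρ (X i.succ)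
  have h1 := map_dehom a (ψ := ψ) (ρ := ρ) (fun i => by simp [ψ]) (inv_mul_cancel₀ hl) hF
  rw [h, map_zero] at h1
  have h2 := (mul_eq_zero.1 h1.symm).resolve_left (pow_ne_zero _ (inv_ne_zero hl))
  exact hinj (by rw [h2, map_zero])

/-- Every polynomial in the affine coordinates is the restriction of a form of any sufficiently
large degree, which may be found in any homogeneous ideal that contains a given lift. -/
theorem exists_homogenization (s : S) {M : ℕ} (hM : s.totalDegree ≤ M) :
    ∃ h : S, h.IsHomogeneous M ∧ dehom a h = dehom a s ∧
      ∀ J : Ideal S, J.IsHomogeneous (grading k n) → s ∈ J → h ∈ J := by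
  refine ⟨∑ i ∈ Finset.range (M + 1), linForm a ^ (M - i) * homogeneousComponent i s, ?_, ?_, ?_⟩
  · refine IsHomogeneous.sum _ _ _ fun i hi => ?_
    have := ((linForm_isHomogeneous a).pow (M - i)).mul (homogeneousComponent_isHomogeneous i s)
    rwa [one_mul, Nat.sub_add_cancel (Nat.lt_succ_iff.1 (Finset.mem_range.1 hi))] at this
  · simp only [map_sum, map_mul, map_pow, dehom_linForm, one_pow, one_mul]
    rw [← map_sum]
    congr 1
    conv_rhs => rw [← sum_homogeneousComponent s]
    refine (Finset.sum_subset ?_ ?_).symm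
    · intro i hi
      simp only [Finset.mem_range] at hi ⊢
      omega
    · intro i _ hi
      exact homogeneousComponent_eq_zero _ _ (by simpa using hi)
  · intro J hJ hs
    exact Ideal.sum_mem _ fun i _ =>
      Ideal.mul_mem_left _ _ (homogeneousComponent_mem_of_mem hJ hs i)

/-- A form vanishes on the affine part of a scheme if and only if it vanishes on the scheme,
provided that no component of the scheme lies at infinity. -/
theorem mem_of_dehom_mem {J : Ideal S} (hJ : J.IsHomogeneous (grading k n))
    (hreg : ∀ (m : ℕ) (H : S), H.IsHomogeneous m → linForm a * H ∈ J → H ∈ J)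
    {F : S} {m : ℕ} (hF : F.IsHomogeneous m) (h : dehom a F ∈ J.map (dehom a)) : F ∈ J := by
  obtain ⟨s, hs, hsF⟩ := (Ideal.mem_map_iff_of_surjective _ (dehom_surjective a)).1 h
  obtain ⟨H, hH, hHs, hHJ⟩ := exists_homogenization a s (M := s.totalDegree + m) (by omega)
  have hp : ∀ i, linForm a ^ i * F ∈ J → F ∈ J := by
    intro i
    induction i with
    | zero => simp
    | succ i ih =>
      intro h
      refine ih (hreg _ _ (((linForm_isHomogeneous a).pow i).mul hF) ?_)
      rwa [← mul_assoc, ← pow_succ']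
  refine hp s.totalDegree ?_
  have h1 : linForm a ^ s.totalDegree * F = H := by
    rw [← sub_eq_zero]
    refine dehom_injective_of_isHomogeneous a (m := s.totalDegree + m) (IsHomogeneous.sub ?_ hH) ?_
    · simpa using ((linForm_isHomogeneous a).pow s.totalDegree).mul hF
    · rw [map_sub, map_mul, map_pow, dehom_linForm, one_pow, one_mul, hHs, hsF, sub_self]
  rw [h1]
  exact hHJ J hJ hs

/-- If no component of a scheme of eventually constant Hilbert function `D` lies at infinity, then
its affine coordinate ring has dimension `D`. -/
theorem finrank_quotient_dehom {J : Ideal S} (hJ : J.IsHomogeneous (grading k n))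
    (hreg : ∀ (m : ℕ) (H : S), H.IsHomogeneous m → linForm a * H ∈ J → H ∈ J) {m₀ D : ℕ}
    (hD : ∀ m, m₀ ≤ m → Module.finrank k (homogeneousSubmodule (Fin (n + 1)) k m) =
      D + Module.finrank k (formsIn J m)) :
    Module.Finite k (W ⧸ J.map (dehom a)) ∧ Module.finrank k (W ⧸ J.map (dehom a)) = D := by
  let π : S →ₗ[k] W ⧸ J.map (dehom a) :=
    ((Ideal.Quotient.mkₐ k (J.map (dehom a))).comp (dehom a)).toLinearMap
  have hπ : ∀ s, π s = Ideal.Quotient.mk _ (dehom a s) := fun s => rfl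
  let V : ℕ → Submodule k (W ⧸ J.map (dehom a)) := fun m =>
    (homogeneousSubmodule (Fin (n + 1)) k m).map π
  have hV : ∀ m, m₀ ≤ m → Module.finrank k (V m) = D := by
    intro m hm
    let φ : homogeneousSubmodule (Fin (n + 1)) k m →ₗ[k] W ⧸ J.map (dehom a) :=
      π ∘ₗ (homogeneousSubmodule (Fin (n + 1)) k m).subtype
    have hr : LinearMap.range φ = V m := by
      rw [LinearMap.range_comp, Submodule.range_subtype]
    have hk : (LinearMap.ker φ).map (homogeneousSubmodule (Fin (n + 1)) k m).subtype =
        formsIn J m := by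
      ext F
      constructor
      · rintro ⟨⟨F, hF⟩, h, rfl⟩
        exact ⟨mem_of_dehom_mem a hJ hreg hF (Ideal.Quotient.eq_zero_iff_mem.1 h), hF⟩
      · rintro ⟨h, hF⟩
        exact ⟨⟨F, hF⟩, Ideal.Quotient.eq_zero_iff_mem.2 (Ideal.mem_map_of_mem _ h), rfl⟩
    have h1 := LinearMap.finrank_range_add_finrank_ker φ
    rw [hr, (Submodule.equivMapOfInjective _ (Submodule.subtype_injective _) _).finrank_eq, hk,
      hD m hm] at h1
    omega
  have hmono : ∀ m m', m ≤ m' → V m ≤ V m' := by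
    rintro m m' h _ ⟨F, hF, rfl⟩
    refine ⟨linForm a ^ (m' - m) * F, ?_, ?_⟩
    · have := ((linForm_isHomogeneous a).pow (m' - m)).mul hF
      rwa [one_mul, Nat.sub_add_cancel h] at this
    · rw [hπ, hπ, map_mul, map_pow, dehom_linForm, one_pow, one_mul]
  have hfin : ∀ m, Module.Finite k (V m) := fun m => inferInstance
  -- the images of the forms of degree `m` increase with `m` and have dimension `D`, so they are
  -- eventually constant, and they exhaust the quotient
  have heq : ∀ m, m₀ ≤ m → V m = V m₀ := fun m hm =>
    (Submodule.eq_of_le_of_finrank_eq (hmono _ _ hm) (by rw [hV _ hm, hV _ le_rfl])).symm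
  have htop : V m₀ = ⊤ := by
    rw [eq_top_iff]
    intro w _
    obtain ⟨w, rfl⟩ := Ideal.Quotient.mk_surjective w
    obtain ⟨s, rfl⟩ := dehom_surjective a w
    obtain ⟨H, hH, hHs, -⟩ := exists_homogenization a s (M := s.totalDegree + m₀) (by omega)
    rw [← heq (s.totalDegree + m₀) (by omega)]
    exact ⟨H, hH, by rw [hπ, hHs]⟩
  have h1 := hV m₀ le_rfl
  have h2 := hfin m₀
  rw [htop] at h1 h2
  rw [finrank_top] at h1
  exact ⟨Module.finite_def.2 (by rwa [← Module.Finite.iff_fg]), h1⟩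

/-- Bézout's theorem in affine coordinates: `n` forms of degree `d` on projective `n`-space without
a common zero on a hyperplane cut out a scheme of length `d ^ n` in the complementary affine
space. -/
theorem bezout {d : ℕ} {G : Fin n → S} (hG : ∀ i, (G i).IsHomogeneous d) (hd : n ≠ 0 → d ≠ 0)
    (hX : ∀ i, ∃ N, (X i : S) ^ N ∈ Ideal.span (Set.range G) ⊔ Ideal.span {linForm a}) :
    Module.Finite k (W ⧸ (Ideal.span (Set.range fun i => dehom a (G i)))) ∧
      Module.finrank k (W ⧸ (Ideal.span (Set.range fun i => dehom a (G i)))) = d ^ n := by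
  let g : Fin (n + 1) → S := Fin.snoc G (linForm a)
  let e : Fin (n + 1) → ℕ := Fin.snoc (fun _ => d) 1
  have hcast : ∀ i : Fin n, g i.castSucc = G i := fun i => by simp [g]
  have hlast : g (Fin.last n) = linForm a := by simp [g]
  have hg : ∀ i, (g i).IsHomogeneous (e i) := by
    intro i
    refine Fin.lastCases ?_ (fun i => ?_) i
    · simpa [g, e] using linForm_isHomogeneous a
    · simpa [g, e] using hG i
  have he : ∀ i, e i ≠ 0 := by
    intro i
    refine Fin.lastCases ?_ (fun i => ?_) i
    · simp [e]
    · simpa [e] using hd (by rintro rfl; exact i.elim0)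
  have hspan : prefixIdeal g n = Ideal.span (Set.range G) := by
    rw [prefixIdeal]
    congr 1
    ext p
    constructor
    · rintro ⟨i, hi, rfl⟩
      exact ⟨⟨i, hi⟩, (hcast ⟨i, hi⟩).symm⟩
    · rintro ⟨i, rfl⟩
      exact ⟨i.castSucc, i.2, hcast i⟩
  have hspan' : Ideal.span (Set.range g) =
      Ideal.span (Set.range G) ⊔ Ideal.span {linForm a} := by
    have := prefixIdeal_succ g (Fin.last n)
    rwa [Fin.val_last, prefixIdeal_of_le _ le_rfl, hspan, hlast] at this
  have hreg := forms_regular hg he (fun i => by rw [hspan']; exact hX i)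
  have hne : ∀ j, g j ≠ 0 := by
    intro j h0
    have h1 := hreg j 0 1 (isHomogeneous_one _ _) (by rw [h0, zero_mul]; exact Ideal.zero_mem _)
    have h2 : prefixIdeal g j ≤ RingHom.ker (constantCoeff (R := k)) := by
      rw [prefixIdeal, Ideal.span_le]
      rintro _ ⟨i, -, rfl⟩
      exact (hg i).coeff_eq_zero (by simpa using (he i).symm)
    simpa [RingHom.mem_ker] using h2 h1
  have hH := hilbertSeries_prefixIdeal (d := d) hreg hne n (Nat.le_succ n) fun i hi => by
    have := hG ⟨i, hi⟩
    rwa [← hcast] at this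
  rw [hspan] at hH
  obtain ⟨m₀, hm⟩ := exists_finrank_formsIn hH
  have hhom : (Ideal.span (Set.range G)).IsHomogeneous (grading k n) := by
    rw [← Set.image_univ]
    exact isHomogeneous_span hG _
  have := finrank_quotient_dehom a hhom (fun m H hH' h => by
    have := hreg (Fin.last n) m H hH'
    rw [Fin.val_last, hspan, hlast] at this
    exact this h) hm
  rwa [Ideal.map_span, ← Set.range_comp] at this

end Dehomogenization

end ProjRat

/-! ### Lengths over an algebraically closed field -/

namespace ProjRat

open MvPolynomial IsLocalRing

section Length

variable (k : Type*) [Field k] [IsAlgClosed k]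

/-- Over an algebraically closed field, simple modules over a commutative algebra that are finite
over `k` have dimension one, so length and dimension agree. -/
theorem length_eq_finrank_of_isFiniteLength {B : Type*} [CommRing B] [Algebra k B] {M : Type*}
    [AddCommGroup M] [Module B M] (h : IsFiniteLength B M) :
    ∀ [Module k M] [IsScalarTower k B M] [Module.Finite k M],
      Module.length B M = Module.finrank k M := by
  induction h with
  | of_subsingleton =>
    intros
    simp [Module.length_eq_zero, Module.finrank_zero_of_subsingleton]
  | @of_simple_quotient M _ _ N hs _ ih =>
    intro _ _ _
    have h1 : Module.length B M = Module.length B N + Module.length B (M ⧸ N) :=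
      Module.length_eq_add_of_exact N.subtype N.mkQ N.subtype_injective N.mkQ_surjective
        (LinearMap.exact_subtype_mkQ N)
    have hN : Module.Finite k N :=
      Module.Finite.of_injective (N.subtype.restrictScalars k) N.subtype_injective
    have h2 := Submodule.finrank_quotient_add_finrank (N.restrictScalars k)
    have h3 : Module.finrank k (M ⧸ N) = 1 := by
      obtain ⟨P, hP, ⟨e⟩⟩ := isSimpleModule_iff_quot_maximal.1 hs
      have : Module.Finite k (M ⧸ N) :=
        Module.Finite.of_surjective (N.mkQ.restrictScalars k) N.mkQ_surjective
      have : Module.Finite k (B ⧸ P) := Module.Finite.equiv (e.restrictScalars k)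
      have h4 := IsAlgClosed.algebraMap_bijective_of_isIntegral (k := k) (K := B ⧸ P)
      rw [(e.restrictScalars k).finrank_eq]
      exact (LinearEquiv.ofBijective (Algebra.linearMap k (B ⧸ P)) h4).finrank_eq.symm.trans
        (Module.finrank_self k)
    have h5 : Module.finrank k (M ⧸ N) + Module.finrank k N = Module.finrank k M := h2
    rw [h1, ih, Module.length_eq_one, ← h5, h3]
    push_cast
    ring

theorem length_eq_finrank {B : Type*} [CommRing B] [Algebra k B] (M : Type*)
    [AddCommGroup M] [Module B M] [Module k M] [IsScalarTower k B M] [Module.Finite k M] :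
    Module.length B M = Module.finrank k M := by
  have h1 : IsNoetherian B M := isNoetherian_of_tower k inferInstance
  have h2 : IsArtinian B M := isArtinian_of_tower k inferInstance
  exact length_eq_finrank_of_isFiniteLength k
    (isFiniteLength_iff_isNoetherian_isArtinian.2 ⟨h1, h2⟩)

/-- The length of a finite algebra is the sum of the lengths of its local rings. -/
theorem sum_length_localization {B : Type*} [CommRing B] [Algebra k B] [Module.Finite k B]
    {ι : Type*} [Fintype ι] (e : ι ≃ PrimeSpectrum B) (A : ι → Type*) [∀ i, CommRing (A i)]
    [∀ i, Algebra B (A i)] [∀ i, IsLocalization.AtPrime (A i) (e i).asIdeal] :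
    ∑ i, Module.length (A i) (A i) = Module.finrank k B := by
  have hart : IsArtinianRing B := IsArtinianRing.of_finite k B
  have : Fintype (PrimeSpectrum B) := Fintype.ofEquiv ι e
  rw [← length_eq_finrank k (B := B) B,
    (PrimeSpectrum.toPiLocalizationEquiv (R := B)).toLinearEquiv.length_eq]
  rw [show Module.length B (PrimeSpectrum.PiLocalization B) =
    ∑ p : PrimeSpectrum B, Module.length B (Localization p.asIdeal.primeCompl) from
      Module.length_pi_of_fintype B _]
  rw [← e.sum_comp]
  refine Finset.sum_congr rfl fun i _ => ?_
  rw [← Module.length_eq_of_surjective (R := A i) (S := B) (M := A i)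
    (IsArtinianRing.localization_surjective (e i).asIdeal.primeCompl (A i))]
  exact (IsLocalization.algEquiv (e i).asIdeal.primeCompl (A i)
    (Localization (e i).asIdeal.primeCompl)).toLinearEquiv.length_eq

/-- The socle of a local ring of length at most two is simple. -/
theorem simpleSocle_of_length_le {B : Type*} [CommRing B] [IsLocalRing B]
    (h : Module.length B B ≤ 2) : SimpleSocle B := by
  intro a b ha hb ha0
  by_cases hau : IsUnit a
  · obtain ⟨u, rfl⟩ := hau
    exact ⟨b * ↑u⁻¹, by simp⟩
  have ham : a ∈ maximalIdeal B := hau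
  have hbm : b ∈ maximalIdeal B := fun hbu => ha0 (hbu.mul_left_eq_zero.1 (hb a ham))
  by_contra! hne
  -- otherwise `0 < (a) < (a, b) < B` is a chain of length three
  have h1 : (⊥ : Ideal B) < Ideal.span {a} := by
    rw [bot_lt_iff_ne_bot, Ne, Ideal.span_singleton_eq_bot]; exact ha0
  have h2 : Ideal.span {a} < Ideal.span {a} ⊔ Ideal.span {b} := by
    refine lt_of_le_of_ne le_sup_left fun heq => ?_
    have : b ∈ Ideal.span {a} := heq ▸ Ideal.mem_sup_right (Ideal.mem_span_singleton_self b)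
    obtain ⟨r, hr⟩ := Ideal.mem_span_singleton'.1 this
    exact hne r hr.symm
  have h3 : Ideal.span {a} ⊔ Ideal.span {b} < ⊤ := by
    refine lt_of_le_of_lt (sup_le ?_ ?_) (lt_top_iff_ne_top.2 (maximalIdeal.isMaximal B).ne_top)
    · exact (Ideal.span_singleton_le_iff_mem _).2 ham
    · exact (Ideal.span_singleton_le_iff_mem _).2 hbm
  let c : LTSeries (Submodule B B) :=
    { length := 3
      toFun := ![⊥, Ideal.span {a}, Ideal.span {a} ⊔ Ideal.span {b}, ⊤]
      step := by
        intro i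
        fin_cases i
        exacts [h1, h2, h3] }
  have h4 : ((3 : ℕ) : WithBot ℕ∞) ≤ Order.krullDim (Submodule B B) :=
    Order.LTSeries.length_le_krullDim c
  rw [← Module.coe_length] at h4
  have h5 : ((3 : ℕ∞) : WithBot ℕ∞) ≤ ((2 : ℕ∞) : WithBot ℕ∞) :=
    le_trans h4 (WithBot.coe_le_coe.2 h)
  exact absurd (WithBot.coe_le_coe.1 h5) (by decide)

end Length

section LocalRings

variable {k : Type*} [Field k] {n : ℕ}

local notation "W" => MvPolynomial (Fin n) k

theorem exists_sub_algebraMap_mem_maximalIdeal [IsAlgClosed k] (P : Ideal W) [hP : P.IsMaximal]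
    {R : Type*} [CommRing R] [Algebra W R] [IsLocalization.AtPrime R P] [Algebra k R]
    [IsScalarTower k W R] [IsLocalRing R] (b : R) :
    ∃ c : k, b - algebraMap k R c ∈ maximalIdeal R := by
  obtain ⟨q, hq⟩ := isMaximal_iff_eq_vanishingIdeal_singleton.1 hP
  have hmem : ∀ p, p ∈ P ↔ eval q p = 0 := fun p => by
    rw [hq, mem_vanishingIdeal_singleton_iff, ← coe_aeval_eq_eval]; rfl
  obtain ⟨r, s, rfl⟩ := IsLocalization.exists_mk'_eq P.primeCompl b
  have hs : eval q (s : W) ≠ 0 := fun h => s.2 ((hmem _).2 h)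
  refine ⟨eval q r / eval q s, ?_⟩
  have hu := IsLocalization.map_units R s
  have h1 : algebraMap W R s * (IsLocalization.mk' R r s - algebraMap k R (eval q r / eval q s)) =
      algebraMap W R (r - (s : W) * C (eval q r / eval q s)) := by
    rw [mul_sub, IsLocalization.mk'_spec', IsScalarTower.algebraMap_apply k W R, ← map_mul,
      ← map_sub]
    rfl
  have h2 : algebraMap W R (r - (s : W) * C (eval q r / eval q s)) ∈ maximalIdeal R := by
    refine (IsLocalization.AtPrime.to_map_mem_maximal_iff R P _).2 ((hmem _).2 ?_)
    simp [mul_div_cancel₀ _ hs]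
  rw [← h1] at h2
  exact (Ideal.unit_mul_mem_iff_mem _ hu).1 h2

theorem exists_regularFamily_maximalIdeal [IsAlgClosed k] (P : Ideal W) [hP : P.IsMaximal]
    (R : Type*) [CommRing R] [Algebra W R] [IsLocalization.AtPrime R P] [IsLocalRing R] :
    ∃ y : Fin n → W, (∀ i, y i ∈ P) ∧ RegularFamily (fun i => algebraMap W R (y i)) ∧
      Ideal.span (Set.range fun i => algebraMap W R (y i)) = maximalIdeal R := by
  obtain ⟨q, hq⟩ := isMaximal_iff_eq_vanishingIdeal_singleton.1 hP
  have hmem : ∀ p, p ∈ P ↔ eval q p = 0 := fun p => by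
    rw [hq, mem_vanishingIdeal_singleton_iff, ← coe_aeval_eq_eval]; rfl
  refine ⟨fun i => X i - C (q i), fun i => (hmem _).2 (by simp),
    (regularFamily_X_sub_C q).of_isLocalization P.primeCompl, ?_⟩
  rw [← IsLocalization.AtPrime.map_eq_maximalIdeal P R, Set.range_comp' (algebraMap W R),
    ← Ideal.map_span]
  congr 1
  apply le_antisymm
  · rw [Ideal.span_le]
    rintro _ ⟨i, rfl⟩
    exact (hmem _).2 (by simp)
  · intro p hp
    have hcomp : (Ideal.Quotient.mkₐ k (Ideal.span (Set.range fun i => (X i - C (q i) : W)))) =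
        (Algebra.ofId k _).comp (aeval q) := by
      ext i
      simp only [AlgHom.comp_apply, aeval_X]
      exact (Ideal.Quotient.mk_eq_mk_iff_sub_mem _ _).2 (Ideal.subset_span ⟨i, rfl⟩)
    have := DFunLike.congr_fun hcomp p
    rw [AlgHom.comp_apply, show aeval q p = 0 from
      (hmem p).1 hp, map_zero] at this
    exact Ideal.Quotient.eq_zero_iff_mem.1 this

/-- In the local ring at `P`, an ideal of finite codimension contains a power of every element of
`P`. -/
theorem exists_pow_mem_map {P : Ideal W} [hP : P.IsMaximal] {R : Type*} [CommRing R] [Algebra W R]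
    [IsLocalization.AtPrime R P] {J : Ideal W} [Module.Finite k (W ⧸ J)] {y : W} (hy : y ∈ P) :
    ∃ N, algebraMap W R y ^ N ∈ J.map (algebraMap W R) := by
  have hart : IsArtinianRing (W ⧸ J) := IsArtinianRing.of_finite k _
  obtain ⟨N, z, hz⟩ := IsArtinian.exists_pow_succ_smul_dvd (Ideal.Quotient.mk J y) (1 : W ⧸ J)
  obtain ⟨z, rfl⟩ := Ideal.Quotient.mk_surjective z
  refine ⟨N, ?_⟩
  rw [← map_pow, IsLocalization.algebraMap_mem_map_algebraMap_iff P.primeCompl]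
  refine ⟨1 - y * z, fun h => ?_, ?_⟩
  · exact hP.ne_top ((Ideal.eq_top_iff_one _).2
      (by simpa using P.add_mem h (P.mul_mem_right z hy)))
  · rw [← Ideal.Quotient.eq_zero_iff_mem]
    simp only [smul_eq_mul, mul_one] at hz
    rw [map_mul, map_sub, map_one, map_mul, map_pow]
    rw [pow_succ] at hz
    linear_combination -hz

theorem finite_quotient_map (P : Ideal W) [hP : P.IsMaximal] (R : Type*) [CommRing R] [Algebra W R]
    [IsLocalization.AtPrime R P] [Algebra k R] [IsScalarTower k W R] (J : Ideal W)
    [Module.Finite k (W ⧸ J)] :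
    Module.Finite k (R ⧸ J.map (algebraMap W R)) := by
  have hart : IsArtinianRing (W ⧸ J) := IsArtinianRing.of_finite k _
  have h1 := IsArtinianRing.localization_surjective (R := W ⧸ J)
    (Algebra.algebraMapSubmonoid (W ⧸ J) P.primeCompl) (R ⧸ J.map (algebraMap W R))
  have h2 : IsScalarTower k (W ⧸ J) (R ⧸ J.map (algebraMap W R)) := by
    refine IsScalarTower.of_algebraMap_eq (R := k) (S := W ⧸ J)
      (A := R ⧸ J.map (algebraMap W R)) fun c => ?_
    change Ideal.Quotient.mk _ (algebraMap k R c) =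
      Ideal.Quotient.mk _ (algebraMap W R (algebraMap k W c))
    rw [← IsScalarTower.algebraMap_apply k W R]
  exact Module.Finite.of_surjective
    (IsScalarTower.toAlgHom k (W ⧸ J) (R ⧸ J.map (algebraMap W R))).toLinearMap h1

end LocalRings

/-- If `g` lies in `J` locally at all common zeros of `J` and `g`, then `g` is divisible by its
square modulo `J`. -/
theorem mem_sup_span_sq_of_forall {A : Type*} [CommRing A] {J : Ideal A} {g : A}
    (h : ∀ P : Ideal A, P.IsMaximal → J ≤ P → g ∈ P → ∃ s ∉ P, s * g ∈ J) :
    g ∈ J ⊔ Ideal.span {g ^ 2} := by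
  -- the elements that multiply `g` into `J` are, together with `g`, in no common maximal ideal
  let K : Ideal A := J.colon {g} ⊔ Ideal.span {g}
  have hK : K = ⊤ := by
    by_contra hne
    obtain ⟨P, hP, hKP⟩ := Ideal.exists_le_maximal K hne
    have hJ : J ≤ P := fun j hj => hKP (Ideal.mem_sup_left (by
      rw [Submodule.mem_colon_singleton]; exact J.mul_mem_right _ hj))
    obtain ⟨s, hs, hsg⟩ := h P hP hJ (hKP (Ideal.mem_sup_right (Ideal.mem_span_singleton_self g)))
    exact hs (hKP (Ideal.mem_sup_left (by rw [Submodule.mem_colon_singleton]; exact hsg)))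
  obtain ⟨s, hs, t, ht, hst⟩ := Submodule.mem_sup.1 ((Ideal.eq_top_iff_one K).1 hK)
  obtain ⟨z, rfl⟩ := Ideal.mem_span_singleton'.1 ht
  rw [Submodule.mem_colon_singleton] at hs
  have h1 : s * g + z * g ^ 2 = g := by linear_combination g * hst
  have h2 : s * g + z * g ^ 2 ∈ J ⊔ Ideal.span {g ^ 2} :=
    Submodule.add_mem_sup hs (Ideal.mul_mem_left _ z (Ideal.mem_span_singleton_self (g ^ 2)))
  rwa [h1] at h2

end ProjRat

/-! ### Local rings of projective space in an affine chart -/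

namespace ProjRat

open MvPolynomial IsLocalRing

section Points

variable {k : Type*} [Field k] {n : ℕ}

local notation "S" => MvPolynomial (Fin (n + 1)) k
local notation "W" => MvPolynomial (Fin n) k

theorem mem_of_irrelevant {P : Ideal S} (h : ∀ i, X i ∈ P) {p : S}
    (hp : p ∈ HomogeneousIdeal.irrelevant (grading k n)) : p ∈ P := by
  have h1 : homogeneousComponent 0 p = 0 := by
    rw [← coe_decompose]
    exact (HomogeneousIdeal.mem_irrelevant_iff _ p).1 hp
  rw [homogeneousComponent_zero, map_eq_zero_iff _ (C_injective _ _)] at h1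
  have h2 : Ideal.span (Set.range X) ≤ P := by
    rw [Ideal.span_le]
    rintro _ ⟨i, rfl⟩
    exact h i
  exact h2 ((mem_span_X_iff p).2 h1)

theorem exists_X_notMem (Q : PSpace k n) : ∃ i, X i ∉ Q.asHomogeneousIdeal := by
  by_contra! h
  exact Q.not_irrelevant_le fun p hp => mem_of_irrelevant (P := Q.asHomogeneousIdeal.toIdeal) h hp

/-- Over an infinite field, finitely many points lie in a common affine chart. -/
theorem exists_linForm_notMem [Infinite k] {E : Set (PSpace k n)} (hE : E.Finite) :
    ∃ a : Fin n → k, ∀ Q ∈ E, linForm a ∉ Q.asHomogeneousIdeal := by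
  classical
  let L : (Fin (n + 1) → k) →ₗ[k] S := Fintype.linearCombination k X
  have hL : ∀ v, L v = ∑ i, v i • X i := fun v => by
    simp [L, Fintype.linearCombination_apply]
  let V : PSpace k n → Submodule k (Fin (n + 1) → k) := fun Q =>
    (Q.asHomogeneousIdeal.toIdeal.restrictScalars k).comap L
  let s : Finset (Submodule k (Fin (n + 1) → k)) :=
    -- the first hyperplane is excluded so that the coefficient of `X₀` can be normalized to `1`
    insert (LinearMap.ker (LinearMap.proj 0)) (hE.toFinset.image V)
  have htop : ⊤ ∉ s := by
    simp only [s, Finset.mem_insert, Finset.mem_image, not_or, not_exists, not_and]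
    refine ⟨fun h => ?_, fun Q _ h => ?_⟩
    · have : (Pi.single 0 1 : Fin (n + 1) → k) ∈ LinearMap.ker (LinearMap.proj (R := k)
        (φ := fun _ : Fin (n + 1) => k) 0) := h ▸ Submodule.mem_top
      simp at this
    · obtain ⟨i, hi⟩ := exists_X_notMem Q
      have h1 : (Pi.single i 1 : Fin (n + 1) → k) ∈ V Q := h ▸ Submodule.mem_top
      apply hi
      have h2 : L (Pi.single i 1) ∈ Q.asHomogeneousIdeal.toIdeal := h1
      rw [hL, Finset.sum_eq_single i (fun j _ hj => by simp [hj]) (by simp)] at h2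
      simpa using h2
  have hne := Subspace.biUnion_ne_univ_of_top_notMem htop
  obtain ⟨v, hv⟩ := (Set.ne_univ_iff_exists_notMem _).1 hne
  simp only [Set.mem_iUnion, not_exists] at hv
  have hv0 : v 0 ≠ 0 := fun h => hv _ (Finset.mem_insert_self _ _) h
  refine ⟨fun i => (v 0)⁻¹ * v i.succ, fun Q hQ hmem => ?_⟩
  refine hv (V Q) (Finset.mem_insert_of_mem (Finset.mem_image_of_mem _ (hE.mem_toFinset.2 hQ))) ?_
  change L v ∈ Q.asHomogeneousIdeal.toIdeal
  have h1 : L v = C (v 0) * linForm fun i => (v 0)⁻¹ * v i.succ := by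
    rw [hL, Fin.sum_univ_succ, linForm, mul_add, Finset.mul_sum, smul_eq_C_mul]
    congr 1
    refine Finset.sum_congr rfl fun i _ => ?_
    rw [smul_eq_C_mul, ← mul_assoc, ← C_mul, mul_inv_cancel_left₀ hv0]
  rw [h1]
  exact Ideal.mul_mem_left _ _ hmem

/-- If the hyperplane `linForm a = 0` avoids the base locus, then the radical of the sum of their
ideals contains all the variables. -/
theorem exists_X_pow_mem {a : Fin n → k} {F : Fin (n + 1) → S} {d : ℕ}
    (hF : ∀ i, (F i).IsHomogeneous d) (ha : ∀ Q ∈ baseLocus F, linForm a ∉ Q.asHomogeneousIdeal)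
    (i : Fin (n + 1)) :
    X i ∈ (Ideal.span (Set.range F) ⊔ Ideal.span {linForm a}).radical := by
  rw [Ideal.radical_eq_sInf, Ideal.mem_sInf]
  rintro P ⟨hP, hprime⟩
  have hcore := Ideal.toIdeal_homogeneousCore_le (grading k n) P
  have hmem : ∀ {m : ℕ} {G : S}, G.IsHomogeneous m → G ∈ P → G ∈ P.homogeneousCore (grading k n) :=
    fun hG h => Ideal.mem_homogeneousCore_of_homogeneous_of_mem ⟨_, hG⟩ h
  by_contra hX
  let Q : PSpace k n :=
    { asHomogeneousIdeal := P.homogeneousCore (grading k n)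
      isPrime := Ideal.IsPrime.homogeneousCore hprime
      not_irrelevant_le := fun h => hX (hcore (h (HomogeneousIdeal.mem_irrelevant_of_mem _
        Nat.one_pos (isHomogeneous_X k i)))) }
  refine ha Q ?_ (hmem (linForm_isHomogeneous a)
    (hP (Ideal.mem_sup_right (Ideal.mem_span_singleton_self _))))
  rintro _ ⟨j, rfl⟩
  exact hmem (hF j) (hP (Ideal.mem_sup_left (Ideal.subset_span ⟨j, rfl⟩)))

end Points

section Chart

variable {k : Type*} [Field k] {n : ℕ} (a : Fin n → k)

local notation "S" => MvPolynomial (Fin (n + 1)) k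
local notation "W" => MvPolynomial (Fin n) k

variable (Q : PSpace k n) (ha : linForm a ∉ Q.asHomogeneousIdeal)

/-- The homomorphism from the coordinate ring of the affine chart of the linear form of `a` to the
local ring of a point in it: the coordinates go to `Xᵢ / linForm a`. -/
def chart : W →+* LocalRing Q :=
  eval₂Hom ((HomogeneousLocalization.fromZeroRingHom (grading k n) _).comp
    (algebraMap k (grading k n 0))) fun i => HomogeneousLocalization.mk
      { deg := 1
        num := ⟨X i.succ, isHomogeneous_X k _⟩
        den := ⟨linForm a, linForm_isHomogeneous a⟩
        den_mem := ha }

local notation "L" => Localization Q.asHomogeneousIdeal.toIdeal.primeCompl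

/-- The homomorphism `chart` sends the restriction of a form `F` of degree `m` to
`F / (linForm a) ^ m`. -/
theorem val_chart_dehom {F : S} {m : ℕ} (hF : F.IsHomogeneous m) :
    algebraMap S L (linForm a ^ m) * (chart a Q ha (dehom a F)).val = algebraMap S L F := by
  let u : L := Localization.mk 1 ⟨linForm a, ha⟩
  let ρ : S →ₐ[k] L := IsScalarTower.toAlgHom k S L
  have hu : u * ρ (linForm a) = 1 := by
    change Localization.mk 1 _ * algebraMap S L (linForm a) = 1
    rw [← Localization.mk_one_eq_algebraMap, Localization.mk_mul, one_mul, mul_one]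
    exact Localization.mk_self ⟨linForm a, ha⟩
  let ψ : W →ₐ[k] L :=
    { toRingHom := (algebraMap (LocalRing Q) L).comp (chart a Q ha)
      commutes' := fun c => by
        change (chart a Q ha (C c)).val = _
        rw [chart, coe_eval₂Hom, eval₂_C, IsScalarTower.algebraMap_apply k S L]
        exact Localization.mk_one_eq_algebraMap _ }
  have hψ : ∀ i, ψ (X i) = u * ρ (X i.succ) := by
    intro i
    change (chart a Q ha (X i)).val = _
    rw [chart, coe_eval₂Hom, eval₂_X, HomogeneousLocalization.val_mk]
    change _ = Localization.mk 1 _ * algebraMap S L (X i.succ)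
    rw [← Localization.mk_one_eq_algebraMap, Localization.mk_mul, one_mul, mul_one]
  have h1 := map_dehom a hψ hu hF
  change (chart a Q ha (dehom a F)).val = _ at h1
  rw [h1, map_pow, ← mul_assoc, ← mul_pow]
  change (ρ (linForm a) * u) ^ m * _ = _
  rw [mul_comm (ρ _), hu, one_pow, one_mul]
  rfl

theorem isUnit_chart_dehom {F : S} {m : ℕ} (hF : F.IsHomogeneous m) :
    IsUnit (chart a Q ha (dehom a F)) ↔ F ∉ Q.asHomogeneousIdeal := by
  rw [← HomogeneousLocalization.isUnit_iff_isUnit_val]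
  have h1 := val_chart_dehom a Q ha hF
  have h2 : IsUnit (algebraMap S L (linForm a ^ m)) := by
    rw [map_pow]
    exact (IsLocalization.map_units L (⟨linForm a, ha⟩ :
      Q.asHomogeneousIdeal.toIdeal.primeCompl)).pow m
  have h3 := IsLocalization.AtPrime.isUnit_to_map_iff L Q.asHomogeneousIdeal.toIdeal F
  rw [← h1, IsUnit.mul_iff] at h3
  constructor
  · intro h
    exact h3.1 ⟨h2, h⟩
  · intro h
    exact (h3.2 h).2

/-- The prime of the affine coordinate ring that corresponds to a point in the chart. -/
def chartIdeal : Ideal W := (maximalIdeal (LocalRing Q)).comap (chart a Q ha)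

instance : (chartIdeal a Q ha).IsPrime := Ideal.comap_isPrime _ _

theorem dehom_mem_chartIdeal {F : S} {m : ℕ} (hF : F.IsHomogeneous m) :
    dehom a F ∈ chartIdeal a Q ha ↔ F ∈ Q.asHomogeneousIdeal := by
  rw [chartIdeal, Ideal.mem_comap, mem_maximalIdeal, mem_nonunits_iff,
    isUnit_chart_dehom a Q ha hF, not_not]

theorem exists_isHomogeneous_dehom_eq (w : W) :
    ∃ (m : ℕ) (h : S), h.IsHomogeneous m ∧ dehom a h = w := by
  obtain ⟨s, rfl⟩ := dehom_surjective a w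
  obtain ⟨h, h1, h2, -⟩ := exists_homogenization a s le_rfl
  exact ⟨_, h, h1, h2⟩

/-- Every element of the local ring is a fraction `G / H` of forms of the same degree, and also the
fraction of their restrictions to the chart. -/
theorem exists_chart_mul_eq (z : LocalRing Q) :
    ∃ (m : ℕ) (G H : S), G.IsHomogeneous m ∧ H.IsHomogeneous m ∧ H ∉ Q.asHomogeneousIdeal ∧
      z * chart a Q ha (dehom a H) = chart a Q ha (dehom a G) ∧
      algebraMap S L H * z.val = algebraMap S L G := by
  obtain ⟨z, rfl⟩ := HomogeneousLocalization.mk_surjective z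
  have hval : algebraMap S L z.den * (HomogeneousLocalization.mk z).val = algebraMap S L z.num := by
    rw [HomogeneousLocalization.val_mk, Localization.mk_eq_mk']
    exact IsLocalization.mk'_spec' L (z.num : S) ⟨z.den, z.den_mem⟩
  refine ⟨z.deg, z.num, z.den, z.num.2, z.den.2, z.den_mem, ?_, hval⟩
  apply HomogeneousLocalization.val_injective
  rw [HomogeneousLocalization.val_mul]
  have h2 : IsUnit (algebraMap S L (linForm a ^ z.deg)) := by
    rw [map_pow]
    exact (IsLocalization.map_units L (⟨linForm a, ha⟩ :
      Q.asHomogeneousIdeal.toIdeal.primeCompl)).pow _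
  apply h2.mul_left_cancel
  rw [val_chart_dehom a Q ha z.num.2, mul_left_comm, val_chart_dehom a Q ha z.den.2, mul_comm,
    hval]

theorem chart_injective : Function.Injective (chart a Q ha) := by
  rw [injective_iff_map_eq_zero]
  intro w hw
  obtain ⟨m, h, hh, rfl⟩ := exists_isHomogeneous_dehom_eq a w
  have h1 := val_chart_dehom a Q ha hh
  rw [hw, HomogeneousLocalization.val_zero, mul_zero] at h1
  have h2 : h = 0 := IsLocalization.injective L
    (Ideal.primeCompl_le_nonZeroDivisors Q.asHomogeneousIdeal.toIdeal) (by rw [← h1, map_zero])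
  rw [h2, map_zero]

/-- The local ring of `ℙⁿ` at a point of the chart is the localization of the affine coordinate
ring at the corresponding prime. -/
theorem isLocalization_chart :
    letI := (chart a Q ha).toAlgebra
    IsLocalization.AtPrime (LocalRing Q) (chartIdeal a Q ha) := by
  let := (chart a Q ha).toAlgebra
  exact {
    map_units := by
      rintro ⟨w, hw⟩
      by_contra h
      exact hw h
    surj := by
      intro z
      obtain ⟨m, G, H, hG, hH, hHQ, h, -⟩ := exists_chart_mul_eq a Q ha z
      exact ⟨⟨dehom a G, ⟨dehom a H, fun h => hHQ ((dehom_mem_chartIdeal a Q ha hH).1 h)⟩⟩, h⟩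
    exists_of_eq := by
      intro x y h
      exact ⟨1, by rw [chart_injective a Q ha h]⟩ }

/-- The ideal of the base scheme in the local ring at a point is generated by the restrictions of
the `Fᵢ` to the chart. -/
theorem localIdeal_eq_map {F : Fin (n + 1) → S} {d : ℕ} (hF : ∀ i, (F i).IsHomogeneous d) :
    localIdeal F Q = (Ideal.span (Set.range fun i => dehom a (F i))).map (chart a Q ha) := by
  apply le_antisymm
  · intro z hz
    obtain ⟨m, G, H, hG, hH, hHQ, h, hv⟩ := exists_chart_mul_eq a Q ha z
    have h1 : algebraMap S L G ∈ (Ideal.span (Set.range F)).map (algebraMap S L) := by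
      rw [← hv]
      exact Ideal.mul_mem_left _ _ hz
    rw [IsLocalization.algebraMap_mem_map_algebraMap_iff Q.asHomogeneousIdeal.toIdeal.primeCompl]
      at h1
    obtain ⟨s, hs, hsG⟩ := h1
    have hhom : (Ideal.span (Set.range F)).IsHomogeneous (grading k n) := by
      rw [← Set.image_univ]
      exact isHomogeneous_span hF _
    -- some homogeneous component of `s` is still outside `Q`
    obtain ⟨j, hj⟩ : ∃ j, homogeneousComponent j s ∉ Q.asHomogeneousIdeal.toIdeal := by
      by_contra! hall
      exact hs ((mem_iff_homogeneousComponent_mem Q.asHomogeneousIdeal.isHomogeneous s).2 hall)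
    have h2 := homogeneousComponent_mem_of_mem hhom hsG (m + j)
    rw [mul_comm, homogeneousComponent_mul_left hG, if_pos (Nat.le_add_right _ _),
      Nat.add_sub_cancel_left] at h2
    have h3 := Ideal.mem_map_of_mem (chart a Q ha) (Ideal.mem_map_of_mem (dehom a) h2)
    rw [Ideal.map_span, ← Set.range_comp] at h3
    have hu1 := (isUnit_chart_dehom a Q ha (homogeneousComponent_isHomogeneous j s)).2 hj
    have hu2 := (isUnit_chart_dehom a Q ha hH).2 hHQ
    rw [map_mul, map_mul, ← h] at h3
    exact (Ideal.mul_unit_mem_iff_mem _ hu2).1 ((Ideal.mul_unit_mem_iff_mem _ hu1).1 h3)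
  · rw [Ideal.map_span, Ideal.span_le]
    rintro _ ⟨_, ⟨i, rfl⟩, rfl⟩
    have h2 : IsUnit (algebraMap S L (linForm a ^ d)) := by
      rw [map_pow]
      exact (IsLocalization.map_units L (⟨linForm a, ha⟩ :
        Q.asHomogeneousIdeal.toIdeal.primeCompl)).pow _
    change (chart a Q ha (dehom a (F i))).val ∈ (Ideal.span (Set.range F)).map (algebraMap S L)
    rw [← Ideal.unit_mul_mem_iff_mem _ h2, val_chart_dehom a Q ha (hF i)]
    exact Ideal.mem_map_of_mem _ (Ideal.subset_span ⟨i, rfl⟩)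

/-- The point of projective space that corresponds to a prime of the affine coordinate ring: the
homogeneous prime generated by the forms whose restriction lies in the given prime. -/
def pointOf (P : Ideal W) [hP : P.IsPrime] : PSpace k n where
  asHomogeneousIdeal := (P.comap (dehom a)).homogeneousCore (grading k n)
  isPrime := Ideal.IsPrime.homogeneousCore (hP.comap _)
  not_irrelevant_le h := by
    have h1 := Ideal.toIdeal_homogeneousCore_le _ _
      (h (HomogeneousIdeal.mem_irrelevant_of_mem _ Nat.one_pos (linForm_isHomogeneous a)))
    rw [Ideal.mem_comap, dehom_linForm] at h1
    exact hP.ne_top ((Ideal.eq_top_iff_one _).2 h1)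

theorem mem_pointOf (P : Ideal W) [P.IsPrime] {G : S} {m : ℕ} (hG : G.IsHomogeneous m) :
    G ∈ (pointOf a P).asHomogeneousIdeal ↔ dehom a G ∈ P :=
  ⟨fun h => Ideal.toIdeal_homogeneousCore_le (grading k n) (P.comap (dehom a)) h,
    fun h => Ideal.mem_homogeneousCore_of_homogeneous_of_mem ⟨_, hG⟩ h⟩

theorem linForm_notMem_pointOf (P : Ideal W) [hP : P.IsPrime] :
    linForm a ∉ (pointOf a P).asHomogeneousIdeal := by
  rw [mem_pointOf a P (linForm_isHomogeneous a), dehom_linForm]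
  exact fun h => hP.ne_top ((Ideal.eq_top_iff_one _).2 h)

theorem chartIdeal_pointOf (P : Ideal W) [P.IsPrime] :
    chartIdeal a (pointOf a P) (linForm_notMem_pointOf a P) = P := by
  ext w
  obtain ⟨m, h, hh, rfl⟩ := exists_isHomogeneous_dehom_eq a w
  rw [dehom_mem_chartIdeal _ _ _ hh, mem_pointOf _ _ hh]

theorem pointOf_chartIdeal : pointOf a (chartIdeal a Q ha) = Q := by
  refine ProjectiveSpectrum.ext (HomogeneousIdeal.ext' fun m G hG => ?_)
  rw [mem_pointOf a _ hG, dehom_mem_chartIdeal a Q ha hG]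

variable {F : Fin (n + 1) → MvPolynomial (Fin (n + 1)) k} {d : ℕ}

theorem mem_baseLocus_iff (hF : ∀ i, (F i).IsHomogeneous d) :
    Q ∈ baseLocus F ↔ Ideal.span (Set.range fun i => dehom a (F i)) ≤ chartIdeal a Q ha := by
  rw [Ideal.span_le]
  constructor
  · rintro h _ ⟨i, rfl⟩
    exact (dehom_mem_chartIdeal a Q ha (hF i)).2 (h ⟨i, rfl⟩)
  · rintro h _ ⟨i, rfl⟩
    exact (dehom_mem_chartIdeal a Q ha (hF i)).1 (h ⟨i, rfl⟩)

end Chart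

section TotalLength

variable {k : Type*} [Field k] {n d : ℕ} {a : Fin n → k}
  {F : Fin (n + 1) → MvPolynomial (Fin (n + 1)) k}

local notation "S" => MvPolynomial (Fin (n + 1)) k
local notation "W" => MvPolynomial (Fin n) k

/-- The subscheme cut out by forms is contained in an affine chart if all its points are, and
its total length is the dimension of its affine coordinate ring. -/
theorem totalLength_eq_finrank [IsAlgClosed k] (hF : ∀ i, (F i).IsHomogeneous d)
    (hfin : (baseLocus F).Finite) (ha : ∀ Q ∈ baseLocus F, linForm a ∉ Q.asHomogeneousIdeal)
    [Module.Finite k (W ⧸ Ideal.span (Set.range fun i => dehom a (F i)))] :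
    totalLength F hfin =
      Module.finrank k (W ⧸ Ideal.span (Set.range fun i => dehom a (F i))) := by
  set I : Ideal W := Ideal.span (Set.range fun i => dehom a (F i)) with hI
  -- the primes of `W ⧸ I` are the points of the base locus
  let f : PrimeSpectrum (W ⧸ I) → {Q // Q ∈ hfin.toFinset} := fun p =>
    ⟨pointOf a (p.asIdeal.comap (Ideal.Quotient.mk I)), by
      rw [hfin.mem_toFinset, mem_baseLocus_iff a _ (linForm_notMem_pointOf a _) hF,
        chartIdeal_pointOf, ← hI]
      intro w hw
      rw [Ideal.mem_comap, Ideal.Quotient.eq_zero_iff_mem.2 hw]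
      exact Ideal.zero_mem _⟩
  have hmem : ∀ Q : {Q // Q ∈ hfin.toFinset}, Q.1 ∈ baseLocus F := fun Q =>
    hfin.mem_toFinset.1 Q.2
  have hf : Function.Bijective f := by
    constructor
    · intro p p' h
      have h1 : pointOf a (p.asIdeal.comap (Ideal.Quotient.mk I)) =
        pointOf a (p'.asIdeal.comap (Ideal.Quotient.mk I)) := congrArg Subtype.val h
      ext w
      obtain ⟨w, rfl⟩ := Ideal.Quotient.mk_surjective w
      obtain ⟨m, g, hg, rfl⟩ := exists_isHomogeneous_dehom_eq a w
      have h2 := mem_pointOf a (p.asIdeal.comap (Ideal.Quotient.mk I)) hg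
      rw [h1] at h2
      exact h2.symm.trans (mem_pointOf a (p'.asIdeal.comap (Ideal.Quotient.mk I)) hg)
    · intro Q
      have hle := (mem_baseLocus_iff a Q.1 (ha _ (hmem Q)) hF).1 (hmem Q)
      have hk : RingHom.ker (Ideal.Quotient.mk I) ≤ chartIdeal a Q.1 (ha _ (hmem Q)) := by
        rwa [Ideal.mk_ker]
      refine ⟨⟨(chartIdeal a Q.1 (ha _ (hmem Q))).map (Ideal.Quotient.mk I),
        Ideal.map_isPrime_of_surjective Ideal.Quotient.mk_surjective hk⟩, Subtype.ext ?_⟩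
      have hc : ((chartIdeal a Q.1 (ha _ (hmem Q))).map (Ideal.Quotient.mk I)).comap
          (Ideal.Quotient.mk I) = chartIdeal a Q.1 (ha _ (hmem Q)) := by
        rw [Ideal.comap_map_of_surjective' _ Ideal.Quotient.mk_surjective, sup_eq_left.2 hk]
      simp only [f, hc]
      exact pointOf_chartIdeal a Q.1 _
  let e : {Q // Q ∈ hfin.toFinset} ≃ PrimeSpectrum (W ⧸ I) := (Equiv.ofBijective f hf).symm
  have he : ∀ Q, ((e Q).asIdeal.comap (Ideal.Quotient.mk I)) =
      chartIdeal a Q.1 (ha _ (hmem Q)) := by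
    intro Q
    have h1 : f (e Q) = Q := (Equiv.ofBijective f hf).apply_symm_apply Q
    ext w
    obtain ⟨m, g, hg, rfl⟩ := exists_isHomogeneous_dehom_eq a w
    rw [dehom_mem_chartIdeal a _ _ hg, ← mem_pointOf a _ hg]
    exact iff_of_eq (congrArg (fun Q' : PSpace k n => g ∈ Q'.asHomogeneousIdeal)
      (congrArg Subtype.val h1))
  let alg : ∀ Q : {Q // Q ∈ hfin.toFinset}, Algebra (W ⧸ I) (BaseLocalRing F Q.1) := fun Q =>
    (Ideal.quotientMap (localIdeal F Q.1) (chart a Q.1 (ha _ (hmem Q))) (by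
      rw [← Ideal.map_le_iff_le_comap, localIdeal_eq_map a Q.1 (ha _ (hmem Q)) hF])).toAlgebra
  -- the local rings of the base scheme are the localizations of `W ⧸ I`
  have hloc : ∀ Q : {Q // Q ∈ hfin.toFinset},
      IsLocalization.AtPrime (BaseLocalRing F Q.1) (e Q).asIdeal := by
    intro Q
    let := (chart a Q.1 (ha _ (hmem Q))).toAlgebra
    have h1 := isLocalization_chart a Q.1 (ha _ (hmem Q))
    have h2 := IsLocalization.of_surjective (chartIdeal a Q.1 (ha _ (hmem Q))).primeCompl
      (LocalRing Q.1) (Ideal.Quotient.mk I) Ideal.Quotient.mk_surjective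
      (Ideal.Quotient.mk (localIdeal F Q.1)) Ideal.Quotient.mk_surjective (by ext <;> rfl) (by
        rw [Ideal.mk_ker, Ideal.mk_ker, localIdeal_eq_map a Q.1 (ha _ (hmem Q)) hF]
        exact le_rfl)
    have h3 : (chartIdeal a Q.1 (ha _ (hmem Q))).primeCompl.map (Ideal.Quotient.mk I) =
        (e Q).asIdeal.primeCompl := by
      ext w
      obtain ⟨w, rfl⟩ := Ideal.Quotient.mk_surjective w
      have hw : w ∈ chartIdeal a Q.1 (ha _ (hmem Q)) ↔ Ideal.Quotient.mk I w ∈ (e Q).asIdeal := by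
        rw [← he Q, Ideal.mem_comap]
      constructor
      · rintro ⟨v, hv, hvw⟩
        change Ideal.Quotient.mk I w ∉ (e Q).asIdeal
        rw [← hvw]
        intro h
        exact hv (by rw [← he Q]; exact h)
      · intro h
        exact ⟨w, fun hw' => h (hw.1 hw'), rfl⟩
    rw [h3] at h2
    exact h2
  have := sum_length_localization k e (fun Q => BaseLocalRing F Q.1)
  rw [← this, totalLength, ← Finset.sum_coe_sort]
  rfl

end TotalLength

end ProjRat

/-! ### Dominant maps and their degree -/

namespace ProjRat

open MvPolynomial

section Dominance

variable {k : Type*} [Field k] {n d : ℕ} {F : Fin (n + 1) → MvPolynomial (Fin (n + 1)) k}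

local notation "S" => MvPolynomial (Fin (n + 1)) k
local notation "W" => MvPolynomial (Fin n) k

/-- No nonzero form vanishes on the image of a dominant map. -/
theorem Dominant.eq_zero (hdom : Dominant F) {H : S} {m : ℕ} (hH : H.IsHomogeneous m)
    (h : aeval F H = 0) : H = 0 := by
  -- the generic point lies in every closed set that contains the image
  let η : PSpace k n :=
    { asHomogeneousIdeal := ⊥
      isPrime := by
        rw [HomogeneousIdeal.toIdeal_bot]
        exact Ideal.isPrime_bot
      not_irrelevant_le := fun h => X_ne_zero (R := k) (0 : Fin (n + 1))
        (h (HomogeneousIdeal.mem_irrelevant_of_mem _ Nat.one_pos (isHomogeneous_X k 0))) }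
  have h1 : Set.range (baseMap F) ⊆ ProjectiveSpectrum.zeroLocus (grading k n) {H} := by
    rintro _ ⟨p, rfl⟩
    rw [ProjectiveSpectrum.mem_zeroLocus, Set.singleton_subset_iff]
    refine Ideal.mem_homogeneousCore_of_homogeneous_of_mem ⟨m, hH⟩ ?_
    rw [Ideal.mem_comap, h]
    exact Ideal.zero_mem _
  have h2 := closure_minimal h1 (ProjectiveSpectrum.isClosed_zeroLocus (grading k n) {H})
  have h3 : η ∈ ProjectiveSpectrum.zeroLocus (grading k n) {H} := h2 (hdom η)
  rw [ProjectiveSpectrum.mem_zeroLocus, Set.singleton_subset_iff] at h3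
  exact h3

theorem Dominant.ne_zero (hdom : Dominant F) (i : Fin (n + 1)) : F i ≠ 0 := fun h =>
  X_ne_zero (R := k) i (hdom.eq_zero (isHomogeneous_X k i) (by rw [aeval_X, h]))

/-- A map given by constants is dominant only if `n = 0`. -/
theorem Dominant.degree_ne_zero (hdom : Dominant F) (hF : ∀ i, (F i).IsHomogeneous d)
    (hn : n ≠ 0) : d ≠ 0 := by
  rintro rfl
  have hC : ∀ i, F i = C (coeff 0 (F i)) := fun i => by
    rw [← homogeneousComponent_zero, homogeneousComponent_eq_self (hF i)]
  let i : Fin n := ⟨0, Nat.pos_of_ne_zero hn⟩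
  have h := hdom.eq_zero (H := C (coeff 0 (F i.succ)) * X 0 - C (coeff 0 (F 0)) * X i.succ) (m := 1)
    ((isHomogeneous_C_mul_X _ _).sub (isHomogeneous_C_mul_X _ _)) (by
      simp only [map_sub, map_mul, aeval_C, aeval_X, algebraMap_eq]
      rw [← hC, ← hC, mul_comm, sub_self])
  have h1 := congrArg (eval (Pi.single i.succ 1 : Fin (n + 1) → k)) h
  simp only [map_sub, map_mul, eval_C, eval_X, Pi.single_eq_same, mul_one, map_zero] at h1
  rw [Pi.single_eq_of_ne (Fin.succ_ne_zero i).symm, mul_zero, zero_sub, neg_eq_zero] at h1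
  exact hdom.ne_zero 0 (by rw [hC, h1, C_0])

variable (a : Fin n → k)

theorem aeval_dehom (H : S) : aeval (fun i => dehom a (F i)) H = dehom a (aeval F H) := by
  rw [← AlgHom.comp_apply, show aeval (fun i => dehom a (F i)) = (dehom a).comp (aeval F) by
    ext i; simp]

theorem Dominant.dehom_aeval_ne_zero (hdom : Dominant F) (hF : ∀ i, (F i).IsHomogeneous d)
    {H : S} {m : ℕ} (hH : H.IsHomogeneous m) (h0 : H ≠ 0) : dehom a (aeval F H) ≠ 0 := fun h =>
  h0 (hdom.eq_zero hH (dehom_injective_of_isHomogeneous a (hH.aeval F hF) h))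

theorem Dominant.dehom_ne_zero (hdom : Dominant F) (hF : ∀ i, (F i).IsHomogeneous d)
    (i : Fin (n + 1)) : dehom a (F i) ≠ 0 := fun h =>
  hdom.ne_zero i (dehom_injective_of_isHomogeneous a (hF i) h)

local notation "K" => FractionRing (MvPolynomial (Fin n) k)

variable (F) in
/-- The rational functions `F₁ / F₀, …, Fₙ / F₀` in the affine coordinates of the source. -/
def affineMap (i : Fin n) : K :=
  algebraMap W K (dehom a (F i.succ)) / algebraMap W K (dehom a (F 0))

/-- Dehomogenization in the target with respect to `F₀`. -/
theorem aeval_affineMap (h0 : dehom a (F 0) ≠ 0) {H : S} {m : ℕ} (hH : H.IsHomogeneous m) :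
    aeval (affineMap F a) (dehom 0 H) =
      (algebraMap W K (dehom a (F 0)))⁻¹ ^ m * algebraMap W K (dehom a (aeval F H)) := by
  have h0' : algebraMap W K (dehom a (F 0)) ≠ 0 := by
    rwa [Ne, FaithfulSMul.algebraMap_eq_zero_iff]
  rw [map_dehom 0 (ψ := aeval (affineMap F a))
    (ρ := aeval fun i => algebraMap W K (dehom a (F i)))
    (u := (algebraMap W K (dehom a (F 0)))⁻¹) (fun i => ?_) ?_ hH, ← aeval_dehom,
    ← aeval_algebraMap_apply]
  · rfl
  · simp [linForm, inv_mul_cancel₀ h0']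
  · rw [aeval_X, aeval_X, affineMap, div_eq_inv_mul]

/-- Polynomial relations between the `Fᵢ / F₀` homogenize to forms that vanish on the image. -/
theorem Dominant.algebraicIndependent (hdom : Dominant F) (hF : ∀ i, (F i).IsHomogeneous d) :
    AlgebraicIndependent k (affineMap F a) := by
  have h0 := hdom.dehom_ne_zero a hF 0
  rw [algebraicIndependent_iff]
  intro p hp
  obtain ⟨m, H, hH, rfl⟩ := exists_isHomogeneous_dehom_eq 0 p
  rw [aeval_affineMap a h0 hH] at hp
  have h0' : algebraMap W K (dehom a (F 0)) ≠ 0 := by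
    rwa [Ne, FaithfulSMul.algebraMap_eq_zero_iff]
  have h1 := (mul_eq_zero.1 hp).resolve_left (pow_ne_zero _ (inv_ne_zero h0'))
  rw [FaithfulSMul.algebraMap_eq_zero_iff] at h1
  by_contra hne
  exact hdom.dehom_aeval_ne_zero a hF hH (fun h => hne (by rw [h, map_zero])) h1

theorem trdeg_polynomial : Algebra.trdeg k W = n := by
  rw [MvPolynomial.trdeg_of_isDomain]
  simp

theorem trdeg_fractionRing : Algebra.trdeg k K = n := by
  have h1 := trdeg_add_eq k W (A := K)
  have : Algebra.IsAlgebraic W K := IsLocalization.isAlgebraic (R := W) K (nonZeroDivisors W)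
  rw [trdeg_eq_zero (R := W) (A := K), trdeg_polynomial, add_zero] at h1
  exact h1.symm

/-- The subfield of rational functions in `F₁ / F₀, …, Fₙ / F₀`. -/
abbrev affineField (F : Fin (n + 1) → S) : IntermediateField k K :=
  IntermediateField.adjoin k (Set.range (affineMap F a))

/-- The function field is algebraic over the subfield because both have transcendence degree `n`,
and finite because it is finitely generated. -/
theorem Dominant.finite_affineField (hdom : Dominant F) (hF : ∀ i, (F i).IsHomogeneous d) :
    Module.Finite (affineField a F) K := by
  have h1 := (hdom.algebraicIndependent a hF).isTranscendenceBasis_of_lift_trdeg_le_of_finite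
    (by rw [trdeg_fractionRing]; simp)
  have h2 := h1.isAlgebraic_field
  have h3 : Algebra.EssFiniteType W K :=
    Algebra.EssFiniteType.of_isLocalization K (nonZeroDivisors W)
  have h4 : Algebra.EssFiniteType k K := Algebra.EssFiniteType.comp k W K
  have h5 : Algebra.EssFiniteType (affineField a F) K := Algebra.EssFiniteType.of_comp k _ K
  exact Algebra.finite_of_essFiniteType_of_isAlgebraic

/-- The embedding of the coordinate ring of the chart into the field of fractions of the homogeneous
coordinate ring. -/
def chartHom : W →ₐ[k] FractionRing S :=
  aeval fun i => (algebraMap S (FractionRing S) (linForm a))⁻¹ *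
    algebraMap S (FractionRing S) (X i.succ)

theorem algebraMap_linForm_ne_zero : algebraMap S (FractionRing S) (linForm a) ≠ 0 := by
  rw [Ne, FaithfulSMul.algebraMap_eq_zero_iff]
  exact linForm_ne_zero a

theorem chartHom_dehom {G : S} {m : ℕ} (hG : G.IsHomogeneous m) :
    chartHom a (dehom a G) =
      (algebraMap S (FractionRing S) (linForm a))⁻¹ ^ m * algebraMap S (FractionRing S) G :=
  map_dehom a (ψ := chartHom a) (ρ := IsScalarTower.toAlgHom k S (FractionRing S))
    (fun i => by simp [chartHom]) (inv_mul_cancel₀ (algebraMap_linForm_ne_zero a)) hG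

theorem chartHom_injective : Function.Injective (chartHom a) := by
  rw [injective_iff_map_eq_zero]
  intro w hw
  obtain ⟨m, G, hG, rfl⟩ := exists_isHomogeneous_dehom_eq a w
  rw [chartHom_dehom a hG] at hw
  have h1 := (mul_eq_zero.1 hw).resolve_left
    (pow_ne_zero _ (inv_ne_zero (algebraMap_linForm_ne_zero a)))
  rw [FaithfulSMul.algebraMap_eq_zero_iff] at h1
  rw [h1, map_zero]

/-- The embedding of the field of fractions of the chart into the field of fractions of the
homogeneous coordinate ring. Its image is the function field of projective space. -/
def chartField : K →+* FractionRing S :=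
  IsFractionRing.lift (A := W) (g := (chartHom a).toRingHom) (chartHom_injective a)

theorem chartField_div_dehom {G H : S} {m : ℕ} (hG : G.IsHomogeneous m) (hH : H.IsHomogeneous m) :
    chartField a (algebraMap W K (dehom a G) / algebraMap W K (dehom a H)) =
      algebraMap S (FractionRing S) G / algebraMap S (FractionRing S) H := by
  have h : ∀ w, chartField a (algebraMap W K w) = chartHom a w := fun w =>
    IsFractionRing.lift_algebraMap _ w
  rw [map_div₀, h, h, chartHom_dehom a hG, chartHom_dehom a hH, mul_div_mul_left]
  exact pow_ne_zero _ (inv_ne_zero (algebraMap_linForm_ne_zero a))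

theorem exists_isHomogeneous_dehom_eq₂ (w w' : W) : ∃ (m : ℕ) (G H : S), G.IsHomogeneous m ∧
    H.IsHomogeneous m ∧ dehom a G = w ∧ dehom a H = w' := by
  obtain ⟨s, rfl⟩ := dehom_surjective a w
  obtain ⟨s', rfl⟩ := dehom_surjective a w'
  obtain ⟨G, hG, h, -⟩ := exists_homogenization a s (le_max_left _ s'.totalDegree)
  obtain ⟨H, hH, h', -⟩ := exists_homogenization a s' (le_max_right s.totalDegree _)
  exact ⟨_, G, H, hG, hH, h, h'⟩

/-- Every fraction of polynomials in the affine coordinates is a fraction of two forms of the same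
degree. -/
theorem map_chartField_top : (⊤ : Subfield K).map (chartField a) = functionField k n := by
  ext z
  rw [mem_functionField]
  constructor
  · rintro ⟨w, -, rfl⟩
    obtain ⟨p, q, hq, rfl⟩ := IsFractionRing.div_surjective (A := W) w
    obtain ⟨m, G, H, hG, hH, rfl, rfl⟩ := exists_isHomogeneous_dehom_eq₂ a p q
    refine ⟨m, G, H, hG, hH, ?_, chartField_div_dehom a hG hH⟩
    rintro rfl
    exact nonZeroDivisors.ne_zero hq (map_zero _)
  · rintro ⟨m, G, H, hG, hH, -, rfl⟩
    exact ⟨_, trivial, chartField_div_dehom a hG hH⟩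

theorem Dominant.map_chartField_affineField (hdom : Dominant F)
    (hF : ∀ i, (F i).IsHomogeneous d) :
    (affineField a F).toSubfield.map (chartField a) = pullbackField F := by
  have h0 := hdom.dehom_ne_zero a hF 0
  have h0' : algebraMap W K (dehom a (F 0)) ≠ 0 := by
    rwa [Ne, FaithfulSMul.algebraMap_eq_zero_iff]
  have key : ∀ {m : ℕ} {G H : S}, G.IsHomogeneous m → H.IsHomogeneous m →
      chartField a (aeval (affineMap F a) (dehom 0 G) / aeval (affineMap F a) (dehom 0 H)) =
      algebraMap S (FractionRing S) (aeval F G) / algebraMap S (FractionRing S) (aeval F H) := by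
    intro m G H hG hH
    rw [aeval_affineMap a h0 hG, aeval_affineMap a h0 hH, mul_div_mul_left _ _
      (pow_ne_zero _ (inv_ne_zero h0')), chartField_div_dehom a (hG.aeval F hF) (hH.aeval F hF)]
  ext z
  constructor
  · rintro ⟨w, hw, rfl⟩
    obtain ⟨p, q, rfl⟩ := (IntermediateField.mem_adjoin_range_iff k _ w).1 hw
    obtain ⟨m, G, H, hG, hH, rfl, rfl⟩ := exists_isHomogeneous_dehom_eq₂ 0 p q
    rw [key hG hH]
    by_cases hH0 : aeval F H = 0
    · rw [hH0, map_zero, div_zero]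
      exact (pullbackField F).zero_mem
    · exact ⟨m, G, H, hG, hH, hH0, rfl⟩
  · rintro ⟨m, G, H, hG, hH, -, rfl⟩
    exact ⟨_, (IntermediateField.mem_adjoin_range_iff k _ _).2 ⟨_, _, rfl⟩, key hG hH⟩

/-- The degree of the map, as the degree of an extension of the function field of the chart. -/
theorem Dominant.degree_eq_finrank (hdom : Dominant F) (hF : ∀ i, (F i).IsHomogeneous d) :
    degree F = Module.finrank (affineField a F) K := by
  have := hdom.finite_affineField a hF
  rw [degree, ← map_chartField_top a, ← hdom.map_chartField_affineField a hF,
    Subfield.relrank_map_map, Subfield.relrank_top_right]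
  change Cardinal.toENat (Module.rank (affineField a F) K) = _
  rw [← Module.finrank_eq_rank]
  simp

end Dominance

end ProjRat

/-! ### Fibres over general points -/

namespace ProjRat

open MvPolynomial

section Fibre

variable {k : Type*} [Field k] {n : ℕ}

local notation "D" => MvPolynomial (Fin n) k

/-- Let `b` be a family in a `k[y₁, …, yₙ]`-algebra that is independent and generates the algebra
up to powers of a polynomial `p`. Then it gives a basis of the fibre over every point at which `p`
does not vanish. -/
theorem finrank_fibre {T : Type*} [CommRing T] [Algebra k T] {ι : Type*} [Fintype ι] {y : Fin n → T}
    {b : ι → T} {p : D} (hli : ∀ g : ι → D, ∑ i, aeval y (g i) * b i = 0 → g = 0)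
    (hp : ∀ z : T, ∃ (N : ℕ) (g : ι → D), aeval y p ^ N * z = ∑ i, aeval y (g i) * b i)
    {c : Fin n → k} (hc : eval c p ≠ 0) :
    Module.finrank k (T ⧸ Ideal.span (Set.range fun j => y j - algebraMap k T (c j))) =
      Fintype.card ι := by
  set I := Ideal.span (Set.range fun j => y j - algebraMap k T (c j)) with hI
  have hq : ∀ g : D, Ideal.Quotient.mk I (aeval y g) = algebraMap k (T ⧸ I) (eval c g) := by
    have : (Ideal.Quotient.mkₐ k I).comp (aeval y) = (Algebra.ofId k (T ⧸ I)).comp (aeval c) := by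
      ext j
      simp only [AlgHom.comp_apply, aeval_X]
      exact (Ideal.Quotient.mk_eq_mk_iff_sub_mem _ _).2 (Ideal.subset_span ⟨j, rfl⟩)
    exact fun g => DFunLike.congr_fun this g
  let l : (ι → k) →ₗ[k] T ⧸ I := Fintype.linearCombination k fun i => Ideal.Quotient.mk I (b i)
  have hl : ∀ v, l v = ∑ i, algebraMap k (T ⧸ I) (v i) * Ideal.Quotient.mk I (b i) := fun v => by
    simp [l, Fintype.linearCombination_apply, Algebra.smul_def]
  have hsurj : Function.Surjective l := by
    intro z
    obtain ⟨z, rfl⟩ := Ideal.Quotient.mk_surjective z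
    obtain ⟨N, g, hg⟩ := hp z
    refine ⟨fun i => (eval c p)⁻¹ ^ N * eval c (g i), ?_⟩
    have h1 := congrArg (Ideal.Quotient.mk I) hg
    simp only [map_mul, map_pow, map_sum, hq] at h1
    rw [hl]
    simp only [map_mul, mul_assoc]
    rw [← Finset.mul_sum, ← h1, ← map_pow, ← mul_assoc, ← map_mul, ← mul_pow, inv_mul_cancel₀ hc,
      one_pow, map_one, one_mul]
  have hinj : Function.Injective l := by
    rw [injective_iff_map_eq_zero]
    intro v hv
    have h1 : ∑ i, algebraMap k T (v i) * b i ∈ I := by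
      rw [← Ideal.Quotient.eq_zero_iff_mem, ← hv, hl, map_sum]
      rfl
    obtain ⟨w, hw⟩ := (Ideal.mem_span_range_iff_exists_fun).1 h1
    choose N g hg using fun j => hp (w j)
    let M := ∑ j, N j
    have hM : ∀ j, M = (M - N j) + N j := fun j =>
      (Nat.sub_add_cancel
        (Finset.single_le_sum (fun _ _ => Nat.zero_le _) (Finset.mem_univ j))).symm
    have h2 := hli (fun i => p ^ M * C (v i) - ∑ j, p ^ (M - N j) * g j i * (X j - C (c j))) (by
      have h3 : ∀ j, aeval y p ^ M * (w j * (y j - algebraMap k T (c j))) =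
          ∑ i, aeval y p ^ (M - N j) * aeval y (g j i) * (y j - algebraMap k T (c j)) * b i := by
        intro j
        rw [hM j, pow_add, mul_assoc, ← mul_assoc (_ ^ N j), hg j, Finset.sum_mul, Finset.mul_sum,
          ← hM j]
        refine Finset.sum_congr rfl fun i _ => ?_
        ring
      have h4 : aeval y p ^ M * ∑ i, algebraMap k T (v i) * b i =
          ∑ j, aeval y p ^ M * (w j * (y j - algebraMap k T (c j))) := by
        rw [← hw, Finset.mul_sum]
      simp only [h3] at h4
      rw [Finset.sum_comm, Finset.mul_sum] at h4
      simp only [map_sub, map_mul, map_pow, map_sum, aeval_C, aeval_X, sub_mul, Finset.sum_mul]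
      rw [Finset.sum_sub_distrib, ← h4, sub_eq_zero]
      exact Finset.sum_congr rfl fun i _ => by ring)
    ext i
    have h3 := congrArg (eval c) (congrFun h2 i)
    simp only [map_sub, map_mul, map_pow, map_sum, eval_C, eval_X, sub_self, mul_zero,
      Finset.sum_const_zero, sub_zero, Pi.zero_apply, map_zero] at h3
    exact (mul_eq_zero.1 h3).resolve_left (pow_ne_zero _ hc)
  rw [← (LinearEquiv.ofBijective l ⟨hinj, hsurj⟩).finrank_eq, Module.finrank_fintype_fun_eq_card]

/-- Generic freeness for a finitely generated domain that is generically finite over a polynomial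
ring. -/
theorem exists_generic_basis {T : Type*} [CommRing T] [Algebra k T] [Algebra.FiniteType k T]
    {K : Type*} [Field K] [Algebra k K] [Algebra T K] [IsScalarTower k T K] [IsFractionRing T K]
    {y : Fin n → T} (hy : AlgebraicIndependent k fun i => algebraMap T K (y i))
    [Module.Finite (IntermediateField.adjoin k (Set.range fun i => algebraMap T K (y i))) K] :
    ∃ (b : Fin (Module.finrank
        (IntermediateField.adjoin k (Set.range fun i => algebraMap T K (y i))) K) → T) (p : D),
      p ≠ 0 ∧ (∀ g : _ → D, ∑ i, aeval y (g i) * b i = 0 → g = 0) ∧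
      ∀ z : T, ∃ (N : ℕ) (g : _ → D), aeval y p ^ N * z = ∑ i, aeval y (g i) * b i := by
  classical
  set A := IntermediateField.adjoin k (Set.range fun i => algebraMap T K (y i)) with hA
  set r := Module.finrank A K with hr
  have hinj : Function.Injective (algebraMap T K) := IsFractionRing.injective T K
  have hj : ∀ g : D, algebraMap T K (aeval y g) = aeval (fun i => algebraMap T K (y i)) g :=
    fun g => (aeval_algebraMap_apply K y g).symm
  have : Nontrivial T := (algebraMap T K).domain_nontrivial
  have hne : ∀ g : D, g ≠ 0 → aeval y g ≠ 0 := fun g hg h => hg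
    ((injective_iff_map_eq_zero _).1 hy g (by
      change aeval _ g = 0
      rw [← hj, h, map_zero]))
  let B := Module.finBasis A K
  -- a common denominator of the basis
  obtain ⟨V, hV⟩ := IsLocalization.exist_integer_multiples_of_finite (nonZeroDivisors T) B
  have hV0 : algebraMap T K V ≠ 0 := fun h =>
    nonZeroDivisors.ne_zero V.2 (hinj (by rw [h, map_zero]))
  choose b hb using hV
  have hb' : ∀ i, algebraMap T K (b i) = algebraMap T K V * B i := fun i => by
    rw [hb i, Algebra.smul_def]
  -- the elements of the subfield are fractions of polynomials in the `y i`
  have hfrac : ∀ β : A, ∃ r s : D, s ≠ 0 ∧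
      (β : K) * algebraMap T K (aeval y s) = algebraMap T K (aeval y r) := by
    intro β
    obtain ⟨r, s, h⟩ := (IntermediateField.mem_adjoin_range_iff k _ _).1 β.2
    by_cases hs : s = 0
    · refine ⟨0, 1, one_ne_zero, ?_⟩
      rw [h, hs, map_zero, div_zero, zero_mul, map_zero, map_zero]
    · refine ⟨r, s, hs, ?_⟩
      rw [h, hj, hj, div_mul_cancel₀]
      rw [← hj]
      exact fun h0 => hne s hs (hinj (by rw [h0, map_zero]))
  have hz : ∀ z : T, ∃ (q : D) (g : Fin r → D), q ≠ 0 ∧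
      aeval y q * z = ∑ i, aeval y (g i) * b i := by
    intro z
    choose r' s hs hrs using fun i => hfrac (B.repr ((algebraMap T K V)⁻¹ * algebraMap T K z) i)
    refine ⟨∏ i, s i, fun i => r' i * ∏ l ∈ Finset.univ.erase i, s l,
      Finset.prod_ne_zero_iff.2 fun i _ => hs i, hinj ?_⟩
    have h1 : algebraMap T K z = ∑ i, (B.repr ((algebraMap T K V)⁻¹ * algebraMap T K z) i : K) *
        algebraMap T K (b i) := by
      have h2 := B.sum_repr ((algebraMap T K V)⁻¹ * algebraMap T K z)
      rw [← mul_right_inj' hV0, mul_inv_cancel_left₀ hV0, Finset.mul_sum] at h2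
      rw [← h2]
      refine Finset.sum_congr rfl fun i _ => ?_
      rw [hb', h2, IntermediateField.smul_def, smul_eq_mul]
      ring
    rw [map_mul, h1, Finset.mul_sum, map_sum]
    refine Finset.sum_congr rfl fun i _ => ?_
    rw [← Finset.mul_prod_erase _ _ (Finset.mem_univ i)]
    simp only [map_mul]
    rw [← hrs i]
    ring
  have hli : ∀ g : Fin r → D, ∑ i, aeval y (g i) * b i = 0 → g = 0 := by
    intro g hg
    have hmem : ∀ i, algebraMap T K (aeval y (g i)) ∈ A := fun i => by
      rw [hj]
      exact (IntermediateField.mem_adjoin_range_iff k _ _).2 ⟨g i, 1, by simp⟩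
    have h1 : ∑ i, (⟨_, hmem i⟩ : A) • B i = 0 := by
      rw [← mul_right_inj' hV0, mul_zero, ← map_zero (algebraMap T K), ← hg, map_sum,
        Finset.mul_sum]
      refine Finset.sum_congr rfl fun i _ => ?_
      rw [map_mul, hb', IntermediateField.smul_def, smul_eq_mul]
      ring
    ext1 i
    by_contra h0
    have h2 := congrArg Subtype.val (Fintype.linearIndependent_iff.1 B.linearIndependent _ h1 i)
    exact hne (g i) h0 (hinj (by rw [map_zero]; exact h2))
  choose q g hq hg using hz
  obtain ⟨t, ht⟩ := Algebra.FiniteType.out (R := k) (A := T)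
  -- it suffices that `p` clears the denominators of `1` and of the products of the basis elements
  -- with the finitely many generators of `T`: then the set `M` of all elements that are generated
  -- up to powers of `p` is stable under multiplication by `T`
  let p : D := q 1 * ∏ x ∈ t, ∏ i, q (x * b i)
  let M : Set T := {z | ∃ (N : ℕ) (g : Fin r → D), aeval y p ^ N * z = ∑ i, aeval y (g i) * b i}
  have hadd : ∀ z ∈ M, ∀ z' ∈ M, z + z' ∈ M := by
    rintro z ⟨N, g, h⟩ z' ⟨N', g', h'⟩
    refine ⟨N + N', fun i => p ^ N' * g i + p ^ N * g' i, ?_⟩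
    simp only [map_add, map_mul, map_pow, add_mul, mul_assoc]
    rw [Finset.sum_add_distrib, ← Finset.mul_sum, ← Finset.mul_sum, ← h, ← h']
    ring
  have hsmul : ∀ (f : D), ∀ z ∈ M, aeval y f * z ∈ M := by
    rintro f z ⟨N, g, h⟩
    refine ⟨N, fun i => f * g i, ?_⟩
    simp only [map_mul, mul_assoc]
    rw [← Finset.mul_sum, ← h]
    ring
  have hdiv : ∀ z, aeval y p * z ∈ M → z ∈ M := by
    rintro z ⟨N, g, h⟩
    exact ⟨N + 1, g, by rw [← h]; ring⟩
  have hbase : ∀ z f, p = f * q z → z ∈ M := by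
    intro z f hf
    refine ⟨1, fun i => f * g z i, ?_⟩
    rw [pow_one, hf, map_mul, mul_assoc, hg, Finset.mul_sum]
    exact Finset.sum_congr rfl fun i _ => by rw [map_mul, mul_assoc]
  have hone : (1 : T) ∈ M := hbase 1 _ (mul_comm _ _)
  have hgen : ∀ x ∈ t, ∀ z ∈ M, x * z ∈ M := by
    rintro x hx z ⟨N, g, h⟩
    have hxb : ∀ i, x * b i ∈ M := by
      intro i
      obtain ⟨f, hf⟩ : q (x * b i) ∣ p := by
        refine Dvd.dvd.mul_left ?_ _
        exact (Finset.dvd_prod_of_mem (fun i => q (x * b i)) (Finset.mem_univ i)).trans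
          (Finset.dvd_prod_of_mem (fun x => ∏ i, q (x * b i)) hx)
      exact hbase _ f (by rw [hf, mul_comm])
    have hsum : ∀ s : Finset (Fin r), ∑ i ∈ s, aeval y (g i) * (x * b i) ∈ M := by
      intro s
      induction s using Finset.induction_on with
      | empty => exact ⟨0, 0, by simp⟩
      | insert i s hi ih =>
        rw [Finset.sum_insert hi]
        exact hadd _ (hsmul _ _ (hxb i)) _ ih
    have h1 : aeval y (p ^ N) * (x * z) ∈ M := by
      rw [map_pow, mul_left_comm, h, Finset.mul_sum]
      simp only [mul_left_comm x]
      exact hsum _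
    have h2 : ∀ N, aeval y (p ^ N) * (x * z) ∈ M → x * z ∈ M := by
      intro N
      induction N with
      | zero => simp
      | succ N ih =>
        intro h
        rw [pow_succ', map_mul, mul_assoc] at h
        exact ih (hdiv _ h)
    exact h2 N h1
  have hall : ∀ x : T, ∀ z ∈ M, x * z ∈ M := by
    intro x
    have hx : x ∈ Algebra.adjoin k (t : Set T) := ht ▸ Algebra.mem_top
    induction hx using Algebra.adjoin_induction with
    | mem x hx => exact hgen x hx
    | algebraMap c =>
      intro z hz
      have := hsmul (C c) z hz
      rwa [aeval_C] at this
    | add x y _ _ hx hy =>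
      intro z hz
      rw [add_mul]
      exact hadd _ (hx z hz) _ (hy z hz)
    | mul x y _ _ hx hy =>
      intro z hz
      rw [mul_assoc]
      exact hx _ (hy z hz)
  refine ⟨b, p, mul_ne_zero (hq _) (Finset.prod_ne_zero_iff.2 fun x _ =>
    Finset.prod_ne_zero_iff.2 fun i _ => hq _), hli, fun z => ?_⟩
  have h := hall z 1 hone
  rwa [mul_one] at h

end Fibre

end ProjRat

/-! ### General members of the linear system -/

namespace ProjRat

open MvPolynomial

section Pencil

variable {k : Type*} [Field k] {n d : ℕ} {F : Fin (n + 1) → MvPolynomial (Fin (n + 1)) k}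

local notation "S" => MvPolynomial (Fin (n + 1)) k
local notation "W" => MvPolynomial (Fin n) k

/-- Restriction to the hyperplane where the linear form of `a` vanishes. -/
def atInfinity (a : Fin n → k) : S →ₐ[k] W := aeval (Fin.cons (-∑ i, C (a i) * X i) X)

/-- The kernel of the restriction to the hyperplane is generated by the linear form. -/
theorem mem_span_linForm {a : Fin n → k} {s : S} (hs : atInfinity a s = 0) :
    s ∈ Ideal.span {linForm a} := by
  have hcomp : ((Ideal.Quotient.mkₐ k (Ideal.span {linForm a})).comp (rename Fin.succ)).comp
      (atInfinity a) = Ideal.Quotient.mkₐ k (Ideal.span {linForm a}) := by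
    ext i
    refine Fin.cases ?_ (fun i => ?_) i
    · simp only [AlgHom.comp_apply, atInfinity, aeval_X, Fin.cons_zero]
      refine ((Ideal.Quotient.mk_eq_mk_iff_sub_mem _ _).2 ?_).symm
      simp only [map_neg, map_sum, map_mul, rename_C, rename_X, sub_neg_eq_add]
      exact Ideal.mem_span_singleton_self _
    · simp [AlgHom.comp_apply, atInfinity]
  have h := DFunLike.congr_fun hcomp s
  rw [AlgHom.comp_apply, hs, map_zero] at h
  exact Ideal.Quotient.eq_zero_iff_mem.1 h.symm

theorem atInfinity_isHomogeneous (a : Fin n → k) {s : S} {m : ℕ} (hs : s.IsHomogeneous m) :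
    (atInfinity a s).IsHomogeneous m := by
  have := hs.aeval (n := 1) (Fin.cons (-∑ i, C (a i) * X i) X : Fin (n + 1) → W) (fun i => by
    refine Fin.cases ?_ (fun i => ?_) i
    · rw [Fin.cons_zero]
      exact (IsHomogeneous.sum _ _ _ fun _ _ => isHomogeneous_C_mul_X _ _).neg
    · rw [Fin.cons_succ]
      exact isHomogeneous_X k i)
  rwa [one_mul] at this

/-- The restrictions of the `n + 1` forms to a hyperplane are algebraically dependent. -/
theorem exists_form_mem_span_linForm (hF : ∀ i, (F i).IsHomogeneous d) (hd : d ≠ 0)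
    (a : Fin n → k) :
    ∃ (m : ℕ) (P : S), P.IsHomogeneous m ∧ P ≠ 0 ∧ aeval F P ∈ Ideal.span {linForm a} := by
  have hdep : ¬ AlgebraicIndependent k fun i => atInfinity a (F i) := by
    intro h
    have h1 := h.lift_cardinalMk_le_trdeg
    rw [trdeg_polynomial] at h1
    simp only [Cardinal.mk_fin, Cardinal.lift_natCast, Nat.cast_le] at h1
    omega
  rw [algebraicIndependent_iff] at hdep
  push Not at hdep
  obtain ⟨P, hP, hP0⟩ := hdep
  have hcomp : ∀ H : S, aeval (fun i => atInfinity a (F i)) H = atInfinity a (aeval F H) := by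
    intro H
    have h : aeval (fun i => atInfinity a (F i)) = (atInfinity a).comp (aeval F) := by
      ext i
      simp
    rw [h, AlgHom.comp_apply]
  obtain ⟨m, hm⟩ : ∃ m, homogeneousComponent m P ≠ 0 := by
    by_contra! h
    exact hP0 (by rw [← sum_homogeneousComponent P]; exact Finset.sum_eq_zero fun i _ => h i)
  refine ⟨m, homogeneousComponent m P, homogeneousComponent_isHomogeneous m P, hm,
    mem_span_linForm ?_⟩
  have hhom : ∀ i, (atInfinity a (aeval F (homogeneousComponent i P))).IsHomogeneous (d * i) :=
    fun i => atInfinity_isHomogeneous a ((homogeneousComponent_isHomogeneous i P).aeval F hF)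
  have h1 := congrArg (homogeneousComponent (d * m)) hP
  rw [hcomp, map_zero] at h1
  conv at h1 => lhs; rw [← sum_homogeneousComponent P]
  rw [map_sum, map_sum, map_sum] at h1
  have h2 : ∀ i, homogeneousComponent (d * m) (atInfinity a (aeval F (homogeneousComponent i P))) =
      if i = m then atInfinity a (aeval F (homogeneousComponent i P)) else 0 := by
    intro i
    rw [homogeneousComponent_of_mem (hhom i)]
    congr 1
    simp only [mul_eq_mul_left_iff, hd, or_false, eq_iff_iff]
    exact eq_comm
  simp only [h2, Finset.sum_ite_eq', Finset.mem_range] at h1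
  by_cases hlt : m < P.totalDegree + 1
  · rwa [if_pos hlt] at h1
  · exact absurd (homogeneousComponent_eq_zero _ _ (by omega)) hm

/-- For general `c`, the forms `Fᵢ - cᵢ F₀` have no common zero on a hyperplane that avoids the base
locus. -/
theorem Dominant.exists_generic_pencil (hdom : Dominant F) (hF : ∀ i, (F i).IsHomogeneous d)
    {a : Fin n → k} (ha : ∀ Q ∈ baseLocus F, linForm a ∉ Q.asHomogeneousIdeal) :
    ∃ p : W, p ≠ 0 ∧ ∀ c, eval c p ≠ 0 → ∀ i, ∃ N, (X i : S) ^ N ∈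
      Ideal.span (Set.range fun i : Fin n => F i.succ - c i • F 0) ⊔ Ideal.span {linForm a} := by
  -- for `n = 0` there are no forms `Fᵢ` with `i > 0`, and the hyperplane is empty
  by_cases hn : n = 0
  · subst hn
    refine ⟨1, one_ne_zero, fun c _ i => ⟨1, Ideal.mem_sup_right ?_⟩⟩
    rw [pow_one, Fin.fin_one_eq_zero i, show X 0 = linForm a by simp [linForm]]
    exact Ideal.mem_span_singleton_self _
  obtain ⟨m, P, hP, hP0, hPF⟩ := exists_form_mem_span_linForm hF (hdom.degree_ne_zero hF hn) a
  refine ⟨dehom 0 P, fun h => hP0 (dehom_injective_of_isHomogeneous 0 hP h), fun c hc i => ?_⟩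
  set J := Ideal.span (Set.range fun i : Fin n => F i.succ - c i • F 0) ⊔ Ideal.span {linForm a}
    with hJ
  have hdiff : ∀ i : Fin n, F i.succ - c i • F 0 ∈ J := fun i =>
    Ideal.mem_sup_left (Ideal.subset_span ⟨i, rfl⟩)
  -- modulo the pencil, `P(F)` is a multiple of a power of `F₀` by the constant `P(1, c)`
  have h0 : F 0 ∈ J.radical := by
    let q := Ideal.Quotient.mkₐ k J
    have h1 : aeval (fun i => q (F i)) P =
        q (F 0) ^ m * algebraMap k (S ⧸ J) (eval c (dehom 0 P)) := by
      have h2 : (fun i => q (F i)) = fun i => q (F 0) *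
          algebraMap k (S ⧸ J) ((Fin.cons 1 c : Fin (n + 1) → k) i) := by
        funext i
        refine Fin.cases ?_ (fun i => ?_) i
        · simp
        · rw [Fin.cons_succ, mul_comm, ← Algebra.smul_def, ← map_smul]
          exact (Ideal.Quotient.mk_eq_mk_iff_sub_mem _ _).2 (hdiff i)
      have h3 : aeval (fun i => algebraMap k (S ⧸ J) ((Fin.cons 1 c : Fin (n + 1) → k) i)) =
          (Algebra.ofId k (S ⧸ J)).comp ((aeval c).comp (dehom 0)) := by
        ext i
        refine Fin.cases ?_ (fun i => ?_) i
        · simp [dehom_X_zero]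
        · simp [dehom_X_succ, Algebra.ofId_apply]
      rw [h2, aeval_smul_of_isHomogeneous hP, h3]
      rfl
    have h2 : aeval (fun i => q (F i)) P = 0 := by
      rw [show aeval (fun i => q (F i)) = q.comp (aeval F) by ext i; simp]
      exact Ideal.Quotient.eq_zero_iff_mem.2 (Ideal.mem_sup_right hPF)
    rw [h2] at h1
    refine ⟨m, Ideal.Quotient.eq_zero_iff_mem.1 ?_⟩
    have h3 := congrArg (· * algebraMap k (S ⧸ J) (eval c (dehom 0 P))⁻¹) h1
    simp only [zero_mul, mul_assoc, ← map_mul, mul_inv_cancel₀ hc, map_one, mul_one] at h3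
    rw [map_pow]
    exact h3.symm
  have h1 : Ideal.span (Set.range F) ⊔ Ideal.span {linForm a} ≤ J.radical := by
    refine sup_le ?_ (le_sup_right.trans Ideal.le_radical)
    rw [Ideal.span_le]
    rintro _ ⟨i, rfl⟩
    refine Fin.cases h0 (fun i => ?_) i
    have h2 := Ideal.add_mem _ (Ideal.le_radical (hdiff i))
      (Submodule.smul_of_tower_mem J.radical (c i) h0)
    rwa [sub_add_cancel] at h2
  have h2 := Ideal.radical_mono h1 (exists_X_pow_mem hF ha i)
  rwa [Ideal.radical_idem] at h2

end Pencil

end ProjRat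

/-! ### Fitting decomposition and general fibres -/

namespace ProjRat

open MvPolynomial

section Fitting

variable {k : Type*} [Field k] {A : Type*} [CommRing A] [Algebra k A]

/-- The localization of a finite algebra at an element has the dimension of the image of
multiplication by a high power of that element. The exponent is at least `2`, so
that an element in this image is divisible by the square. -/
theorem finrank_localization_away (J : Ideal A) (g : A) [Module.Finite k (A ⧸ J)] (T : Type*)
    [CommRing T] [Algebra A T] [IsLocalization.Away g T] [Algebra k T] [IsScalarTower k A T] :
    ∃ e, Module.finrank k (T ⧸ J.map (algebraMap A T)) = Module.finrank k
      (LinearMap.range (LinearMap.mulLeft k (Ideal.Quotient.mk J g ^ (e + 2)))) := by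
  have hart : IsArtinianRing (A ⧸ J) := IsArtinianRing.of_finite k _
  have h1 := IsArtinianRing.localization_surjective (R := A ⧸ J)
    (Algebra.algebraMapSubmonoid (A ⧸ J) (Submonoid.powers g)) (T ⧸ J.map (algebraMap A T))
  have h2 : IsScalarTower k (A ⧸ J) (T ⧸ J.map (algebraMap A T)) := by
    refine IsScalarTower.of_algebraMap_eq (R := k) (S := A ⧸ J)
      (A := T ⧸ J.map (algebraMap A T)) fun c => ?_
    change Ideal.Quotient.mk _ (algebraMap k T c) =
      Ideal.Quotient.mk _ (algebraMap A T (algebraMap k A c))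
    rw [← IsScalarTower.algebraMap_apply k A T]
  let l := (IsScalarTower.toAlgHom k (A ⧸ J) (T ⧸ J.map (algebraMap A T))).toLinearMap
  obtain ⟨e, y, hy⟩ := IsArtinian.exists_pow_succ_smul_dvd (Ideal.Quotient.mk J g) (1 : A ⧸ J)
  simp only [smul_eq_mul, mul_one] at hy
  have hpow : ∀ t, Ideal.Quotient.mk J g ^ e = Ideal.Quotient.mk J g ^ t *
      (Ideal.Quotient.mk J g ^ e * y ^ t) := by
    intro t
    induction t with
    | zero => simp
    | succ t ih =>
      conv_lhs => rw [ih]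
      conv_lhs => rw [← hy]
      rw [Nat.succ_eq_add_one]
      ring
  have hker : LinearMap.ker l =
      LinearMap.ker (LinearMap.mulLeft k (Ideal.Quotient.mk J g ^ (e + 2))) := by
    ext z
    obtain ⟨z, rfl⟩ := Ideal.Quotient.mk_surjective z
    have h3 : l (Ideal.Quotient.mk J z) = Ideal.Quotient.mk _ (algebraMap A T z) := rfl
    rw [LinearMap.mem_ker, LinearMap.mem_ker, h3, Ideal.Quotient.eq_zero_iff_mem,
      IsLocalization.algebraMap_mem_map_algebraMap_iff (Submonoid.powers g),
      LinearMap.mulLeft_apply]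
    constructor
    · rintro ⟨_, ⟨t, rfl⟩, h⟩
      have h4 : Ideal.Quotient.mk J g ^ t * Ideal.Quotient.mk J z = 0 := by
        rw [← map_pow, ← map_mul]
        exact Ideal.Quotient.eq_zero_iff_mem.2 h
      rw [pow_add, hpow t]
      linear_combination (Ideal.Quotient.mk J g ^ e * y ^ t * Ideal.Quotient.mk J g ^ 2) * h4
    · intro h
      refine ⟨g ^ (e + 2), ⟨e + 2, rfl⟩, Ideal.Quotient.eq_zero_iff_mem.1 ?_⟩
      rw [map_mul, map_pow, h]
  refine ⟨e, ?_⟩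
  have h3 := LinearMap.finrank_range_add_finrank_ker l
  have h4 := LinearMap.finrank_range_add_finrank_ker
    (LinearMap.mulLeft k (Ideal.Quotient.mk J g ^ (e + 2)))
  rw [LinearMap.range_eq_top.2 h1, finrank_top, hker] at h3
  omega

/-- The dimensions of the image and the cokernel of multiplication by `g` add up to that of the
algebra. -/
theorem finrank_quotient_sup_span (J : Ideal A) (g : A) [Module.Finite k (A ⧸ J)] :
    Module.finrank k (LinearMap.range (LinearMap.mulLeft k (Ideal.Quotient.mk J g))) +
      Module.finrank k (A ⧸ J ⊔ Ideal.span {g}) = Module.finrank k (A ⧸ J) := by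
  let l : (A ⧸ J) →ₗ[k] A ⧸ J ⊔ Ideal.span {g} :=
    (Ideal.Quotient.factorₐ k (le_sup_left : J ≤ J ⊔ Ideal.span {g})).toLinearMap
  have hl : ∀ z, l (Ideal.Quotient.mk J z) = Ideal.Quotient.mk _ z := fun _ => rfl
  have hsurj : Function.Surjective l := by
    intro z
    obtain ⟨z, rfl⟩ := Ideal.Quotient.mk_surjective z
    exact ⟨Ideal.Quotient.mk J z, rfl⟩
  have hker : LinearMap.ker l = LinearMap.range (LinearMap.mulLeft k (Ideal.Quotient.mk J g)) := by
    ext z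
    obtain ⟨z, rfl⟩ := Ideal.Quotient.mk_surjective z
    rw [LinearMap.mem_ker, hl, Ideal.Quotient.eq_zero_iff_mem]
    constructor
    · intro h
      obtain ⟨j, hj, w, hw, rfl⟩ := Submodule.mem_sup.1 h
      obtain ⟨w, rfl⟩ := Ideal.mem_span_singleton'.1 hw
      refine ⟨Ideal.Quotient.mk J w, ?_⟩
      rw [LinearMap.mulLeft_apply, map_add, Ideal.Quotient.eq_zero_iff_mem.2 hj, zero_add, map_mul,
        mul_comm]
    · rintro ⟨w, hw⟩
      obtain ⟨w, rfl⟩ := Ideal.Quotient.mk_surjective w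
      rw [LinearMap.mulLeft_apply, ← map_mul, eq_comm, Ideal.Quotient.mk_eq_mk_iff_sub_mem] at hw
      have := Ideal.add_mem (J ⊔ Ideal.span {g}) (Ideal.mem_sup_left hw)
        (Ideal.mem_sup_right (Ideal.mul_mem_right w _ (Ideal.mem_span_singleton_self g)))
      rwa [sub_add_cancel] at this
  have h := LinearMap.finrank_range_add_finrank_ker l
  rw [LinearMap.range_eq_top.2 hsurj, finrank_top, hker] at h
  omega

/-- For a finite algebra `A ⧸ J` and an element `g`, the dimensions of the localization at `g` and
of the quotient by `g` add up to at most the dimension of the algebra, with equality if and only if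
`g` and `g ^ 2` generate the same ideal. -/
theorem finrank_localization_add_finrank_quotient (J : Ideal A) (g : A) [Module.Finite k (A ⧸ J)]
    (T : Type*) [CommRing T] [Algebra A T] [IsLocalization.Away g T] [Algebra k T]
    [IsScalarTower k A T] :
    Module.finrank k (T ⧸ J.map (algebraMap A T)) + Module.finrank k (A ⧸ J ⊔ Ideal.span {g}) ≤
      Module.finrank k (A ⧸ J) ∧
    (Module.finrank k (T ⧸ J.map (algebraMap A T)) + Module.finrank k (A ⧸ J ⊔ Ideal.span {g}) =
      Module.finrank k (A ⧸ J) ↔ g ∈ J ⊔ Ideal.span {g ^ 2}) := by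
  obtain ⟨e, he⟩ := finrank_localization_away (k := k) J g T
  have hq := finrank_quotient_sup_span (k := k) J g
  rw [he, ← hq]
  set γ := Ideal.Quotient.mk J g with hγ
  have hle : LinearMap.range (LinearMap.mulLeft k (γ ^ (e + 2))) ≤
      LinearMap.range (LinearMap.mulLeft k γ) := by
    rintro _ ⟨z, rfl⟩
    exact ⟨γ ^ (e + 1) * z, by simp only [LinearMap.mulLeft_apply]; ring⟩
  have hmem : g ∈ J ⊔ Ideal.span {g ^ 2} ↔ ∃ z, γ = γ ^ 2 * z := by
    constructor
    · intro h
      obtain ⟨j, hj, w, hw, h⟩ := Submodule.mem_sup.1 h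
      obtain ⟨w, rfl⟩ := Ideal.mem_span_singleton'.1 hw
      refine ⟨Ideal.Quotient.mk J w, ?_⟩
      rw [hγ, ← map_pow, ← map_mul, Ideal.Quotient.mk_eq_mk_iff_sub_mem]
      have : g - g ^ 2 * w = j := by linear_combination -h
      rwa [this]
    · rintro ⟨z, hz⟩
      obtain ⟨z, rfl⟩ := Ideal.Quotient.mk_surjective z
      rw [hγ, ← map_pow, ← map_mul, Ideal.Quotient.mk_eq_mk_iff_sub_mem] at hz
      have := Ideal.add_mem (J ⊔ Ideal.span {g ^ 2}) (Ideal.mem_sup_left hz)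
        (Ideal.mem_sup_right (Ideal.mul_mem_right z _ (Ideal.mem_span_singleton_self (g ^ 2))))
      rwa [sub_add_cancel] at this
  refine ⟨Nat.add_le_add_right (Submodule.finrank_mono hle) _, ?_⟩
  rw [Nat.add_right_cancel_iff, hmem]
  constructor
  · intro h
    have heq := Submodule.eq_of_le_of_finrank_eq hle h
    obtain ⟨z, hz⟩ : γ ∈ LinearMap.range (LinearMap.mulLeft k (γ ^ (e + 2))) := by
      rw [heq]
      exact ⟨1, by simp⟩
    simp only [LinearMap.mulLeft_apply] at hz
    exact ⟨γ ^ e * z, by rw [← mul_assoc, ← pow_add, add_comm 2 e, hz]⟩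
  · rintro ⟨z, hz⟩
    have hpow : ∀ i, γ = γ ^ (i + 1) * z ^ i := by
      intro i
      induction i with
      | zero => simp
      | succ i ih =>
        calc γ = γ ^ i * γ * z ^ i := by rw [← pow_succ]; exact ih
          _ = γ ^ i * (γ ^ 2 * z) * z ^ i := by rw [← hz]
          _ = _ := by ring
    have : LinearMap.range (LinearMap.mulLeft k (γ ^ (e + 2))) =
        LinearMap.range (LinearMap.mulLeft k γ) := by
      refine le_antisymm hle ?_
      rintro _ ⟨w, rfl⟩
      refine ⟨z ^ (e + 1) * w, ?_⟩
      simp only [LinearMap.mulLeft_apply]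
      rw [← mul_assoc, ← hpow (e + 1)]
    rw [this]

end Fitting

end ProjRat

/-! ### The general fibre -/

namespace ProjRat

open MvPolynomial IsLocalRing

section GeneralFibre

variable {k : Type*} [Field k] {n d : ℕ} {F : Fin (n + 1) → MvPolynomial (Fin (n + 1)) k}

local notation "W" => MvPolynomial (Fin n) k

/-- Away from the zeros of `F₀`, a general pencil ideal cuts out as many points as the degree of the
rational map. -/
theorem Dominant.exists_generic_fibre [IsAlgClosed k] (hdom : Dominant F) (a : Fin n → k)
    (hF : ∀ i, (F i).IsHomogeneous d) :
    ∃ p : W, p ≠ 0 ∧ ∀ c, eval c p ≠ 0 →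
      degree F = Module.finrank k (Localization.Away (dehom a (F 0)) ⧸
        (Ideal.span (Set.range fun i : Fin n => dehom a (F i.succ) - c i • dehom a (F 0))).map
          (algebraMap W (Localization.Away (dehom a (F 0))))) := by
  set φ : Fin (n + 1) → W := fun i => dehom a (F i) with hφ
  have h0 : φ 0 ≠ 0 := hdom.dehom_ne_zero a hF 0
  let T := Localization.Away (φ 0)
  let K := FractionRing W
  have hle : Submonoid.powers (φ 0) ≤ nonZeroDivisors W :=
    powers_le_nonZeroDivisors_of_noZeroDivisors h0
  let : Algebra T K := IsLocalization.localizationAlgebraOfSubmonoidLe T K _ _ hle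
  have t1 : IsScalarTower W T K :=
    IsLocalization.localization_isScalarTower_of_submonoid_le T K _ _ hle
  have t2 : IsScalarTower k T K := IsScalarTower.of_algebraMap_eq fun c => by
    rw [IsScalarTower.algebraMap_apply k W K, IsScalarTower.algebraMap_apply k W T,
      ← IsScalarTower.algebraMap_apply W T K]
  have t3 : IsFractionRing T K :=
    IsFractionRing.isFractionRing_of_isDomain_of_isLocalization (Submonoid.powers (φ 0)) T K
  have t4 : Algebra.FiniteType k T := by
    have : Algebra.FiniteType W T :=
      IsLocalization.finiteType_of_monoid_fg (Submonoid.powers (φ 0)) T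
    exact Algebra.FiniteType.trans (S := W) inferInstance this
  let y : Fin n → T := fun i => algebraMap W T (φ i.succ) * IsLocalization.Away.invSelf (φ 0)
  have hinv : algebraMap W T (φ 0) * IsLocalization.Away.invSelf (φ 0) = 1 :=
    IsLocalization.Away.mul_invSelf (φ 0)
  have hy : (fun i => algebraMap T K (y i)) = affineMap F a := by
    funext i
    have h1 := congrArg (algebraMap T K) hinv
    rw [map_mul, map_one, ← IsScalarTower.algebraMap_apply] at h1
    rw [affineMap, map_mul, ← IsScalarTower.algebraMap_apply, div_eq_mul_inv,
      eq_inv_of_mul_eq_one_right h1]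
  have hfin := hdom.finite_affineField a hF
  have hdeg := hdom.degree_eq_finrank a hF
  have halg := hdom.algebraicIndependent a hF
  rw [affineField, ← hy] at hfin hdeg
  rw [← hy] at halg
  obtain ⟨b, p, hp, hli, hb⟩ := exists_generic_basis halg
  refine ⟨p, hp, fun c hc => ?_⟩
  have h1 := finrank_fibre hli hb hc
  rw [Fintype.card_fin] at h1
  have hu : IsUnit (algebraMap W T (φ 0)) := IsUnit.of_mul_eq_one _ hinv
  have h2 : (Ideal.span (Set.range fun i : Fin n => φ i.succ - c i • φ 0)).map (algebraMap W T) =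
      Ideal.span (Set.range fun j => y j - algebraMap k T (c j)) := by
    have h3 : ∀ i, algebraMap W T (φ i.succ - c i • φ 0) =
        algebraMap W T (φ 0) * (y i - algebraMap k T (c i)) := fun i => by
      rw [map_sub, Algebra.smul_def, map_mul, ← IsScalarTower.algebraMap_apply k W T]
      simp only [y]
      linear_combination -(algebraMap W T (φ i.succ)) * hinv
    rw [Ideal.map_span, ← Set.range_comp]
    apply le_antisymm
    · rw [Ideal.span_le]
      rintro _ ⟨i, rfl⟩
      rw [Function.comp_apply, h3]
      exact Ideal.mul_mem_left _ _ (Ideal.subset_span ⟨i, rfl⟩)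
    · rw [Ideal.span_le]
      rintro _ ⟨i, rfl⟩
      rw [SetLike.mem_coe, ← Ideal.unit_mul_mem_iff_mem _ hu]
      exact Ideal.subset_span ⟨i, h3 i⟩
  rw [hdeg, ← h1]
  change _ = ((Module.finrank k (T ⧸ (Ideal.span _).map (algebraMap W T)) : ℕ) : ℕ∞)
  rw [h2]

end GeneralFibre

section LocalCriterion

variable {k : Type*} [Field k] {R : Type*} [CommRing R] [IsLocalRing R] [Algebra k R]
  {n : ℕ} {x : Fin n → R} {F : Fin (n + 1) → R} {c : Fin n → k}

/-- If the quotient by the `Fᵢ` is Gorenstein and finite over `k`, then the `Fᵢ` are linearly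
dependent modulo the product of their ideal and the maximal ideal. -/
theorem exists_relation_of_isGorensteinLocalRing
    (hres : ∀ b : R, ∃ c : k, b - algebraMap k R c ∈ maximalIdeal R) (hx : RegularFamily x)
    (hxm : Ideal.span (Set.range x) = maximalIdeal R) (hF : ∀ i, F i ∈ maximalIdeal R)
    (hpow : ∀ j, ∃ N, x j ^ N ∈ Ideal.span (Set.range fun i : Fin n => F i.succ - c i • F 0))
    [hfin : Module.Finite k (R ⧸ Ideal.span (Set.range fun i : Fin n => F i.succ - c i • F 0))]
    (h : IsGorensteinLocalRing (R ⧸ Ideal.span (Set.range F))) :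
    ∃ e : Fin (n + 1) → k, e ≠ 0 ∧
      ∑ i, e i • F i ∈ maximalIdeal R * Ideal.span (Set.range F) := by
  have := h.isLocalRing
  have hle : Ideal.span (Set.range fun i : Fin n => F i.succ - c i • F 0) ≤
      Ideal.span (Set.range F) := (span_pencil_sup c F) ▸ le_sup_left
  have : Module.Finite k (R ⧸ Ideal.span (Set.range F)) :=
    Module.Finite.of_surjective (Ideal.Quotient.factorₐ k hle).toLinearMap
      (Ideal.Quotient.factor_surjective hle)
  have hart : IsArtinianRing (R ⧸ Ideal.span (Set.range F)) := IsArtinianRing.of_finite k _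
  refine exists_relation_of_simpleSocle c hres hx hxm hpow hF
    (simpleSocle_of_baer (h.baer ?_))
  rw [← jacobson_eq_maximalIdeal ⊥ bot_ne_top]
  exact IsArtinianRing.isNilpotent_jacobson_bot

variable [IsNoetherianRing R]

/-- If `F₀` lies in a pencil ideal of finite colength, then this ideal is the ideal of all the `Fᵢ`,
and it is generated by a regular sequence. -/
theorem exists_isRegular_of_mem_pencil (hx : RegularFamily x) (hF : ∀ i, F i ∈ maximalIdeal R)
    (hpow : ∀ j, ∃ N, x j ^ N ∈ Ideal.span (Set.range fun i : Fin n => F i.succ - c i • F 0))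
    (h : F 0 ∈ Ideal.span (Set.range fun i : Fin n => F i.succ - c i • F 0)) :
    ∃ rs : List R, RingTheory.Sequence.IsRegular R rs ∧
      Ideal.ofList rs = Ideal.span (Set.range F) := by
  have hm : ∀ i : Fin n, F i.succ - c i • F 0 ∈ maximalIdeal R := fun i =>
    Ideal.sub_mem _ (hF _) (by rw [Algebra.smul_def]; exact Ideal.mul_mem_left _ _ (hF 0))
  refine ⟨_, isRegular_ofFn (regularFamily_of_pow_mem hx hm hpow) hm, ?_⟩
  rw [ofList_ofFn, ← span_pencil_sup c F, eq_comm, sup_eq_left, Ideal.span_singleton_le_iff_mem]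
  exact h

/-- If `F₀` lies in a pencil ideal of finite colength, then the quotient by the `Fᵢ` is
Gorenstein. -/
theorem isGorensteinLocalRing_of_mem_pencil
    (hres : ∀ b : R, ∃ c : k, b - algebraMap k R c ∈ maximalIdeal R) (hx : RegularFamily x)
    (hxm : Ideal.span (Set.range x) = maximalIdeal R) (hF : ∀ i, F i ∈ maximalIdeal R)
    (hpow : ∀ j, ∃ N, x j ^ N ∈ Ideal.span (Set.range fun i : Fin n => F i.succ - c i • F 0))
    [hfin : Module.Finite k (R ⧸ Ideal.span (Set.range fun i : Fin n => F i.succ - c i • F 0))]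
    (h : F 0 ∈ Ideal.span (Set.range fun i : Fin n => F i.succ - c i • F 0)) :
    IsGorensteinLocalRing (R ⧸ Ideal.span (Set.range F)) := by
  have hI : Ideal.span (Set.range F) =
      Ideal.span (Set.range fun i : Fin n => F i.succ - c i • F 0) := by
    rw [← span_pencil_sup c F, sup_eq_left, Ideal.span_singleton_le_iff_mem]
    exact h
  have hne : Ideal.span (Set.range F) ≠ ⊤ := fun htop => (maximalIdeal.isMaximal R).ne_top
    (top_le_iff.1 (htop ▸ Ideal.span_le.2 (by rintro _ ⟨i, rfl⟩; exact hF i)))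
  rw [hI] at hne ⊢
  have : Nontrivial (R ⧸ Ideal.span (Set.range fun i : Fin n => F i.succ - c i • F 0)) :=
    Ideal.Quotient.nontrivial_iff.2 hne
  have : IsLocalRing (R ⧸ Ideal.span (Set.range fun i : Fin n => F i.succ - c i • F 0)) :=
    IsLocalRing.of_surjective' _ Ideal.Quotient.mk_surjective
  exact isGorensteinLocalRing_of_baer ((simpleSocle_quotient hx hxm hpow).baer
    (exists_sub_algebraMap_mem_quotient hres _))

/-- A finite local `k`-algebra of length at most two, with residue field `k`, is Gorenstein. -/
theorem isGorensteinLocalRing_of_length_le {B : Type*} [CommRing B] [IsLocalRing B] [Algebra k B]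
    [Module.Finite k B] (hres : ∀ b : B, ∃ c : k, b - algebraMap k B c ∈ maximalIdeal B)
    (h : Module.length B B ≤ 2) : IsGorensteinLocalRing B :=
  have : IsNoetherianRing B := isNoetherian_of_tower k inferInstance
  isGorensteinLocalRing_of_baer ((simpleSocle_of_length_le h).baer hres)

end LocalCriterion

end ProjRat

/-! ### The local criterion at the points of the base locus -/

namespace ProjRat

open MvPolynomial IsLocalRing

section Pencil

variable {k : Type*} [Field k] {n : ℕ}

local notation "W" => MvPolynomial (Fin n) k

/-- The ideal generated by the `φᵢ - cᵢ φ₀` with `i > 0`: the preimage of the point `(1 : c)` under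
the map with coordinates `φ`, together with the common zeros of `φ`. -/
def pencilIdeal (φ : Fin (n + 1) → W) (c : Fin n → k) : Ideal W :=
  Ideal.span (Set.range fun i : Fin n => φ i.succ - c i • φ 0)

/-- The pencil ideal and `φ₀` generate the ideal of the base scheme. -/
theorem pencilIdeal_sup (φ : Fin (n + 1) → W) (c : Fin n → k) :
    pencilIdeal φ c ⊔ Ideal.span {φ 0} = Ideal.span (Set.range φ) := span_pencil_sup c φ

theorem map_pencilIdeal {R : Type*} [CommRing R] [Algebra W R] [Algebra k R] [IsScalarTower k W R]
    (φ : Fin (n + 1) → W) (c : Fin n → k) :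
    (pencilIdeal φ c).map (algebraMap W R) = Ideal.span (Set.range fun i : Fin n =>
      algebraMap W R (φ i.succ) - c i • algebraMap W R (φ 0)) := by
  rw [pencilIdeal, Ideal.map_span, ← Set.range_comp]
  congr 2
  funext i
  simp only [Function.comp_apply, map_sub, Algebra.smul_def, map_mul]
  rw [← IsScalarTower.algebraMap_apply]

theorem map_span_range {R : Type*} [CommRing R] [Algebra W R] (φ : Fin (n + 1) → W) :
    (Ideal.span (Set.range φ)).map (algebraMap W R) =
      Ideal.span (Set.range fun i => algebraMap W R (φ i)) := by
  rw [Ideal.map_span, ← Set.range_comp]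
  rfl

/-- A linear dependence modulo the product of the ideal of the `φᵢ` and the maximal ideal forces
`φ₀` into every pencil ideal that it does not degenerate. -/
theorem algebraMap_mem_map_pencilIdeal (P : Ideal W) [hP : P.IsMaximal]
    (R : Type*) [CommRing R] [Algebra W R] [IsLocalization.AtPrime R P]
    {φ : Fin (n + 1) → W} {c : Fin n → k}
    {e : Fin (n + 1) → k}
    (hrel : algebraMap W R (∑ i, e i • φ i) ∈
      P.map (algebraMap W R) * (Ideal.span (Set.range φ)).map (algebraMap W R))
    (hc : e 0 + ∑ i : Fin n, e i.succ * c i ≠ 0) :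
    algebraMap W R (φ 0) ∈ (pencilIdeal φ c).map (algebraMap W R) := by
  let : Algebra k R := ((algebraMap W R).comp (algebraMap k W)).toAlgebra
  have : IsScalarTower k W R := IsScalarTower.of_algebraMap_eq fun _ => rfl
  have : IsLocalRing R := IsLocalization.AtPrime.isLocalRing R P
  have : IsNoetherianRing R := IsLocalization.isNoetherianRing P.primeCompl R inferInstance
  have hsum : algebraMap W R (∑ i, e i • φ i) = ∑ i, e i • algebraMap W R (φ i) := by
    rw [map_sum]
    refine Finset.sum_congr rfl fun i _ => ?_
    rw [Algebra.smul_def, Algebra.smul_def, map_mul, ← IsScalarTower.algebraMap_apply]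
  rw [hsum, IsLocalization.AtPrime.map_eq_maximalIdeal P R, map_span_range] at hrel
  rw [map_pencilIdeal]
  exact mem_span_pencil_of_relation (F := fun i => algebraMap W R (φ i)) c hrel hc

variable [IsAlgClosed k]

/-- If the local ring of the base scheme at `P` is a complete intersection or Gorenstein, then the
`φᵢ` are linearly dependent modulo the product of their ideal and the maximal ideal. -/
theorem exists_relation_of_isRegular_or_isGorenstein (P : Ideal W) [hP : P.IsMaximal]
    (R : Type*) [CommRing R] [Algebra W R] [IsLocalization.AtPrime R P]
    {φ : Fin (n + 1) → W} (hφ : ∀ i, φ i ∈ P) {c : Fin n → k}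
    [hfin : Module.Finite k (W ⧸ pencilIdeal φ c)]
    (h : (∃ rs : List R, RingTheory.Sequence.IsRegular R rs ∧
      Ideal.ofList rs = (Ideal.span (Set.range φ)).map (algebraMap W R)) ∨
      IsGorensteinLocalRing (R ⧸ (Ideal.span (Set.range φ)).map (algebraMap W R))) :
    ∃ e : Fin (n + 1) → k, e ≠ 0 ∧ algebraMap W R (∑ i, e i • φ i) ∈
      P.map (algebraMap W R) * (Ideal.span (Set.range φ)).map (algebraMap W R) := by
  let : Algebra k R := ((algebraMap W R).comp (algebraMap k W)).toAlgebra
  have : IsScalarTower k W R := IsScalarTower.of_algebraMap_eq fun _ => rfl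
  have : IsLocalRing R := IsLocalization.AtPrime.isLocalRing R P
  have : IsNoetherianRing R := IsLocalization.isNoetherianRing P.primeCompl R inferInstance
  obtain ⟨y, hyP, hy, hym⟩ := exists_regularFamily_maximalIdeal P R
  have hres := exists_sub_algebraMap_mem_maximalIdeal P (R := R)
  have hm := IsLocalization.AtPrime.map_eq_maximalIdeal P R
  have hF : ∀ i, algebraMap W R (φ i) ∈ maximalIdeal R := fun i =>
    hm ▸ Ideal.mem_map_of_mem _ (hφ i)
  have hpow : ∀ j, ∃ N, algebraMap W R (y j) ^ N ∈ (pencilIdeal φ c).map (algebraMap W R) :=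
    fun j => exists_pow_mem_map (hyP j)
  have hq : Module.Finite k (R ⧸ (pencilIdeal φ c).map (algebraMap W R)) :=
    finite_quotient_map P R _
  rw [map_pencilIdeal] at hq hpow
  have hsum : ∀ e : Fin (n + 1) → k, algebraMap W R (∑ i, e i • φ i) =
      ∑ i, e i • algebraMap W R (φ i) := fun e => by
    rw [map_sum]
    refine Finset.sum_congr rfl fun i _ => ?_
    rw [Algebra.smul_def, Algebra.smul_def, map_mul, ← IsScalarTower.algebraMap_apply]
  simp only [hsum]
  rw [map_span_range] at h ⊢
  rw [hm]
  rcases h with ⟨rs, hreg, hrs⟩ | h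
  · exact exists_relation_of_isRegular hres hym hreg hrs
  · exact exists_relation_of_isGorensteinLocalRing hres hy hym hF hpow h

/-- If `φ₀` lies in a pencil ideal locally at `P`, then the local ring of the base scheme is a
complete intersection and Gorenstein. -/
theorem isRegular_and_isGorenstein_of_mem (P : Ideal W) [hP : P.IsMaximal]
    (R : Type*) [CommRing R] [Algebra W R] [IsLocalization.AtPrime R P]
    {φ : Fin (n + 1) → W} (hφ : ∀ i, φ i ∈ P) {c : Fin n → k}
    [hfin : Module.Finite k (W ⧸ pencilIdeal φ c)]
    (h : algebraMap W R (φ 0) ∈ (pencilIdeal φ c).map (algebraMap W R)) :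
    (∃ rs : List R, RingTheory.Sequence.IsRegular R rs ∧
      Ideal.ofList rs = (Ideal.span (Set.range φ)).map (algebraMap W R)) ∧
    IsGorensteinLocalRing (R ⧸ (Ideal.span (Set.range φ)).map (algebraMap W R)) := by
  let : Algebra k R := ((algebraMap W R).comp (algebraMap k W)).toAlgebra
  have : IsScalarTower k W R := IsScalarTower.of_algebraMap_eq fun _ => rfl
  have : IsLocalRing R := IsLocalization.AtPrime.isLocalRing R P
  have : IsNoetherianRing R := IsLocalization.isNoetherianRing P.primeCompl R inferInstance
  obtain ⟨y, hyP, hy, hym⟩ := exists_regularFamily_maximalIdeal P R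
  have hres := exists_sub_algebraMap_mem_maximalIdeal P (R := R)
  have hm := IsLocalization.AtPrime.map_eq_maximalIdeal P R
  have hF : ∀ i, algebraMap W R (φ i) ∈ maximalIdeal R := fun i =>
    hm ▸ Ideal.mem_map_of_mem _ (hφ i)
  have hpow : ∀ j, ∃ N, algebraMap W R (y j) ^ N ∈ (pencilIdeal φ c).map (algebraMap W R) :=
    fun j => exists_pow_mem_map (hyP j)
  have hq : Module.Finite k (R ⧸ (pencilIdeal φ c).map (algebraMap W R)) :=
    finite_quotient_map P R _
  rw [map_pencilIdeal] at hq hpow h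
  rw [map_span_range]
  exact ⟨exists_isRegular_of_mem_pencil hy hF hpow h,
    isGorensteinLocalRing_of_mem_pencil hres hy hym hF hpow h⟩

/-- A point of length at most two of the base scheme is Gorenstein. -/
theorem isGorensteinLocalRing_quotient_of_length_le (P : Ideal W) [hP : P.IsMaximal]
    (R : Type*) [CommRing R] [Algebra W R] [IsLocalization.AtPrime R P]
    {φ : Fin (n + 1) → W} (hφ : ∀ i, φ i ∈ P)
    [hfin : Module.Finite k (W ⧸ Ideal.span (Set.range φ))]
    (h : Module.length (R ⧸ (Ideal.span (Set.range φ)).map (algebraMap W R))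
      (R ⧸ (Ideal.span (Set.range φ)).map (algebraMap W R)) ≤ 2) :
    IsGorensteinLocalRing (R ⧸ (Ideal.span (Set.range φ)).map (algebraMap W R)) := by
  let : Algebra k R := ((algebraMap W R).comp (algebraMap k W)).toAlgebra
  have : IsScalarTower k W R := IsScalarTower.of_algebraMap_eq fun _ => rfl
  have : IsLocalRing R := IsLocalization.AtPrime.isLocalRing R P
  have : Module.Finite k (R ⧸ (Ideal.span (Set.range φ)).map (algebraMap W R)) :=
    finite_quotient_map P R _
  have hne : (Ideal.span (Set.range φ)).map (algebraMap W R) ≠ ⊤ := fun htop =>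
    (maximalIdeal.isMaximal R).ne_top (top_le_iff.1 (htop ▸ by
      rw [map_span_range, Ideal.span_le]
      rintro _ ⟨i, rfl⟩
      exact IsLocalization.AtPrime.map_eq_maximalIdeal P R ▸ Ideal.mem_map_of_mem _ (hφ i)))
  have : Nontrivial (R ⧸ (Ideal.span (Set.range φ)).map (algebraMap W R)) :=
    Ideal.Quotient.nontrivial_iff.2 hne
  have : IsLocalRing (R ⧸ (Ideal.span (Set.range φ)).map (algebraMap W R)) :=
    IsLocalRing.of_surjective' _ Ideal.Quotient.mk_surjective
  exact isGorensteinLocalRing_of_length_le (exists_sub_algebraMap_mem_quotient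
    (exists_sub_algebraMap_mem_maximalIdeal P (R := R)) _) h

end Pencil

end ProjRat

/-! ### The inequality and the case of equality -/

namespace ProjRat

open MvPolynomial IsLocalRing

section Points

variable {k : Type*} [Field k] {n d : ℕ} {F : Fin (n + 1) → MvPolynomial (Fin (n + 1)) k}
  (a : Fin n → k) {Q : PSpace k n}

local notation "W" => MvPolynomial (Fin n) k

theorem isMaximal_of_finite_quotient {P I : Ideal W} [hP : P.IsPrime] (hle : I ≤ P)
    [Module.Finite k (W ⧸ I)] : P.IsMaximal := by
  have : Module.Finite k (W ⧸ P) :=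
    Module.Finite.of_surjective (Ideal.Quotient.factorₐ k hle).toLinearMap
      (Ideal.Quotient.factor_surjective hle)
  have : IsArtinianRing (W ⧸ P) := IsArtinianRing.of_finite k _
  exact Ideal.Quotient.maximal_of_isField P (IsArtinianRing.isField_of_isDomain _)

theorem mem_chartIdeal (ha : linForm a ∉ Q.asHomogeneousIdeal) (hF : ∀ i, (F i).IsHomogeneous d)
    (hQ : Q ∈ baseLocus F) (i : Fin (n + 1)) : dehom a (F i) ∈ chartIdeal a Q ha :=
  (mem_baseLocus_iff a Q ha hF).1 hQ (Ideal.subset_span ⟨i, rfl⟩)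

theorem isMaximal_chartIdeal (ha : linForm a ∉ Q.asHomogeneousIdeal)
    (hF : ∀ i, (F i).IsHomogeneous d) (hQ : Q ∈ baseLocus F)
    [Module.Finite k (W ⧸ Ideal.span (Set.range fun i => dehom a (F i)))] :
    (chartIdeal a Q ha).IsMaximal :=
  isMaximal_of_finite_quotient ((mem_baseLocus_iff a Q ha hF).1 hQ)

/-- Membership in the extension of an ideal to the local ring of a point, expressed in affine
coordinates. -/
theorem chart_mem_map_iff (ha : linForm a ∉ Q.asHomogeneousIdeal) (J : Ideal W) (w : W) :
    chart a Q ha w ∈ J.map (chart a Q ha) ↔ ∃ s ∉ chartIdeal a Q ha, s * w ∈ J := by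
  let := (chart a Q ha).toAlgebra
  have := isLocalization_chart a Q ha
  refine (IsLocalization.algebraMap_mem_map_algebraMap_iff (chartIdeal a Q ha).primeCompl
    (LocalRing Q) J w).trans ?_
  rfl

end Points

end ProjRat

end

open ProjRat MvPolynomial

theorem mainTheorem5 {k : Type*} [Field k] [IsAlgClosed k] (n d : ℕ)
    (F : Fin (n + 1) → MvPolynomial (Fin (n + 1)) k)
    (hF : ∀ i, (F i).IsHomogeneous d)
    (hfin : (ProjRat.baseLocus F).Finite)
    (hdom : ProjRat.Dominant F) :
    ProjRat.degree F + ProjRat.totalLength F hfin ≤ (d : ℕ∞) ^ n ∧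
    List.TFAE [
      ProjRat.degree F + ProjRat.totalLength F hfin = (d : ℕ∞) ^ n,
      ProjRat.IsLocalCompleteIntersection F,
      ProjRat.IsGorenstein F] ∧
    ((∀ Q ∈ ProjRat.baseLocus F, ProjRat.lengthAt F Q = 1 ∨ ProjRat.lengthAt F Q = 2) →
      ProjRat.degree F + ProjRat.totalLength F hfin = (d : ℕ∞) ^ n) := by
  classical
  have := hfin.fintype
  obtain ⟨a, ha⟩ := exists_linForm_notMem hfin
  set φ : Fin (n + 1) → MvPolynomial (Fin n) k := fun i => dehom a (F i) with hφ
  obtain ⟨p₁, hp₁, hfibre⟩ := hdom.exists_generic_fibre a hF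
  obtain ⟨p₂, hp₂, hpencil⟩ := hdom.exists_generic_pencil hF ha
  -- the pencil ideal has codimension `d ^ n` for general `c`
  have hbezout : ∀ c, eval c p₂ ≠ 0 →
      Module.Finite k (MvPolynomial (Fin n) k ⧸ pencilIdeal φ c) ∧
        Module.finrank k (MvPolynomial (Fin n) k ⧸ pencilIdeal φ c) = d ^ n := fun c hc => by
    have h := bezout a (fun i => (hF i.succ).sub
      ((homogeneousSubmodule _ k d).smul_mem (c i) (hF 0)))
      (fun hn => hdom.degree_ne_zero hF hn) (hpencil c hc)
    have hG : (fun i : Fin n => dehom a (F i.succ - c i • F 0)) =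
        fun i => φ i.succ - c i • φ 0 := by
      simp only [map_sub, map_smul, hφ]
    rwa [hG] at h
  have hpoint : ∀ p : MvPolynomial (Fin n) k, p ≠ 0 → ∃ c, eval c p ≠ 0 := fun p hp => by
    by_contra! h
    exact hp (MvPolynomial.funext fun c => by rw [h c, map_zero])
  obtain ⟨c₀, hc₀⟩ := hpoint p₂ hp₂
  have hfin₀ := (hbezout c₀ hc₀).1
  have hle : pencilIdeal φ c₀ ≤ Ideal.span (Set.range φ) := pencilIdeal_sup φ c₀ ▸ le_sup_left
  have hfinI : Module.Finite k (MvPolynomial (Fin n) k ⧸ Ideal.span (Set.range φ)) :=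
    Module.Finite.of_surjective (Ideal.Quotient.factorₐ k hle).toLinearMap
      (Ideal.Quotient.factor_surjective hle)
  have hmax : ∀ Q : baseLocus F, (chartIdeal a Q.1 (ha Q.1 Q.2)).IsMaximal := fun Q =>
    isMaximal_chartIdeal a _ hF Q.2
  have hmem : ∀ (Q : baseLocus F) (i), φ i ∈ chartIdeal a Q.1 (ha Q.1 Q.2) := fun Q =>
    mem_chartIdeal a _ hF Q.2
  -- at each point that satisfies one of the local conditions, the relation `e` puts `F₀` into the
  -- pencil ideals of all `c` outside a hyperplane; the relation is found with the auxiliary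
  -- point `c₀`
  have hrel : ∀ Q : baseLocus F, ∃ e : Fin (n + 1) → k, e ≠ 0 ∧
      ((∃ rs : List (LocalRing Q.1), RingTheory.Sequence.IsRegular (LocalRing Q.1) rs ∧
          Ideal.ofList rs = localIdeal F Q.1) ∨ IsGorensteinLocalRing (BaseLocalRing F Q.1) →
        ∀ c, eval c p₂ ≠ 0 → e 0 + ∑ i : Fin n, e i.succ * c i ≠ 0 →
          chart a Q.1 (ha Q.1 Q.2) (φ 0) ∈ (pencilIdeal φ c).map (chart a Q.1 (ha Q.1 Q.2))) := by
    intro Q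
    by_cases h : (∃ rs : List (LocalRing Q.1), RingTheory.Sequence.IsRegular (LocalRing Q.1) rs ∧
        Ideal.ofList rs = localIdeal F Q.1) ∨ IsGorensteinLocalRing (BaseLocalRing F Q.1)
    · let := (chart a Q.1 (ha Q.1 Q.2)).toAlgebra
      have := isLocalization_chart a Q.1 (ha Q.1 Q.2)
      have h' := h
      change _ ∨ IsGorensteinLocalRing (LocalRing Q.1 ⧸ localIdeal F Q.1) at h'
      rw [localIdeal_eq_map a Q.1 (ha Q.1 Q.2) hF] at h'
      obtain ⟨e, he, hr⟩ := exists_relation_of_isRegular_or_isGorenstein _ (LocalRing Q.1) (hmem Q)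
        (c := c₀) h'
      refine ⟨e, he, fun _ c hc hec => ?_⟩
      have := (hbezout c hc).1
      exact algebraMap_mem_map_pencilIdeal _ (LocalRing Q.1) hr hec
    · exact ⟨1, one_ne_zero, fun h' => absurd h' h⟩
  choose e he hrel using hrel
  let q : baseLocus F → MvPolynomial (Fin n) k := fun Q =>
    C (e Q 0) + ∑ i : Fin n, C (e Q i.succ) * X i
  have hq : ∀ Q c, eval c (q Q) = e Q 0 + ∑ i : Fin n, e Q i.succ * c i := fun Q c => by
    simp [q]
  have hq0 : ∀ Q, q Q ≠ 0 := by
    intro Q h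
    have h1 : ∀ c : Fin n → k, e Q 0 + ∑ i : Fin n, e Q i.succ * c i = 0 := fun c => by
      rw [← hq, h, map_zero]
    have h0 : e Q 0 = 0 := by simpa using h1 0
    refine he Q (_root_.funext fun i => Fin.cases h0 (fun i => ?_) i)
    have h2 := h1 (Pi.single i 1)
    simpa [h0, Pi.single_apply] using h2
  -- a point `c` that is general for the fibre, for Bézout's theorem and for all the relations
  obtain ⟨c, hc⟩ := hpoint (p₁ * p₂ * ∏ Q, q Q)
    (mul_ne_zero (mul_ne_zero hp₁ hp₂) (Finset.prod_ne_zero_iff.2 fun Q _ => hq0 Q))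
  rw [map_mul, map_mul, map_prod] at hc
  have hc₁ := left_ne_zero_of_mul (left_ne_zero_of_mul hc)
  have hc₂ := right_ne_zero_of_mul (left_ne_zero_of_mul hc)
  have hc₃ : ∀ Q, e Q 0 + ∑ i : Fin n, e Q i.succ * c i ≠ 0 := fun Q =>
    hq Q c ▸ Finset.prod_ne_zero_iff.1 (right_ne_zero_of_mul hc) Q (Finset.mem_univ Q)
  obtain ⟨hfinc, hdim⟩ := hbezout c hc₂
  obtain ⟨hineq, heq⟩ := finrank_localization_add_finrank_quotient (k := k) (pencilIdeal φ c) (φ 0)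
    (Localization.Away (φ 0))
  have hdeg : degree F = Module.finrank k (Localization.Away (φ 0) ⧸
    (pencilIdeal φ c).map (algebraMap _ (Localization.Away (φ 0)))) := hfibre c hc₁
  rw [pencilIdeal_sup, hdim] at hineq heq
  rw [hdeg, totalLength_eq_finrank hF hfin ha]
  -- equality means that `F₀` lies in the pencil ideal at every point of the base locus
  have hlocal : φ 0 ∈ pencilIdeal φ c ⊔ Ideal.span {φ 0 ^ 2} ↔ ∀ Q : baseLocus F,
      chart a Q.1 (ha Q.1 Q.2) (φ 0) ∈ (pencilIdeal φ c).map (chart a Q.1 (ha Q.1 Q.2)) := by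
    simp only [chart_mem_map_iff]
    constructor
    · intro h Q
      obtain ⟨j, hj, w, hw, h⟩ := Submodule.mem_sup.1 h
      obtain ⟨w, rfl⟩ := Ideal.mem_span_singleton'.1 hw
      refine ⟨1 - w * φ 0, fun h1 => (hmax Q).ne_top ((Ideal.eq_top_iff_one _).2 ?_), ?_⟩
      · have := Ideal.add_mem _ h1 (Ideal.mul_mem_left _ w (hmem Q 0))
        rwa [sub_add_cancel] at this
      · rwa [show (1 - w * φ 0) * φ 0 = j by linear_combination -h]
    · intro h
      refine mem_sup_span_sq_of_forall fun P hP hJ h0 => ?_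
      have hQ : pointOf a P ∈ baseLocus F := by
        rw [mem_baseLocus_iff a _ (linForm_notMem_pointOf a P) hF, chartIdeal_pointOf, ← hφ,
          ← pencilIdeal_sup φ c]
        exact sup_le hJ ((Ideal.span_singleton_le_iff_mem _).2 h0)
      have h1 := h ⟨_, hQ⟩
      rwa [chartIdeal_pointOf] at h1
  rw [hlocal] at heq
  have hcast : ∀ x y : ℕ, (x : ℕ∞) + y = (d : ℕ∞) ^ n ↔ x + y = d ^ n := fun x y => by
    norm_cast
  rw [hcast, heq]
  have hforward : (∀ Q : baseLocus F,
      chart a Q.1 (ha Q.1 Q.2) (φ 0) ∈ (pencilIdeal φ c).map (chart a Q.1 (ha Q.1 Q.2))) →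
      IsLocalCompleteIntersection F ∧ IsGorenstein F := by
    intro h
    have h1 : ∀ Q ∈ baseLocus F, (∃ rs : List (LocalRing Q),
        RingTheory.Sequence.IsRegular (LocalRing Q) rs ∧ Ideal.ofList rs = localIdeal F Q) ∧
          IsGorensteinLocalRing (BaseLocalRing F Q) := by
      intro Q hQ
      let := (chart a Q (ha Q hQ)).toAlgebra
      have := isLocalization_chart a Q (ha Q hQ)
      have := hmax ⟨Q, hQ⟩
      change _ ∧ IsGorensteinLocalRing (LocalRing Q ⧸ localIdeal F Q)
      rw [localIdeal_eq_map a Q (ha Q hQ) hF]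
      exact isRegular_and_isGorenstein_of_mem _ (LocalRing Q) (hmem ⟨Q, hQ⟩) (h ⟨Q, hQ⟩)
    exact ⟨fun Q hQ => (h1 Q hQ).1, fun Q hQ => (h1 Q hQ).2⟩
  have hgor : IsGorenstein F → ∀ Q : baseLocus F,
      chart a Q.1 (ha Q.1 Q.2) (φ 0) ∈ (pencilIdeal φ c).map (chart a Q.1 (ha Q.1 Q.2)) :=
    fun h Q => hrel Q (Or.inr (h Q.1 Q.2)) c hc₂ (hc₃ Q)
  refine ⟨by exact_mod_cast hineq, ?_, fun h => hgor fun Q hQ => ?_⟩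
  · tfae_have 1 → 2 := fun h => (hforward h).1
    tfae_have 1 → 3 := fun h => (hforward h).2
    tfae_have 2 → 1 := fun h Q => hrel Q (Or.inl (h Q.1 Q.2)) c hc₂ (hc₃ Q)
    tfae_have 3 → 1 := hgor
    tfae_finish
  · let := (chart a Q (ha Q hQ)).toAlgebra
    have := isLocalization_chart a Q (ha Q hQ)
    have := hmax ⟨Q, hQ⟩
    have h1 : lengthAt F Q ≤ 2 := by
      rcases h Q hQ with h | h <;> rw [h]
      exact one_le_two
    change Module.length (LocalRing Q ⧸ localIdeal F Q) (LocalRing Q ⧸ localIdeal F Q) ≤ 2 at h1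
    change IsGorensteinLocalRing (LocalRing Q ⧸ localIdeal F Q)
    rw [localIdeal_eq_map a Q (ha Q hQ) hF] at h1
    rw [localIdeal_eq_map a Q (ha Q hQ) hF]
    exact isGorensteinLocalRing_quotient_of_length_le _ (LocalRing Q) (hmem ⟨Q, hQ⟩) h1
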